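/- Let $F_n$ be the free group of rank $n$, and let $CV_n$ be Culler–Vogtmann's Outer Space: marked metric graphs $A$ of rank $n$ with all vertices of valence at least three, up to homotopy-compatible homothety, topologized as a subspace of $\mathbb R^{F_n}/\text{homothety}$ by the length functions $l_A$, where $l_A(w)$ is the length of the shortest loop of $A$ in the free homotopy class of $w\in F_n$ (equivalently the translation length of $w$ on the universal cover $T_A$). Let $\bar A$ be the representative of volume one, and put $$\Lambda_R(A,B)=\sup_{1\ne w\in F_n}\frac{l_B(w)}{l_A(w)},\qquad d_R(A,B)=\log\Lambda_R(\bar A,\bar B),\qquad d(A,B)=\log\bigl(\Lambda_R(A,B)\Lambda_R(B,A)\bigr).$$ The $\varepsilon$-thick part of $CV_n$ is the set of all $A$ with $l_{\bar A}(w)\ge\varepsilon$ for every $w\neq1$. A right-geodesic from $A$ to $B$ is a continuous path $\alpha:[0,d_R(A,B)]\to CV_n$ from $A$ to $B$ with $d_R(\alpha(s),\alpha(t))=t-s$ for $s\le t$. A path $\alpha:I\to CV_n$ is a $(K,L)$-quasi-geodesic for $d$ if $\frac1K|x-y|-L\le d(\alpha(x),\alpha(y))\le K|x-y|+L$ for all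 $x,y\in I$. A PL-map $f:A\to B$ is a map in the homotopy class given by the markings that has constant speed on every edge. It is optimal if there is no vertex $v$ of the subgraph $A_{\max}$ of maximally stretched edges such that the images of all the edges of $A_{\max}$ at $v$ share an initial segment. Given an optimal $f:A\to \bar B$, let $A_0$ be the marked metric graph obtained from $A$ by changing the length of each edge $e$ to the length of $f(e)$ (collapsing the edges on which $f$ is constant), so that $f$ induces a map $f_0:A_0\to\bar B$ that is isometric on edges. A fast folding path from $A_0$ to $\bar B$ is a path $t\mapsto A_t$, $t\in[0,\bar t\,]$, in $CV_n$, with maps $f_t:A_t\to\bar B$, obtained as follows for some times $0=t_0<t_1<\dots<t_N=\bar t$. At time $t_i$, subdivide $A_{t_i}$ and $\bar B$ so that $f_{t_i}$ is simplicial and isometric on edges, and let $t_{i+1}-t_i$ be the smallest length of an edge of $A_{t_i}$ that shares an endpoint and its image with another edge (on universal covers). For $t\in[t_i,t_{i+1}]$, the universal cover of $A_t$ is the quotient of that of $A_{t_i}$, with the metric for which the projection is isometric on edges, by the equivalence relation generated by $x\sim y$ whenever $x$ and $y$ have the same image under the lift of $f_{t_i}$ and both are at distance at most $t-t_i$ from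 a common vertex; $f_t$ is the induced map. Finally, $f_{\bar t}$ is an isometry. **Theorem.** For every $n$ and every $\varepsilon>0$ there are constants $K\ge1$ and $L\ge0$, depending only on $\varepsilon$ and $n$, such that the following holds. Let $A,B$ be marked metric graphs of rank $n$ such that a fast folding path $t\mapsto A_t$ from $A_0$ to $\bar B$, guided by some optimal map $A\to\bar B$, stays in the $\varepsilon$-thick part of $CV_n$. Then there is a right-geodesic from $A$ to $B$ that is a $(K,L)$-quasi-geodesic for $d$. -/

import Mathlib

open Set Topology

namespace OuterSpace

/-! ### Real trees and simplicial structures -/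

section Trees

variable {X : Type} [MetricSpace X]

/-- The segment between two points of a metric space. -/
def seg (x y : X) : Set X := {z | dist x z + dist z y = dist x y}

/-- A (nonempty) real tree: a geodesic metric space that satisfies the four point condition. -/
structure IsRealTree (X : Type) [MetricSpace X] : Prop where
  nonempty : Nonempty X
  geodesic : ∀ x y : X, ∃ γ : ℝ → X, γ 0 = x ∧ γ (dist x y) = y ∧
    ∀ s ∈ Icc 0 (dist x y), ∀ t ∈ Icc 0 (dist x y), dist (γ s) (γ t) = |s - t|
  fourPoint : ∀ x y z w : X,
    dist x y + dist z w ≤ max (dist x z + dist y w) (dist x w + dist y z)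

/-- The branch points of a tree, i.e. the points of valence at least three: there are three points
different from `x` such that `x` lies between any two of them. -/
def branchPoints (X : Type) [MetricSpace X] : Set X :=
  {x | ∃ a b c : X, a ≠ x ∧ b ≠ x ∧ c ≠ x ∧ x ∈ seg a b ∧ x ∈ seg b c ∧ x ∈ seg a c}

/-- The (oriented) edges determined by a vertex set `V`: pairs of distinct vertices with no
vertex strictly between them. The edge itself is `seg v w`. -/
def IsEdge (V : Set X) (v w : X) : Prop :=
  v ∈ V ∧ w ∈ V ∧ v ≠ w ∧ ∀ z ∈ seg v w, z ∈ V → z = v ∨ z = w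

/-- `V` is the vertex set of an equivariant simplicial structure with finite quotient on the tree
`X` with its action of `G`. Vertices of valence two are allowed here, so that `V` may be any
(finite, equivariant) subdivision. -/
structure IsVertexSet (G : Type) [Group G] [MulAction G X] (V : Set X) : Prop where
  smul_mem : ∀ (g : G), ∀ v ∈ V, g • v ∈ V
  finite_vertices : ∃ S : Set X, S.Finite ∧ ∀ v ∈ V, ∃ g : G, ∃ u ∈ S, g • u = v
  finite_edges : ∃ S : Set (X × X), S.Finite ∧
    ∀ v w, IsEdge V v w → ∃ g : G, ∃ p ∈ S, g • p.1 = v ∧ g • p.2 = w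
  separated : ∃ δ > 0, ∀ v ∈ V, ∀ w ∈ V, v ≠ w → δ ≤ dist v w
  edge_nhds : ∀ x, x ∉ V → ∃ v w, IsEdge V v w ∧ x ∈ seg v w ∧ seg v w ∈ 𝓝 x

end Trees

/-! ### Marked metric graphs of rank `n`, through their universal covers -/

/-- A marked metric graph of rank `n` all of whose vertices have valence at least three (a point of
the unprojectivised Outer Space), given as its universal cover: a simplicial real tree with a
minimal free isometric action of the free group of rank `n`. -/
structure MarkedTree (n : ℕ) where
  pt : Type
  [metric : MetricSpace pt]
  [action : MulAction (FreeGroup (Fin n)) pt]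
  realTree : IsRealTree pt
  dist_smul : ∀ (g : FreeGroup (Fin n)) (x y : pt), dist (g • x) (g • y) = dist x y
  free : ∀ (g : FreeGroup (Fin n)) (x : pt), g • x = x → g = 1
  minimal : ∀ S : Set pt, S.Nonempty → (∀ (g : FreeGroup (Fin n)), ∀ x ∈ S, g • x ∈ S) →
    (∀ x ∈ S, ∀ y ∈ S, seg x y ⊆ S) → S = univ
  simplicial : IsVertexSet (FreeGroup (Fin n)) (branchPoints pt)

attribute [instance] MarkedTree.metric MarkedTree.action

instance (n : ℕ) : CoeSort (MarkedTree n) Type := ⟨MarkedTree.pt⟩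

namespace MarkedTree

variable {n : ℕ}

/-- The edges of the tree (lifts of the oriented edges of the graph); the vertices are the points
of valence at least three. -/
def Edge (A : MarkedTree n) (v w : A) : Prop := IsEdge (branchPoints A) v w

/-- Translation length of `w`, i.e. the length of the shortest loop in the free homotopy class
given by `w`. -/
noncomputable def len (A : MarkedTree n) (w : FreeGroup (Fin n)) : ℝ :=
  ⨅ p : A, dist p (w • p)

/-- The oriented edges of the tree. -/
def OEdge (A : MarkedTree n) : Type := {p : A × A // A.Edge p.1 p.2}

/-- Two oriented edges of the tree are equivalent if they are lifts of the same oriented edge of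
the quotient graph. -/
def edgeSetoid (A : MarkedTree n) : Setoid A.OEdge where
  r e e' := ∃ g : FreeGroup (Fin n), g • e.1.1 = e'.1.1 ∧ g • e.1.2 = e'.1.2
  iseqv :=
    { refl := fun e => ⟨1, one_smul _ _, one_smul _ _⟩
      symm := by
        rintro e e' ⟨g, h1, h2⟩
        exact ⟨g⁻¹, by rw [← h1, inv_smul_smul], by rw [← h2, inv_smul_smul]⟩
      trans := by
        rintro e e' e'' ⟨g, h1, h2⟩ ⟨k, h3, h4⟩
        exact ⟨k * g, by rw [mul_smul, h1, h3], by rw [mul_smul, h2, h4]⟩ }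

/-- The oriented edges of the quotient graph. -/
def GraphEdge (A : MarkedTree n) : Type := Quotient A.edgeSetoid

/-- The length of an oriented edge of the quotient graph. -/
noncomputable def edgeLen (A : MarkedTree n) : A.GraphEdge → ℝ :=
  Quotient.lift (fun e : A.OEdge => dist e.1.1 e.1.2) (by
    rintro e e' ⟨g, h1, h2⟩
    show dist e.1.1 e.1.2 = dist e'.1.1 e'.1.2
    rw [← h1, ← h2, A.dist_smul])

/-- The volume of the quotient graph: the sum of the lengths of its edges. Every edge is counted
with its two orientations, whence the factor `1 / 2`. -/
noncomputable def vol (A : MarkedTree n) : ℝ := (1 / 2) * ∑ᶠ e : A.GraphEdge, A.edgeLen e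

/-- Equivalence of marked metric graphs: an equivariant homothety between the universal covers. -/
def Equivalent (A B : MarkedTree n) : Prop :=
  ∃ (φ : A ≃ B) (c : ℝ), 0 < c ∧ (∀ x y, dist (φ x) (φ y) = c * dist x y) ∧
    ∀ (g : FreeGroup (Fin n)) x, φ (g • x) = g • φ x

theorem Equivalent.refl (A : MarkedTree n) : A.Equivalent A :=
  ⟨Equiv.refl _, 1, one_pos, fun x y => by simp, fun g x => rfl⟩

theorem Equivalent.symm {A B : MarkedTree n} (h : A.Equivalent B) : B.Equivalent A := by
  obtain ⟨φ, c, hc, hd, he⟩ := h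
  refine ⟨φ.symm, c⁻¹, inv_pos.2 hc, fun x y => ?_, fun g x => ?_⟩
  · have := hd (φ.symm x) (φ.symm y)
    simp only [Equiv.apply_symm_apply] at this
    rw [this]
    field_simp
  · apply φ.injective
    rw [he]
    simp

theorem Equivalent.trans {A B C : MarkedTree n} (h : A.Equivalent B) (h' : B.Equivalent C) :
    A.Equivalent C := by
  obtain ⟨φ, c, hc, hd, he⟩ := h
  obtain ⟨ψ, b, hb, hd', he'⟩ := h'
  refine ⟨φ.trans ψ, b * c, mul_pos hb hc, fun x y => ?_, fun g x => ?_⟩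
  · simp only [Equiv.trans_apply]
    rw [hd', hd, mul_assoc]
  · simp [he, he']

instance setoid (n : ℕ) : Setoid (MarkedTree n) where
  r := Equivalent
  iseqv := ⟨Equivalent.refl, Equivalent.symm, Equivalent.trans⟩

section Homothety

variable {A B : MarkedTree n} (φ : A ≃ B) (c : ℝ)

theorem seg_homothety (hc : 0 < c) (hd : ∀ x y, dist (φ x) (φ y) = c * dist x y) (x y z : A) :
    φ z ∈ seg (φ x) (φ y) ↔ z ∈ seg x y := by
  simp only [seg, mem_ofPred_eq, hd]
  rw [← mul_add]
  exact mul_right_inj' hc.ne'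

theorem branchPoints_homothety (hc : 0 < c) (hd : ∀ x y, dist (φ x) (φ y) = c * dist x y) (x : A) :
    φ x ∈ branchPoints B ↔ x ∈ branchPoints A := by
  have hs := seg_homothety φ c hc hd
  constructor
  · rintro ⟨a, b, d, h1, h2, h3, h4, h5, h6⟩
    obtain ⟨a, rfl⟩ := φ.surjective a
    obtain ⟨b, rfl⟩ := φ.surjective b
    obtain ⟨d, rfl⟩ := φ.surjective d
    exact ⟨a, b, d, fun h => h1 (by rw [h]), fun h => h2 (by rw [h]), fun h => h3 (by rw [h]),
      (hs _ _ _).1 h4, (hs _ _ _).1 h5, (hs _ _ _).1 h6⟩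
  · rintro ⟨a, b, d, h1, h2, h3, h4, h5, h6⟩
    exact ⟨φ a, φ b, φ d, φ.injective.ne h1, φ.injective.ne h2, φ.injective.ne h3,
      (hs _ _ _).2 h4, (hs _ _ _).2 h5, (hs _ _ _).2 h6⟩

theorem edge_homothety (hc : 0 < c) (hd : ∀ x y, dist (φ x) (φ y) = c * dist x y) (v w : A) :
    B.Edge (φ v) (φ w) ↔ A.Edge v w := by
  have hb := branchPoints_homothety φ c hc hd
  have hs := seg_homothety φ c hc hd
  unfold Edge IsEdge
  rw [hb, hb, φ.injective.ne_iff]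
  refine and_congr_right fun _ => and_congr_right fun _ => and_congr_right fun _ => ?_
  constructor
  · intro h z hz hz'
    simpa using h (φ z) ((hs _ _ _).2 hz) ((hb _).2 hz')
  · intro h z hz hz'
    obtain ⟨z, rfl⟩ := φ.surjective z
    simpa using h z ((hs _ _ _).1 hz) ((hb _).1 hz')

theorem len_homothety (hc : 0 < c) (hd : ∀ x y, dist (φ x) (φ y) = c * dist x y)
    (he : ∀ (g : FreeGroup (Fin n)) x, φ (g • x) = g • φ x) (w : FreeGroup (Fin n)) :
    B.len w = c * A.len w := by
  unfold len
  rw [Real.mul_iInf_of_nonneg hc.le, ← φ.iInf_comp]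
  simp only [← he, hd]

/-- The bijection between oriented edges of graphs that a homothety induces. -/
def edgeMap (hc : 0 < c) (hd : ∀ x y, dist (φ x) (φ y) = c * dist x y)
    (he : ∀ (g : FreeGroup (Fin n)) x, φ (g • x) = g • φ x) : A.GraphEdge → B.GraphEdge :=
  Quotient.map' (s₁ := A.edgeSetoid) (s₂ := B.edgeSetoid)
    (fun e => ⟨(φ e.1.1, φ e.1.2), (edge_homothety φ c hc hd _ _).2 e.2⟩) (by
      rintro e e' ⟨g, h1, h2⟩
      exact ⟨g, by simp only [← he, h1], by simp only [← he, h2]⟩)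

theorem vol_homothety (hc : 0 < c) (hd : ∀ x y, dist (φ x) (φ y) = c * dist x y)
    (he : ∀ (g : FreeGroup (Fin n)) x, φ (g • x) = g • φ x) : B.vol = c * A.vol := by
  have hbij : Function.Bijective (edgeMap φ c hc hd he) := by
    constructor
    · intro a b
      induction a using Quotient.inductionOn with
      | h a =>
        induction b using Quotient.inductionOn with
        | h b =>
          intro h
          obtain ⟨g, h1, h2⟩ := Quotient.exact h
          refine Quotient.sound ⟨g, ?_, ?_⟩
          · exact φ.injective ((he _ _).trans h1)
          · exact φ.injective ((he _ _).trans h2)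
    · intro b
      induction b using Quotient.inductionOn with
      | h b =>
        obtain ⟨⟨v, w⟩, hvw⟩ := b
        obtain ⟨v, rfl⟩ := φ.surjective v
        obtain ⟨w, rfl⟩ := φ.surjective w
        exact ⟨Quotient.mk A.edgeSetoid ⟨(v, w), (edge_homothety φ c hc hd v w).1 hvw⟩, rfl⟩
  have key : ∑ᶠ e : A.GraphEdge, c * A.edgeLen e = ∑ᶠ e : B.GraphEdge, B.edgeLen e := by
    refine finsum_eq_of_bijective _ hbij fun e => ?_
    induction e using Quotient.inductionOn with
    | h e => exact (hd _ _).symm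
  unfold vol
  have hsmul : ∑ᶠ e : A.GraphEdge, c * A.edgeLen e = c * ∑ᶠ e : A.GraphEdge, A.edgeLen e := by
    simpa only [smul_eq_mul] using (smul_finsum c A.edgeLen).symm
  rw [← key, hsmul]
  ring

end Homothety

end MarkedTree

open MarkedTree

/-! ### Outer Space, its topology and its metrics -/

/-- Outer Space (Culler-Vogtmann space) of rank `n`. -/
def CV (n : ℕ) : Type 1 := Quotient (MarkedTree.setoid n)

/-- The class of a marked metric graph in Outer Space. -/
def MarkedTree.cls {n : ℕ} (A : MarkedTree n) : CV n := Quotient.mk _ A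

/-- The homothety relation on functions on the free group. -/
def homothetySetoid (n : ℕ) : Setoid (FreeGroup (Fin n) → ℝ) where
  r u v := ∃ c : ℝ, 0 < c ∧ v = c • u
  iseqv :=
    { refl := fun u => ⟨1, one_pos, (one_smul _ _).symm⟩
      symm := by
        rintro u v ⟨c, hc, rfl⟩
        exact ⟨c⁻¹, inv_pos.2 hc, (inv_smul_smul₀ hc.ne' _).symm⟩
      trans := by
        rintro u v w ⟨c, hc, rfl⟩ ⟨b, hb, rfl⟩
        exact ⟨b * c, mul_pos hb hc, smul_smul _ _ _⟩ }

namespace CV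

variable {n : ℕ}

/-- `a.len w` is the translation length of `w` in the representative of `a` of volume one. -/
noncomputable def len (a : CV n) (w : FreeGroup (Fin n)) : ℝ :=
  Quotient.lift (fun A : MarkedTree n => A.len w / A.vol) (by
    rintro A B ⟨φ, c, hc, hd, he⟩
    show A.len w / A.vol = B.len w / B.vol
    rw [len_homothety φ c hc hd he, vol_homothety φ c hc hd he, mul_div_mul_left _ _ hc.ne']) a

/-- The topology of Outer Space, as a subspace of the space of functions on the free group up to
homothety. -/
noncomputable instance : TopologicalSpace (CV n) :=
  TopologicalSpace.induced (fun a : CV n => Quotient.mk (homothetySetoid n) a.len) inferInstance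

/-- The right hand factor of the representatives of volume one. -/
noncomputable def stretchR (a b : CV n) : ℝ :=
  ⨆ w : {w : FreeGroup (Fin n) // w ≠ 1}, b.len w / a.len w

/-- The right hand non-symmetric metric. -/
noncomputable def dR (a b : CV n) : ℝ := Real.log (stretchR a b)

/-- The symmetric metric; the product of the two factors does not depend on the chosen
representatives. -/
noncomputable def d (a b : CV n) : ℝ := Real.log (stretchR a b * stretchR b a)

/-- The `ε`-thin part: some loop is shorter than `ε` in the representative of volume one. -/
def thin (n : ℕ) (ε : ℝ) : Set (CV n) := {a | ∃ w : FreeGroup (Fin n), w ≠ 1 ∧ a.len w < ε}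

/-- The `ε`-thick part. -/
def thick (n : ℕ) (ε : ℝ) : Set (CV n) := (thin n ε)ᶜ

/-- `α`, restricted to `[0, dR a b]`, is a right-geodesic from `a` to `b`, parametrised by `dR`. -/
structure IsRightGeodesic (α : ℝ → CV n) (a b : CV n) : Prop where
  continuousOn : ContinuousOn α (Icc 0 (dR a b))
  start : α 0 = a
  finish : α (dR a b) = b
  dR_eq : ∀ s ∈ Icc 0 (dR a b), ∀ t ∈ Icc 0 (dR a b), s ≤ t → dR (α s) (α t) = t - s

/-- `α`, restricted to the interval `I`, is a `(K, L)`-quasi-geodesic for the symmetric metric. -/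
def IsQuasiGeodesicOn (α : ℝ → CV n) (I : Set ℝ) (K L : ℝ) : Prop :=
  ∀ x ∈ I, ∀ y ∈ I, 1 / K * |x - y| - L ≤ d (α x) (α y) ∧ d (α x) (α y) ≤ K * |x - y| + L

end CV

/-! ### Optimal maps and fast folding paths -/

variable {n : ℕ}

/-- Lifts of PL-maps in the homotopy class determined by the markings: equivariant maps that have
constant speed on every edge. -/
structure IsPL {A B : MarkedTree n} (f : A → B) : Prop where
  equivariant : ∀ (g : FreeGroup (Fin n)) x, f (g • x) = g • f x
  linear : ∀ v w, A.Edge v w →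
    ∃ S : ℝ, ∀ x ∈ seg v w, ∀ y ∈ seg v w, dist (f x) (f y) = S * dist x y

/-- The stretching factor of an edge under a PL-map. -/
noncomputable def stretch {A B : MarkedTree n} (f : A → B) (v w : A) : ℝ :=
  dist (f v) (f w) / dist v w

/-- The edges of the subgraph of maximally stretched edges. -/
def IsMaxEdge {A B : MarkedTree n} (f : A → B) (v w : A) : Prop :=
  A.Edge v w ∧ ∀ v' w', A.Edge v' w' → stretch f v' w' ≤ stretch f v w

/-- A PL-map is optimal if there is no vertex `v` of the subgraph of maximally stretched edges such
that the images of all maximally stretched edges at `v` share a nontrivial segment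
starting at `f v`. -/
structure IsOptimal {A B : MarkedTree n} (f : A → B) : Prop where
  isPL : IsPL f
  gates : ¬ ∃ v, (∃ w, IsMaxEdge f v w) ∧
    ∃ p, p ≠ f v ∧ ∀ w, IsMaxEdge f v w → p ∈ seg (f v) (f w)

/-- `c : A → A₀` shrinks every edge `e` of `A` to the length of `f e`, without any folding; edges
on which `f` is constant are collapsed. So `A₀` is, up to homothety, the graph obtained by
shrinking each edge of `A` until `f` stretches all edges by the same factor, and
it is scaled so that this factor is one. -/
structure IsShrinking {A B A₀ : MarkedTree n} (f : A → B) (c : A → A₀) : Prop where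
  equivariant : ∀ (g : FreeGroup (Fin n)) x, c (g • x) = g • c x
  surjective : Function.Surjective c
  between : ∀ x y, ∀ z ∈ seg x y, c z ∈ seg (c x) (c y)
  edge : ∀ v w, A.Edge v w → ∀ x ∈ seg v w, ∀ y ∈ seg v w, dist (c x) (c y) = dist (f x) (f y)

/-- `f` is simplicial for the subdivisions `W` and `U`, and isometric on edges. -/
structure IsSimplicial {A B : MarkedTree n} (f : A → B) (W : Set A) (U : Set B) : Prop where
  source : IsVertexSet (FreeGroup (Fin n)) W
  target : IsVertexSet (FreeGroup (Fin n)) U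
  vertex : ∀ v ∈ W, f v ∈ U
  edge : ∀ v w, IsEdge W v w → IsEdge U (f v) (f w)
  isometric : ∀ v w, IsEdge W v w →
    ∀ x ∈ seg v w, ∀ y ∈ seg v w, dist (f x) (f y) = dist x y

/-- The folding relation at time `s`: the equivalence relation generated by the relations
`x ∼ y` if `f x = f y` and both `x` and `y` are at distance at most `s` from a common
vertex `v`. -/
def FoldRel {A B : MarkedTree n} (f : A → B) (W : Set A) (s : ℝ) : A → A → Prop :=
  Relation.EqvGen fun x y => f x = f y ∧ ∃ v ∈ W, dist v x ≤ s ∧ dist v y ≤ s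

/-- The times at which a pair of distinct edges with a common end-point and the same
image is completely identified by folding from that end-point. -/
def foldTimes {A B : MarkedTree n} (f : A → B) (W : Set A) : Set ℝ :=
  {l | ∃ v w w', IsEdge W v w ∧ IsEdge W v w' ∧ w ≠ w' ∧ f w = f w' ∧ l = dist v w}

/-- `q : A → A'` is the quotient map by the folding relation at time `s`, where the quotient has
the metric for which `q` is isometric on edges, and `f'` is the map induced by `f` on it. -/
structure IsFold {A A' B : MarkedTree n} (f : A → B) (W : Set A) (s : ℝ) (q : A → A')
    (f' : A' → B) : Prop where
  equivariant : ∀ (g : FreeGroup (Fin n)) x, q (g • x) = g • q x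
  surjective : Function.Surjective q
  fibre : ∀ x y, q x = q y ↔ FoldRel f W s x y
  isometric : ∀ v w, IsEdge W v w →
    ∀ x ∈ seg v w, ∀ y ∈ seg v w, dist (q x) (q y) = dist x y
  factor : ∀ x, f' (q x) = f x

/-- A fast folding path from `A` to `B` guided by the optimal map `f`. The graph `A₀ = graph 0` is
obtained from `A` by shrinking edges; from time `time i` to time `time (i + 1)`, the
first time at which a pair of edges is completely identified, all edges with the same germ of image
are folded at unit speed; then source and target are subdivided anew and the procedure is
repeated, until the induced map to `B` is an isometry. The scale is that of `B`. -/
structure FastFoldingPath (A B : MarkedTree n) (f : A → B) where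
  graph : ℝ → MarkedTree n
  toTarget : ∀ t, graph t → B
  shrink : A → graph 0
  steps : ℕ
  time : ℕ → ℝ
  isOptimal : IsOptimal f
  isShrinking : IsShrinking f shrink
  toTarget_shrink : ∀ x, toTarget 0 (shrink x) = f x
  time_zero : time 0 = 0
  fold : ∀ i < steps, ∃ (W : Set (graph (time i))) (U : Set B),
    IsSimplicial (toTarget (time i)) W U ∧
    IsLeast (foldTimes (toTarget (time i)) W) (time (i + 1) - time i) ∧
    ∀ t ∈ Icc (time i) (time (i + 1)), ∃ q : graph (time i) → graph t,
      IsFold (toTarget (time i)) W (t - time i) q (toTarget t)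
  finish : Function.Bijective (toTarget (time steps)) ∧ Isometry (toTarget (time steps))

/-- The final time of a fast folding path. -/
def FastFoldingPath.finalTime {A B : MarkedTree n} {f : A → B} (P : FastFoldingPath A B f) : ℝ :=
  P.time P.steps

end OuterSpace

/-! Let k be the maximal stretching factor of the optimal map f. Scale A by k, interpolate linearly
between the edge lengths of kA and those of A₀, then follow the fast folding path. Along this path
the volume and all translation lengths are nonincreasing. Optimality gives a loop g that runs
through maximally stretched edges and whose image does not backtrack
(`IsOptimal.exists_legal_loop`), so its length is constant. Hence the right stretching factor from
an earlier to a later volume-one graph is the quotient of the two volumes, and `dR` is the drop of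
log vol, which is additive. Parametrising by log vol gives a right-geodesic
(`IsStretchPath.exists_rightGeodesic`). Where the volume stands still, so does the homothety class.

For two points of the path the volumes cancel in the symmetric metric: `d` is the supremum over
loops g of the drop of log l(g). It remains to compare this drop with the drop of log vol.

Upper bound, folding. A folding map Q : X → Y is isometric on countably many pieces. By an area
formula, the points of X at which Q is not injective have, modulo the group, measure at most 2 (vol
X - vol Y). The distance lost along a segment is at most the measure of its folded part
(`dist_le_dist_add_measure`), and in an ε-thick graph a loop of length l covers a point about l / (ε
vol) times at most. So the relative loss of length is at most 2/ε times the relative loss of volume,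
and summing over short times gives the rate 4/ε for logarithms.

Upper bound, interpolation. A itself may be thin, but A₀ is thick. Counting how often an axis of A
covers a point of the graph bounds l_A(g) / vol A by a multiple 1/ε of l(g) / vol in A₀
(`IsBetween.mul_len_le`), which costs only an additive constant.

Lower bound. During folding, some loop of the later graph has length at most 2 vol, while it had
length at least ε vol in the earlier graph. During the interpolation, a family of loops that
together cross all edges equally often has total length proportional to the volume (`exists_loops`),
so one of them shrinks at least as much as the volume does. If a subpath meets both phases, the
phase with the larger drop accounts for at least half of it; hence the factor 1/2. -/

open MeasureTheory Measure

namespace OuterSpace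

/-! ### Segments, medians and connectedness in real trees. -/

section Segments

variable {X : Type} [MetricSpace X] {x y z u a b c d p : X}

theorem mem_seg : z ∈ seg x y ↔ dist x z + dist z y = dist x y := Iff.rfl

theorem mem_seg_of_le (h : dist x z + dist z y ≤ dist x y) : z ∈ seg x y :=
  le_antisymm h (dist_triangle _ _ _)

theorem seg_comm (x y : X) : seg x y = seg y x := by
  ext z
  rw [mem_seg, mem_seg, dist_comm x z, dist_comm z y, dist_comm x y, add_comm]

theorem left_mem_seg (x y : X) : x ∈ seg x y := by simp [mem_seg]

theorem right_mem_seg (x y : X) : y ∈ seg x y := by simp [mem_seg]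

theorem seg_self (x : X) : seg x x = {x} := by
  ext z
  rw [mem_seg, dist_comm z x, dist_self, mem_singleton_iff]
  constructor
  · intro h
    exact (dist_eq_zero.1 (by linarith)).symm
  · rintro rfl
    simp

theorem mem_seg_trans (h : z ∈ seg x y) (h' : u ∈ seg x z) : u ∈ seg x y := by
  apply mem_seg_of_le
  rw [mem_seg] at h h'
  linarith [dist_triangle u z y]

theorem mem_seg_trans_right (h : z ∈ seg x y) (h' : u ∈ seg x z) : z ∈ seg u y := by
  apply mem_seg_of_le
  rw [mem_seg] at h h'
  linarith [dist_triangle x u y]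

theorem mem_seg_swap (h : z ∈ seg x y) : z ∈ seg y x := seg_comm x y ▸ h

theorem eq_of_mem_seg_of_mem_seg (h : x ∈ seg y z) (h' : y ∈ seg x z) : x = y := by
  rw [mem_seg] at h h'
  rw [dist_comm y x] at h
  exact dist_eq_zero.1 (by linarith [dist_nonneg (x := x) (y := y)])

theorem dist_left_le_of_mem_seg (h : z ∈ seg x y) : dist x z ≤ dist x y := by
  rw [mem_seg] at h
  linarith [dist_nonneg (x := z) (y := y)]

end Segments

namespace IsRealTree

variable {X : Type} [MetricSpace X] (hX : IsRealTree X) {x y z u a b c d p : X}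

include hX

theorem exists_param (x y : X) : ∃ γ : ℝ → X, γ 0 = x ∧ γ (dist x y) = y ∧
    (∀ s ∈ Icc 0 (dist x y), ∀ t ∈ Icc 0 (dist x y), dist (γ s) (γ t) = |s - t|) ∧
    (∀ t ∈ Icc 0 (dist x y), dist x (γ t) = t) ∧
    (∀ z ∈ seg x y, γ (dist x z) = z) ∧ γ '' Icc 0 (dist x y) = seg x y := by
  obtain ⟨γ, h0, h1, h⟩ := hX.geodesic x y
  have hd : (0 : ℝ) ∈ Icc 0 (dist x y) := ⟨le_rfl, dist_nonneg⟩
  have hd' : dist x y ∈ Icc 0 (dist x y) := ⟨dist_nonneg, le_rfl⟩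
  have hx : ∀ t ∈ Icc 0 (dist x y), dist x (γ t) = t := by
    intro t ht
    have := h 0 hd t ht
    rw [h0, zero_sub, abs_neg, abs_of_nonneg ht.1] at this
    exact this
  have hy : ∀ t ∈ Icc 0 (dist x y), dist (γ t) y = dist x y - t := by
    intro t ht
    have := h t ht _ hd'
    rw [h1, abs_sub_comm, abs_of_nonneg (sub_nonneg.2 ht.2)] at this
    exact this
  have hz : ∀ z ∈ seg x y, γ (dist x z) = z := by
    intro z hz
    have hm : dist x z ∈ Icc 0 (dist x y) := ⟨dist_nonneg, dist_left_le_of_mem_seg hz⟩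
    rw [mem_seg] at hz
    -- Both points have the same distances to x and to y, so the four point condition forces them to
    -- coincide.
    have h4 := hX.fourPoint z (γ (dist x z)) x y
    have e1 := hx _ hm
    have e2 := hy _ hm
    rw [dist_comm z x, dist_comm (γ (dist x z)) x, e1, e2] at h4
    have : dist z (γ (dist x z)) + dist x y ≤ dist x y := by
      refine h4.trans (max_le (by linarith) (by linarith))
    exact (dist_le_zero.1 (by linarith)).symm
  refine ⟨γ, h0, h1, h, hx, hz, ?_⟩
  ext z
  constructor
  · rintro ⟨t, ht, rfl⟩
    rw [mem_seg, hx t ht, hy t ht]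
    ring
  · intro hzs
    exact ⟨dist x z, ⟨dist_nonneg, dist_left_le_of_mem_seg hzs⟩, hz z hzs⟩

theorem dist_of_mem_seg (hz : z ∈ seg x y) (hu : u ∈ seg x y) :
    dist z u = |dist x z - dist x u| := by
  obtain ⟨γ, -, -, h, -, hγ, -⟩ := hX.exists_param x y
  rw [← h _ ⟨dist_nonneg, dist_left_le_of_mem_seg hz⟩ _ ⟨dist_nonneg, dist_left_le_of_mem_seg hu⟩,
    hγ z hz, hγ u hu]

theorem exists_median (x y z : X) : ∃ p, p ∈ seg x y ∧ p ∈ seg x z ∧ p ∈ seg y z := by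
  obtain ⟨γ, -, h1, h, hx, -, hs⟩ := hX.exists_param x y
  have hxy := dist_triangle x z y
  have hxz := dist_triangle x y z
  have hyz := dist_triangle y x z
  rw [dist_comm y x] at hyz
  rw [dist_comm z y] at hxy
  -- The Gromov product of y and z at x: the distance from x at which the two geodesics part.
  set t := (dist x y + dist x z - dist y z) / 2 with ht
  have htm : t ∈ Icc 0 (dist x y) := ⟨by linarith, by linarith⟩
  have hp : γ t ∈ seg x y := hs ▸ mem_image_of_mem _ htm
  have hpx := hx t htm
  have hpy : dist (γ t) y = dist x y - t := by
    rw [mem_seg] at hp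
    linarith
  have h4 := hX.fourPoint (γ t) z x y
  rw [dist_comm (γ t) x, dist_comm z y, dist_comm z x, hpx, hpy] at h4
  have h5 : dist (γ t) z + dist x y ≤ t + dist y z := by
    refine h4.trans (max_le le_rfl ?_)
    rw [ht]
    linarith
  refine ⟨γ t, hp, mem_seg_of_le ?_, mem_seg_of_le ?_⟩
  · rw [hpx]
    linarith
  · rw [dist_comm y, hpy]
    linarith

/-- Geodesics that overlap in a nondegenerate segment glue to a geodesic. The overlap `b ≠ c`
excludes one of the two terms in the four point condition. -/
theorem mem_seg_concat (h : b ∈ seg a c) (h' : c ∈ seg b d) (hbc : b ≠ c) :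
    b ∈ seg a d ∧ c ∈ seg a d := by
  have h4 := hX.fourPoint a c b d
  have hpos := dist_pos.2 hbc
  rw [mem_seg] at h h'
  have h5 : dist a c + dist b d ≤ dist a d + dist b c := by
    rcases le_max_iff.1 h4 with h6 | h6
    · linarith
    · rwa [dist_comm c b] at h6
  constructor
  · apply mem_seg_of_le
    linarith
  · apply mem_seg_of_le
    linarith

/-- A point that separates a from b separates p from at least one of them. -/
theorem mem_seg_or_mem_seg (hz : z ∈ seg a b) (p : X) : z ∈ seg a p ∨ z ∈ seg p b := by
  rw [mem_seg] at hz
  have h := hX.fourPoint a b z p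
  rcases le_max_iff.1 h with h | h
  · right
    apply mem_seg_of_le
    rw [dist_comm p z, dist_comm p b]
    linarith
  · left
    apply mem_seg_of_le
    rw [dist_comm z b] at hz
    rw [dist_comm b z] at h
    linarith [dist_comm z b]

theorem isCompact_seg (x y : X) : IsCompact (seg x y) := by
  obtain ⟨γ, -, -, h, -, -, hs⟩ := hX.exists_param x y
  rw [← hs]
  refine isCompact_Icc.image_of_continuousOn ?_
  refine LipschitzOnWith.continuousOn (K := 1) (LipschitzOnWith.of_dist_le_mul ?_)
  intro s hs t ht
  rw [h s hs t ht, NNReal.coe_one, one_mul, Real.dist_eq]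

theorem isPreconnected_seg (x y : X) : IsPreconnected (seg x y) := by
  obtain ⟨γ, -, -, h, -, -, hs⟩ := hX.exists_param x y
  rw [← hs]
  refine isPreconnected_Icc.image _ ?_
  refine LipschitzOnWith.continuousOn (K := 1) (LipschitzOnWith.of_dist_le_mul ?_)
  intro s hs t ht
  rw [h s hs t ht, NNReal.coe_one, one_mul, Real.dist_eq]

theorem isClosed_seg (x y : X) : IsClosed (seg x y) := (hX.isCompact_seg x y).isClosed

/-- Removing an inner point z of the segment disconnects the tree: the points that z separates from
a and those that it does not are both open. -/
theorem seg_subset_of_isPreconnected {S : Set X} (hS : IsPreconnected S) (ha : a ∈ S)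
    (hb : b ∈ S) : seg a b ⊆ S := by
  intro z hz
  by_contra hzS
  have hU : IsOpen {x : X | dist a x < dist a z + dist z x} :=
    isOpen_lt (by fun_prop) (by fun_prop)
  have hV : IsOpen {x : X | z ∈ seg a x ∧ x ≠ z} := by
    rw [Metric.isOpen_iff]
    rintro x ⟨hx, hxz⟩
    refine ⟨dist x z, dist_pos.2 hxz, fun x' hx' => ?_⟩
    rw [Metric.mem_ball, dist_comm] at hx'
    refine ⟨?_, ?_⟩
    · rcases hX.mem_seg_or_mem_seg hx x' with h | h
      · exact h
      · exfalso
        rw [mem_seg] at h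
        rw [dist_comm x x', dist_comm x z] at hx'
        linarith [dist_nonneg (x := x') (y := z)]
    · rintro rfl
      exact lt_irrefl _ hx'
  have hsub : S ⊆ {x : X | dist a x < dist a z + dist z x} ∪ {x : X | z ∈ seg a x ∧ x ≠ z} := by
    intro x hx
    by_cases h : z ∈ seg a x
    · exact Or.inr ⟨h, fun e => hzS (e ▸ hx)⟩
    · exact Or.inl (lt_of_le_of_ne (dist_triangle _ _ _) (fun e => h e.symm))
  have hza : z ≠ a := fun e => hzS (e ▸ ha)
  have hzb : z ≠ b := fun e => hzS (e ▸ hb)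
  obtain ⟨x, -, hx1, hx2⟩ := hS _ _ hU hV hsub ⟨a, ha, by
    change dist a a < dist a z + dist z a
    rw [dist_self]
    linarith [dist_pos.2 hza, dist_nonneg (x := a) (y := z)]⟩ ⟨b, hb, hz, hzb.symm⟩
  change dist a x < _ at hx1
  have h3 : dist a z + dist z x = dist a x := hx2.1
  linarith

/-- If p is the projection of v to the segment, only the two points at distance r - d(v, p) from p
qualify. -/
theorem sphere_inter_seg_finite (v a b : X) (r : ℝ) : {z ∈ seg a b | dist v z = r}.Finite := by
  obtain ⟨p, hpa, hpb, hp⟩ := hX.exists_median v a b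
  have hinj : InjOn (dist a) {z ∈ seg a b | dist v z = r} := by
    rintro z ⟨hz, -⟩ w ⟨hw, -⟩ h
    have := hX.dist_of_mem_seg hz hw
    rw [h, sub_self, abs_zero] at this
    exact dist_eq_zero.1 this
  refine Finite.of_finite_image (Finite.subset (s := {dist a p - (r - dist v p),
    dist a p + (r - dist v p)}) (by simp) ?_) hinj
  rintro _ ⟨z, ⟨hz, hr⟩, rfl⟩
  rcases hX.mem_seg_or_mem_seg hz p with h | h
  · left
    have h1 := mem_seg_trans_right (mem_seg_swap hpa) h
    rw [mem_seg] at h h1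
    rw [dist_comm z v, dist_comm p v] at h1
    linarith
  · right
    have h1 := mem_seg_trans_right (mem_seg_swap hpb) (mem_seg_swap h)
    have h2 := mem_seg_trans_right (mem_seg_swap hp) (mem_seg_swap h)
    rw [mem_seg] at h h1 h2
    rw [dist_comm z v, dist_comm p v] at h1
    rw [dist_comm z a, dist_comm p a] at h2
    rw [mem_singleton_iff]
    linarith

theorem card_le_of_separated {δ : ℝ} (hδ : 0 < δ) (F : Finset X) (hF : ∀ z ∈ F, z ∈ seg x y)
    (hsep : ∀ z ∈ F, ∀ u ∈ F, z ≠ u → δ ≤ dist z u) : (F.card : ℝ) ≤ dist x y / δ + 1 := by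
  have hmaps : ∀ z ∈ F, ⌊dist x z / δ⌋₊ ∈ Finset.range (⌊dist x y / δ⌋₊ + 1) := by
    intro z hz
    rw [Finset.mem_range, Nat.lt_succ_iff]
    exact Nat.floor_le_floor (by gcongr; exact dist_left_le_of_mem_seg (hF z hz))
  have hinj : Set.InjOn (fun z => ⌊dist x z / δ⌋₊) F := by
    intro z hz u hu h
    by_contra hne
    have h1 := hsep z hz u hu hne
    rw [hX.dist_of_mem_seg (hF z hz) (hF u hu)] at h1
    have h2 : |dist x z / δ - dist x u / δ| < 1 := by
      have ha := Nat.floor_le (a := dist x z / δ) (by positivity)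
      have hb := Nat.floor_le (a := dist x u / δ) (by positivity)
      have hc := Nat.lt_floor_add_one (dist x z / δ)
      have hd := Nat.lt_floor_add_one (dist x u / δ)
      simp only at h
      rw [h] at ha hc
      rw [abs_lt]
      constructor <;> linarith
    rw [← sub_div, abs_div, abs_of_pos hδ, div_lt_one hδ] at h2
    linarith
  have h := Finset.card_le_card_of_injOn _ hmaps hinj
  rw [Finset.card_range] at h
  have h2 := Nat.floor_le (a := dist x y / δ) (by positivity)
  have h3 : (F.card : ℝ) ≤ (⌊dist x y / δ⌋₊ : ℝ) + 1 := by exact_mod_cast h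
  linarith

theorem finite_of_separated {δ : ℝ} (hδ : 0 < δ) {S : Set X} (hS : S ⊆ seg x y)
    (hsep : ∀ z ∈ S, ∀ u ∈ S, z ≠ u → δ ≤ dist z u) : S.Finite := by
  by_contra hinf
  obtain ⟨F, hFS, hF⟩ := Set.Infinite.exists_subset_card_eq hinf (⌊dist x y / δ + 1⌋₊ + 1)
  have h := hX.card_le_of_separated hδ F (fun z hz => hS (hFS hz))
    (fun z hz u hu => hsep z (hFS hz) u (hFS hu))
  rw [hF] at h
  have := Nat.lt_floor_add_one (dist x y / δ + 1)
  push_cast at h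
  linarith

end IsRealTree

/-! ### Length as one-dimensional Hausdorff measure. -/

section Measure

theorem hausdorffMeasure_image_of_isometricOn {X Y : Type} [MetricSpace X] [MeasurableSpace X]
    [BorelSpace X] [MetricSpace Y] [MeasurableSpace Y] [BorelSpace Y] (Q : X → Y) (S : Set X)
    (h : ∀ x ∈ S, ∀ y ∈ S, dist (Q x) (Q y) = dist x y) : μH[1] (Q '' S) = μH[1] S := by
  have h1 : Isometry (fun x : S => Q x) := Isometry.of_dist_eq fun x y => h x x.2 y y.2
  have e1 := h1.hausdorffMeasure_image (d := 1) (Or.inl zero_le_one) univ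
  have e2 := (isometry_subtype_coe (s := S)).hausdorffMeasure_image (d := 1)
    (Or.inl zero_le_one) univ
  rw [image_univ] at e1 e2
  rw [Subtype.range_coe] at e2
  rw [e2, ← e1]
  congr 1
  ext y
  simp

theorem IsRealTree.hausdorffMeasure_seg {X : Type} [MetricSpace X] [MeasurableSpace X]
    [BorelSpace X] (hX : IsRealTree X) (x y : X) :
    μH[1] (seg x y) = ENNReal.ofReal (dist x y) := by
  obtain ⟨γ, -, -, h, -, -, hs⟩ := hX.exists_param x y
  rw [← hs, hausdorffMeasure_image_of_isometricOn γ _ (fun s hs t ht => by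
    rw [h s hs t ht, Real.dist_eq]), hausdorffMeasure_real, Real.volume_Icc, sub_zero]

end Measure

/-! ### Simplicial structures: edges, stars of vertices, local finiteness. -/

section VertexSets

variable {X : Type} [MetricSpace X] {V : Set X} {x y z u v w a : X}

theorem IsEdge.symm (h : IsEdge V v w) : IsEdge V w v := by
  obtain ⟨hv, hw, hne, h⟩ := h
  exact ⟨hw, hv, hne.symm, fun z hz hzV => (h z (mem_seg_swap hz) hzV).symm⟩

theorem IsRealTree.exists_mem_seg_near (hX : IsRealTree X) {r : ℝ} (hr : 0 < r) (hxa : a ≠ x) :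
    ∃ z ∈ seg x a, z ≠ x ∧ dist x z < r := by
  obtain ⟨γ, -, -, -, h, -, hs⟩ := hX.exists_param x a
  have hpos := dist_pos.2 hxa.symm
  have hm : min (r / 2) (dist x a) ∈ Icc 0 (dist x a) :=
    ⟨le_min (by linarith) dist_nonneg, min_le_right _ _⟩
  have hd := h _ hm
  refine ⟨γ (min (r / 2) (dist x a)), hs ▸ mem_image_of_mem _ hm, ?_, ?_⟩
  · intro e
    rw [e, dist_self] at hd
    have := lt_min (show 0 < r / 2 by linarith) hpos
    linarith
  · rw [hd]
    exact (min_le_left _ _).trans_lt (by linarith)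

/-- Off V the tree is locally an interval, and on a line no point lies between every two of three
other points. -/
theorem IsRealTree.branchPoints_subset (hX : IsRealTree X) {G : Type} [Group G] [MulAction G X]
    (hV : IsVertexSet G V) : branchPoints X ⊆ V := by
  rintro x ⟨a, b, c, ha, hb, hc, hab, hbc, hac⟩
  by_contra hx
  obtain ⟨v, w, -, hxe, hn⟩ := hV.edge_nhds x hx
  obtain ⟨r, hr, hball⟩ := Metric.mem_nhds_iff.1 hn
  have key : ∀ {a : X}, a ≠ x → ∃ z ∈ seg x a, z ≠ x ∧ z ∈ seg v w := by
    intro a ha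
    obtain ⟨z, hz, hzx, hd⟩ := hX.exists_mem_seg_near hr ha
    exact ⟨z, hz, hzx, hball (by rwa [Metric.mem_ball, dist_comm])⟩
  obtain ⟨a', ha1, ha2, ha3⟩ := key ha
  obtain ⟨b', hb1, hb2, hb3⟩ := key hb
  obtain ⟨c', hc1, hc2, hc3⟩ := key hc
  have shrink : ∀ {a b a' b' : X}, x ∈ seg a b → a' ∈ seg x a → b' ∈ seg x b → x ∈ seg a' b' := by
    intro a b a' b' h h1 h2
    have h3 := mem_seg_trans_right h (mem_seg_swap h1)
    exact mem_seg_swap (mem_seg_trans_right (mem_seg_swap h3) (mem_seg_swap h2))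
  have e1 := shrink hab ha1 hb1
  have e2 := shrink hbc hb1 hc1
  have e3 := shrink hac ha1 hc1
  have na := dist_pos.2 ha2
  have nb := dist_pos.2 hb2
  have nc := dist_pos.2 hc2
  rw [mem_seg] at e1 e2 e3
  rw [dist_comm x b'] at e1
  rw [dist_comm x c'] at e2 e3
  rw [hX.dist_of_mem_seg ha3 hxe] at na e1 e3
  rw [hX.dist_of_mem_seg hb3 hxe] at nb e1 e2
  rw [hX.dist_of_mem_seg hc3 hxe] at nc e2 e3
  rw [hX.dist_of_mem_seg ha3 hb3] at e1
  rw [hX.dist_of_mem_seg hb3 hc3] at e2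
  rw [hX.dist_of_mem_seg ha3 hc3] at e3
  generalize dist v a' = α at *
  generalize dist v b' = β at *
  generalize dist v c' = κ at *
  generalize dist v x = ξ at *
  rcases abs_cases (α - ξ) with h1 | h1 <;> rcases abs_cases (β - ξ) with h2 | h2 <;>
    rcases abs_cases (κ - ξ) with h3 | h3 <;> rcases abs_cases (α - β) with h4 | h4 <;>
    rcases abs_cases (β - κ) with h5 | h5 <;> rcases abs_cases (α - κ) with h6 | h6 <;> linarith

/-- If the projection of y to the edge were an inner point, it would be a branch point with
directions to v, w and y. -/
theorem IsRealTree.exit_edge (hX : IsRealTree X) (hV : branchPoints X ⊆ V) (he : IsEdge V v w)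
    (hx : x ∈ seg v w) (hy : y ∉ seg v w) : v ∈ seg x y ∨ w ∈ seg x y := by
  obtain ⟨p, hp1, hp2, hp3⟩ := hX.exists_median v w y
  have hp : p = v ∨ p = w := by
    by_contra! h
    have hpy : p ≠ y := fun e => hy (e ▸ hp1)
    have hb : p ∈ branchPoints X := ⟨v, w, y, h.1.symm, h.2.symm, hpy.symm, hp1, hp3, hp2⟩
    rcases he.2.2.2 p hp1 (hV hb) with h' | h'
    · exact h.1 h'
    · exact h.2 h'
  rcases hp with rfl | rfl
  · exact Or.inl (mem_seg_trans_right hp3 (mem_seg_swap hx))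
  · exact Or.inr (mem_seg_trans_right hp2 hx)

theorem IsRealTree.edge_unique (hX : IsRealTree X) (hV : branchPoints X ⊆ V) {v' w' : X}
    (he : IsEdge V v w) (he' : IsEdge V v' w') (hx : x ∈ seg v w) (hy : y ∈ seg v' w')
    (hxy : ∀ z ∈ seg x y, z ∉ V) : (v' = v ∧ w' = w) ∨ (v' = w ∧ w' = v) := by
  have hyV : y ∉ V := hxy y (right_mem_seg x y)
  have hye : y ∈ seg v w := by
    by_contra h
    rcases hX.exit_edge hV he hx h with h | h
    · exact hxy v h he.1
    · exact hxy w h he.2.1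
  have key : ∀ {v' w' : X}, IsEdge V v' w' → y ∈ seg v' w' → v' ∈ seg v w := by
    intro v' w' he' hy
    by_contra h
    have aux : ∀ {u : X}, u ∈ V → u ∈ seg v w → u ∉ seg y v' := by
      intro u hu hue hus
      rcases he'.2.2.2 u (mem_seg_trans hy (mem_seg_swap hus)) hu with rfl | rfl
      · exact h hue
      · have := eq_of_mem_seg_of_mem_seg (mem_seg_swap hy) hus
        exact hyV (this ▸ hu)
    rcases hX.exit_edge hV he hye h with h1 | h1
    · exact aux he.1 (left_mem_seg _ _) h1
    · exact aux he.2.1 (right_mem_seg _ _) h1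
  have h1 := he.2.2.2 v' (key he' hy) he'.1
  have h2 := he.2.2.2 w' (key he'.symm (mem_seg_swap hy)) he'.2.1
  have h3 := he'.2.2.1
  rcases h1 with rfl | rfl <;> rcases h2 with rfl | rfl
  · exact absurd rfl h3
  · exact Or.inl ⟨rfl, rfl⟩
  · exact Or.inr ⟨rfl, rfl⟩
  · exact absurd rfl h3

theorem IsRealTree.mem_seg_of_edges (hX : IsRealTree X) (hV : branchPoints X ⊆ V)
    (hu : IsEdge V v u) (hw : IsEdge V v w) (huw : u ≠ w) : v ∈ seg u w := by
  obtain ⟨p, hp1, hp2, hp3⟩ := hX.exists_median v u w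
  by_cases hpv : p = v
  · exact hpv ▸ hp3
  exfalso
  have hpV : p ∈ V := by
    by_cases hpu : p = u
    · exact hpu ▸ hu.2.1
    by_cases hpw : p = w
    · exact hpw ▸ hw.2.1
    · exact hV ⟨v, u, w, Ne.symm hpv, Ne.symm hpu, Ne.symm hpw, hp1, hp3, hp2⟩
  have h1 := (hu.2.2.2 p hp1 hpV).resolve_left hpv
  have h2 := (hw.2.2.2 p hp2 hpV).resolve_left hpv
  exact huw (h1.symm.trans h2)

/-- Continuous induction along the geodesic. The local bound is only needed from the centre of each
ball, whose radius may depend on the centre. -/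
theorem dist_le_of_locally {Y : Type} [MetricSpace Y] (hX : IsRealTree X) {K : ℝ} (hK : 0 ≤ K)
    (c : X → Y)
    (h : ∀ x, ∃ r > 0, ∀ z, dist x z < r → dist (c x) (c z) ≤ K * dist x z) (x y : X) :
    dist (c x) (c y) ≤ K * dist x y := by
  have hc : Continuous c := by
    rw [Metric.continuous_iff]
    intro b η hη
    obtain ⟨r, hr, hb⟩ := h b
    refine ⟨min r (η / (K + 1)), lt_min hr (by positivity), fun a ha => ?_⟩
    rw [dist_comm] at ha
    have h1 := hb a (ha.trans_le (min_le_left _ _))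
    have h2 := ha.trans_le (min_le_right _ _)
    rw [lt_div_iff₀ (by positivity)] at h2
    rw [dist_comm]
    nlinarith [dist_nonneg (x := b) (y := a)]
  obtain ⟨γ, h0, h1, hγ, -, -, -⟩ := hX.exists_param x y
  have hγc : ContinuousOn γ (Icc 0 (dist x y)) := by
    refine LipschitzOnWith.continuousOn (K := 1) (LipschitzOnWith.of_dist_le_mul ?_)
    intro s hs t ht
    rw [hγ s hs t ht, NNReal.coe_one, one_mul, Real.dist_eq]
  set S : Set ℝ := {t | dist (c x) (c (γ t)) ≤ K * t} with hS
  have hsub : Icc 0 (dist x y) ⊆ S := by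
    apply IsClosed.Icc_subset_of_forall_mem_nhdsWithin
    · have hF : ContinuousOn (fun t => dist (c x) (c (γ t)) - K * t) (Icc 0 (dist x y)) := by
        refine ContinuousOn.sub ?_ (by fun_prop)
        exact (continuous_const.dist hc).comp_continuousOn hγc
      have := hF.preimage_isClosed_of_isClosed isClosed_Icc (isClosed_Iic (a := (0 : ℝ)))
      convert this using 1
      ext t
      simp only [hS, mem_inter_iff, mem_ofPred_eq, mem_preimage, mem_Iic, sub_nonpos]
      tauto
    · simp [hS, h0]
    · rintro t ⟨htS, ht0, ht1⟩
      obtain ⟨r, hr, hb⟩ := h (γ t)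
      have hmem : Ioo t (min (t + r) (dist x y)) ∈ 𝓝[>] t :=
        Ioo_mem_nhdsGT (lt_min (by linarith) ht1)
      filter_upwards [hmem] with t' ht'
      have ht'' : t' < t + r := ht'.2.trans_le (min_le_left _ _)
      have ht3 : t' < dist x y := ht'.2.trans_le (min_le_right _ _)
      have hd := hγ t ⟨ht0, ht1.le⟩ t' ⟨ht0.trans ht'.1.le, ht3.le⟩
      rw [abs_sub_comm, abs_of_pos (sub_pos.2 ht'.1)] at hd
      have h2 := hb (γ t') (by rw [hd]; linarith)
      rw [hd] at h2
      have h3 := dist_triangle (c x) (c (γ t)) (c (γ t'))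
      simp only [hS, mem_ofPred_eq] at htS ⊢
      linarith
  have := hsub ⟨dist_nonneg, le_rfl⟩
  simpa only [hS, mem_ofPred_eq, h1] using this

variable {G : Type} [Group G] [MulAction G X]

/-- The condition `edge_nhds` only concerns points off V; this describes the small balls about
vertices, which are stars of edges. -/
theorem IsVertexSet.exists_separation (hV : IsVertexSet G V) (hX : IsRealTree X) :
    ∃ δ > 0, (∀ v ∈ V, ∀ w ∈ V, v ≠ w → δ ≤ dist v w) ∧
      ∀ v ∈ V, ∀ z, z ≠ v → dist v z < δ → ∃ w, IsEdge V v w ∧ z ∈ seg v w := by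
  obtain ⟨δ, hδ, hsep⟩ := hV.separated
  refine ⟨δ, hδ, hsep, fun v hv z hzv hd => ?_⟩
  have hzV : z ∉ V := fun h => absurd (hsep v hv z h hzv.symm) (not_le.2 hd)
  obtain ⟨u, w, he, hz, -⟩ := hV.edge_nhds z hzV
  have key : ∀ {u : X}, u ∈ V → u ≠ v → u ∉ seg z v := by
    intro u hu huv h
    have h1 := hsep u hu v hv huv
    rw [mem_seg] at h
    rw [dist_comm v z] at hd
    linarith [dist_nonneg (x := z) (y := u)]
  by_cases huv : u = v
  · exact ⟨w, huv ▸ he, huv ▸ hz⟩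
  by_cases hwv : w = v
  · exact ⟨u, hwv ▸ he.symm, hwv ▸ mem_seg_swap hz⟩
  exfalso
  have hve : v ∉ seg u w := by
    intro h
    rcases he.2.2.2 v h hv with h | h
    · exact huv h.symm
    · exact hwv h.symm
  rcases hX.exit_edge (hX.branchPoints_subset hV) he hz hve with h | h
  · exact key he.1 huv h
  · exact key he.2.1 hwv h

theorem IsVertexSet.dist_le_of_edges {Y : Type} [MetricSpace Y] (hV : IsVertexSet G V)
    (hX : IsRealTree X) {K : ℝ} (hK : 0 ≤ K) (c : X → Y)
    (h : ∀ v w, IsEdge V v w → ∀ x ∈ seg v w, ∀ y ∈ seg v w, dist (c x) (c y) ≤ K * dist x y)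
    (x y : X) : dist (c x) (c y) ≤ K * dist x y := by
  refine dist_le_of_locally hX hK c (fun x => ?_) x y
  by_cases hx : x ∈ V
  · obtain ⟨δ, hδ, -, hn⟩ := hV.exists_separation hX
    refine ⟨δ, hδ, fun z hz => ?_⟩
    by_cases hzx : z = x
    · simp [hzx]
    obtain ⟨w, he, hzs⟩ := hn x hx z hzx hz
    exact h _ _ he _ (left_mem_seg _ _) _ hzs
  · obtain ⟨v, w, he, hxs, hn⟩ := hV.edge_nhds x hx
    obtain ⟨r, hr, hball⟩ := Metric.mem_nhds_iff.1 hn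
    refine ⟨r, hr, fun z hz => h _ _ he _ hxs _ (hball ?_)⟩
    rwa [Metric.mem_ball, dist_comm]

theorem IsVertexSet.exists_edge_toward (hV : IsVertexSet G V) (hX : IsRealTree X) (hv : v ∈ V)
    (ha : a ≠ v) : ∃ w, IsEdge V v w ∧ ∃ z ∈ seg v w, z ≠ v ∧ z ∈ seg v a := by
  obtain ⟨δ, hδ, -, hn⟩ := hV.exists_separation hX
  obtain ⟨z, hz, hzv, hd⟩ := hX.exists_mem_seg_near hδ ha
  obtain ⟨w, he, hzw⟩ := hn v hv z hzv hd
  exact ⟨w, he, z, hzw, hzv, hz⟩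

/-- Since the action is free, an orbit of oriented edges contains at most one edge that starts at v.
-/
theorem IsVertexSet.neighbors_finite (hV : IsVertexSet G V)
    (hfree : ∀ (g : G) (x : X), g • x = x → g = 1) (v : X) : {w | IsEdge V v w}.Finite := by
  obtain ⟨S, hS, h⟩ := hV.finite_edges
  choose g p hpS h1 h2 using fun (w : {w | IsEdge V v w}) => h v w w.2
  have hinj : Function.Injective (fun w : {w | IsEdge V v w} => (⟨p w, hpS w⟩ : S)) := by
    intro w w' hww
    have hp : p w = p w' := congrArg Subtype.val hww
    have e1 : g w • (p w).1 = g w' • (p w).1 := by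
      rw [h1, hp, h1]
    have e2 : g w = g w' := by
      have := hfree ((g w')⁻¹ * g w) (p w).1 (by rw [mul_smul, e1, inv_smul_smul])
      exact (inv_mul_eq_one.1 this).symm
    apply Subtype.ext
    rw [← h2 w, ← h2 w', e2, hp]
  have : Finite S := hS
  exact Finite.of_injective _ hinj

theorem IsVertexSet.finite_inter_closedBall (hV : IsVertexSet G V) (hX : IsRealTree X)
    (hfree : ∀ (g : G) (x : X), g • x = x → g = 1) (x : X) (R : ℝ) :
    {v ∈ V | dist v x ≤ R}.Finite := by
  obtain ⟨δ, hδ, hsep⟩ := hV.separated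
  have key : ∀ (k : ℕ), ∀ x₀ ∈ V, {v ∈ V | dist x₀ v ≤ k * δ}.Finite := by
    intro k
    induction k with
    | zero =>
      intro x₀ _
      refine (finite_singleton x₀).subset ?_
      rintro v ⟨-, hv⟩
      rw [Nat.cast_zero, zero_mul] at hv
      exact (dist_le_zero.1 hv).symm
    | succ k ih =>
      intro x₀ hx₀
      have hfin := (ih x₀ hx₀).biUnion (t := fun v => {w | IsEdge V v w})
        (fun v _ => hV.neighbors_finite hfree v)
      refine (hfin.union (finite_singleton x₀)).subset ?_
      rintro v ⟨hv, hd⟩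
      by_cases hvx : v = x₀
      · exact Or.inr hvx
      left
      have hF : {z ∈ seg x₀ v | z ∈ V ∧ z ≠ v}.Finite :=
        hX.finite_of_separated hδ (fun z hz => hz.1)
          (fun z hz u hu => hsep z hz.2.1 u hu.2.1)
      -- The last vertex before v on the way from x₀ is a neighbour of v and closer to x₀ by at
      -- least δ.
      obtain ⟨u, hu, hmax⟩ := exists_max_image _ (fun z => dist x₀ z) hF
        ⟨x₀, left_mem_seg _ _, hx₀, Ne.symm hvx⟩
      have hsepuv := hsep u hu.2.1 v hv hu.2.2
      have hus := hu.1
      rw [mem_seg] at hus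
      simp only [mem_iUnion]
      refine ⟨u, ⟨hu.2.1, ?_⟩, hu.2.1, hv, hu.2.2, fun z hz hzV => ?_⟩
      · push_cast at hd
        linarith
      · by_contra! hne
        have hz' : z ∈ seg x₀ v := mem_seg_swap (mem_seg_trans (mem_seg_swap hu.1)
          (mem_seg_swap hz))
        have h1 := hmax z ⟨hz', hzV, hne.2⟩
        have h2 := dist_pos.2 hne.1
        have h4 : u ∈ seg x₀ z := by
          have := mem_seg_trans_right (mem_seg_swap hu.1) (mem_seg_swap hz)
          exact mem_seg_swap this
        rw [mem_seg] at h4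
        rw [dist_comm z u] at h2
        linarith
  by_cases hne : ∃ x₀, x₀ ∈ V
  · obtain ⟨x₀, hx₀⟩ := hne
    refine (key ⌈(dist x₀ x + R) / δ⌉₊ x₀ hx₀).subset ?_
    rintro v ⟨hv, hd⟩
    refine ⟨hv, ?_⟩
    have h1 := Nat.le_ceil ((dist x₀ x + R) / δ)
    rw [div_le_iff₀ hδ] at h1
    have h2 := dist_triangle x₀ x v
    rw [dist_comm x v] at h2
    linarith
  · refine finite_empty.subset ?_
    rintro v ⟨hv, -⟩
    exact hne ⟨v, hv⟩

theorem IsVertexSet.countable [Countable G] (hV : IsVertexSet G V) : V.Countable := by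
  obtain ⟨S, hS, h⟩ := hV.finite_vertices
  have : (⋃ g : G, (fun u => g • u) '' S).Countable :=
    countable_iUnion fun g => hS.countable.image _
  refine this.mono fun v hv => ?_
  obtain ⟨g, u, hu, rfl⟩ := h v hv
  exact mem_iUnion.2 ⟨g, u, hu, rfl⟩

/-- Endpoints of the edges of a vertex set, including degenerate edges. -/
def edgePairs (V : Set X) : Set (X × X) := {p | p.1 ∈ V ∧ (p.2 = p.1 ∨ IsEdge V p.1 p.2)}

theorem IsVertexSet.edgePairs_countable [Countable G] (hV : IsVertexSet G V) :
    (edgePairs V).Countable := by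
  refine (hV.countable.prod hV.countable).mono ?_
  rintro ⟨v, w⟩ ⟨h1, h2⟩
  refine ⟨h1, ?_⟩
  rcases h2 with h2 | h2
  · exact h2 ▸ h1
  · exact h2.2.1

theorem IsVertexSet.exists_edgePair (hV : IsVertexSet G V) (x : X) :
    ∃ p ∈ edgePairs V, x ∈ seg p.1 p.2 := by
  by_cases hx : x ∈ V
  · exact ⟨(x, x), ⟨hx, Or.inl rfl⟩, left_mem_seg _ _⟩
  · obtain ⟨v, w, he, hxs, -⟩ := hV.edge_nhds x hx
    exact ⟨(v, w), ⟨he.1, Or.inr he⟩, hxs⟩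

theorem dist_eq_of_edgePair {Y : Type} [MetricSpace Y] {c : X → Y}
    (h : ∀ v w, IsEdge V v w → ∀ x ∈ seg v w, ∀ y ∈ seg v w, dist (c x) (c y) = dist x y)
    {p : X × X} (hp : p ∈ edgePairs V) (hx : x ∈ seg p.1 p.2) (hy : y ∈ seg p.1 p.2) :
    dist (c x) (c y) = dist x y := by
  rcases hp.2 with h' | h'
  · rw [h', seg_self] at hx hy
    rw [mem_singleton_iff.1 hx, mem_singleton_iff.1 hy, dist_self, dist_self]
  · exact h _ _ h' _ hx _ hy

end VertexSets

/-! ### Axes and translation lengths. -/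

/-- Used to pass to powers of a group element, which makes bounded errors negligible. -/
theorem le_of_forall_nat_mul_le {a b C : ℝ} (h : ∀ k : ℕ, k * a ≤ k * b + C) : a ≤ b := by
  by_contra! hab
  obtain ⟨k, hk⟩ := exists_nat_gt (C / (a - b))
  rw [div_lt_iff₀ (sub_pos.2 hab)] at hk
  have := h k
  nlinarith

/-- Local geodesics in a tree are geodesics, by repeated use of `mem_seg_concat`. -/
theorem IsRealTree.chain {X : Type} [MetricSpace X] (hX : IsRealTree X) {v : ℕ → X}
    (hv : ∀ i, v (i + 1) ∈ seg (v i) (v (i + 2))) (hne : ∀ i, v i ≠ v (i + 1)) (k : ℕ) :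
    v k ∈ seg (v 0) (v (k + 1)) ∧
      dist (v 0) (v k) = ∑ i ∈ Finset.range k, dist (v i) (v (i + 1)) := by
  have h1 : ∀ k, v k ∈ seg (v 0) (v (k + 1)) := by
    intro k
    induction k with
    | zero => exact left_mem_seg _ _
    | succ k ih => exact (hX.mem_seg_concat ih (hv k) (hne k)).2
  refine ⟨h1 k, ?_⟩
  induction k with
  | zero => simp
  | succ k ih =>
    rw [Finset.sum_range_succ, ← ih]
    exact (h1 k).symm

namespace MarkedTree

variable {n : ℕ} (A : MarkedTree n)

theorem smul_mem_seg (g : FreeGroup (Fin n)) {x y z : A} :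
    g • z ∈ seg (g • x) (g • y) ↔ z ∈ seg x y := by
  rw [mem_seg, mem_seg, A.dist_smul, A.dist_smul, A.dist_smul]

theorem bddBelow_dist (g : FreeGroup (Fin n)) : BddBelow (range fun p : A => dist p (g • p)) :=
  ⟨0, by rintro _ ⟨p, rfl⟩; exact dist_nonneg⟩

theorem len_le (g : FreeGroup (Fin n)) (p : A) : A.len g ≤ dist p (g • p) :=
  ciInf_le (A.bddBelow_dist g) p

theorem dist_pow_le (g : FreeGroup (Fin n)) (p : A) (k : ℕ) :
    dist p (g ^ k • p) ≤ k * dist p (g • p) := by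
  induction k with
  | zero => simp
  | succ k ih =>
    have h := dist_triangle p (g ^ k • p) (g ^ (k + 1) • p)
    rw [pow_succ, mul_smul, A.dist_smul] at h
    push_cast
    rw [pow_succ, mul_smul]
    linarith

theorem dist_pow_of_axis {g : FreeGroup (Fin n)} {x : A} (hne : g • x ≠ x)
    (h : g • x ∈ seg x (g • g • x)) (k : ℕ) :
    dist x (g ^ k • x) = k * dist x (g • x) := by
  have hs : ∀ i, g ^ (i + 1) • x = g ^ i • g • x := fun i => by rw [pow_succ, mul_smul]
  have hc := A.realTree.chain (v := fun i => g ^ i • x) (fun i => by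
    rw [show i + 2 = (i + 1) + 1 from rfl, hs (i + 1), hs i, pow_succ, mul_smul, A.smul_mem_seg]
    exact h) (fun i => by
    rw [hs i]
    exact fun e => hne ((MulAction.injective _ e).symm)) k
  have h2 := hc.2
  simp only [pow_zero, one_smul] at h2
  rw [h2, Finset.sum_congr rfl (fun i _ => by rw [hs i, A.dist_smul]), Finset.sum_const,
    Finset.card_range, nsmul_eq_mul]

theorem len_of_axis {g : FreeGroup (Fin n)} {x : A} (hne : g • x ≠ x)
    (h : g • x ∈ seg x (g • g • x)) : A.len g = dist x (g • x) := by
  have := A.realTree.nonempty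
  refine le_antisymm (A.len_le g x) (le_ciInf fun y => ?_)
  refine le_of_forall_nat_mul_le (C := 2 * dist x y) fun k => ?_
  rw [← A.dist_pow_of_axis hne h]
  have h1 := A.dist_pow_le g y k
  have h2 := dist_triangle4 x y (g ^ k • y) (g ^ k • x)
  rw [A.dist_smul, dist_comm y x] at h2
  linarith

/-- For arbitrary x the path x, gx, ggx backtracks from gx up to the median p. Cutting off this
backtracking leads to the axis. If it reached half of d(x, gx), the midpoint of x and gx would be
fixed unless the two halves just meet, and the action is free. -/
theorem exists_axis {g : FreeGroup (Fin n)} (hg : g ≠ 1) :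
    ∃ x : A, g • x ≠ x ∧ g • x ∈ seg x (g • g • x) := by
  have hfree : ∀ x : A, g • x ≠ x := fun x h => hg (A.free g x h)
  obtain ⟨x⟩ := A.realTree.nonempty
  obtain ⟨p, hp1, hp2, hp3⟩ := A.realTree.exists_median (g • x) x (g • g • x)
  set D := dist x (g • x) with hD
  have hD2 : dist (g • x) (g • g • x) = D := A.dist_smul _ _ _
  rcases le_total (dist (g • x) p) (D / 2) with ha | ha
  · refine ⟨g⁻¹ • p, hfree _, ?_⟩
    rw [smul_inv_smul]
    have e1 : g⁻¹ • p ∈ seg x (g • x) := by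
      rw [← A.smul_mem_seg g, smul_inv_smul]
      exact hp2
    have e2 : dist x (g⁻¹ • p) = dist (g • x) p := by
      rw [← A.dist_smul g, smul_inv_smul]
    have e3 : dist x p = D - dist (g • x) p := by
      have := hp1
      rw [mem_seg] at this
      rw [dist_comm p x, dist_comm (g • x) x] at this
      linarith
    have e4 : g⁻¹ • p ∈ seg x p := by
      apply mem_seg_of_le
      rw [A.realTree.dist_of_mem_seg e1 (mem_seg_swap hp1), e2, e3,
        abs_of_nonpos (by linarith)]
      linarith
    have e5 : g • p ∈ seg (g • x) (g • g • x) := by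
      rw [A.smul_mem_seg]
      exact mem_seg_swap hp1
    have e6 : dist (g • x) (g • p) = D - dist (g • x) p := by rw [A.dist_smul, e3]
    have e7 : p ∈ seg (g • x) (g • p) := by
      apply mem_seg_of_le
      rw [A.realTree.dist_of_mem_seg hp2 e5, e6, abs_of_nonpos (by linarith)]
      linarith
    have e8 : g • p ∈ seg p (g • g • x) := mem_seg_trans_right e5 e7
    have e9 : p ∈ seg (g⁻¹ • p) (g • g • x) := mem_seg_trans_right hp3 e4
    exact mem_seg_swap (mem_seg_trans_right (mem_seg_swap e9) (mem_seg_swap e8))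
  · exfalso
    obtain ⟨γ, -, -, -, hγ, -, hs⟩ := A.realTree.exists_param (g • x) p
    have hm : D / 2 ∈ Icc 0 (dist (g • x) p) := ⟨by positivity, ha⟩
    have hmp : γ (D / 2) ∈ seg (g • x) p := hs ▸ mem_image_of_mem _ hm
    have hd := hγ _ hm
    have h1 := mem_seg_trans hp1 hmp
    have h2 := mem_seg_trans hp2 hmp
    have h3 : g • γ (D / 2) ∈ seg (g • x) (g • g • x) := by
      rw [A.smul_mem_seg]
      exact mem_seg_swap h1
    have h4 := A.realTree.dist_of_mem_seg h3 h2
    rw [A.dist_smul, hd] at h4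
    rw [mem_seg, hd, dist_comm _ x, dist_comm (g • x) x, ← hD] at h1
    rw [show dist x (γ (D / 2)) = D / 2 by linarith, sub_self, abs_zero] at h4
    exact hfree _ (dist_eq_zero.1 h4)

theorem len_pos {g : FreeGroup (Fin n)} (hg : g ≠ 1) : 0 < A.len g := by
  obtain ⟨x, hne, hx⟩ := A.exists_axis hg
  rw [A.len_of_axis hne hx]
  exact dist_pos.2 hne.symm

/-- The hypothesis on `v 1` excludes backtracking where a period and its translate meet, so that `v
0` lies on the axis of g. -/
theorem len_of_periodic {v : ℕ → A} (hv : ∀ i, v (i + 1) ∈ seg (v i) (v (i + 2)))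
    (hne : ∀ i, v i ≠ v (i + 1)) {N : ℕ} (hN : 0 < N) {g : FreeGroup (Fin n)}
    (h0 : g • v 0 = v N) (h1 : g • v 1 = v (N + 1)) :
    g ≠ 1 ∧ g • v 0 ∈ seg (v 0) (g • g • v 0) ∧
      A.len g = ∑ i ∈ Finset.range N, dist (v i) (v (i + 1)) := by
  have hc := A.realTree.chain hv hne
  have hpos : 0 < dist (v 0) (v N) := by
    rw [(hc N).2]
    exact Finset.sum_pos (fun i _ => dist_pos.2 (hne i)) ⟨0, Finset.mem_range.2 hN⟩
  have hfix : g • v 0 ≠ v 0 := by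
    rw [h0]
    exact (dist_pos.1 hpos).symm
  have hone : ∀ k, v 1 ∈ seg (v 0) (v (k + 1)) := by
    intro k
    induction k with
    | zero => exact right_mem_seg _ _
    | succ k ih => exact mem_seg_trans (hc (k + 1)).1 ih
  have hax : g • v 0 ∈ seg (v 0) (g • g • v 0) := by
    rw [h0]
    refine (A.realTree.mem_seg_concat (hc N).1 ?_ (hne N)).1
    rw [← h1]
    nth_rewrite 1 [← h0]
    rw [A.smul_mem_seg]
    obtain ⟨m, rfl⟩ := Nat.exists_eq_succ_of_ne_zero hN.ne'
    exact hone m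
  refine ⟨?_, hax, ?_⟩
  · rintro rfl
    exact hfix (one_smul _ _)
  · rw [A.len_of_axis hfix hax, h0, (hc N).2]

/-- Equivariant maps that send segments to segments monotonically. -/
structure IsBetween {A Z : MarkedTree n} (c : A → Z) : Prop where
  equivariant : ∀ (g : FreeGroup (Fin n)) x, c (g • x) = g • c x
  between : ∀ x y, ∀ z ∈ seg x y, c z ∈ seg (c x) (c y)

/-- Such a map sends axis points to axis points, so one point computes the translation lengths in A
and in all such targets. -/
theorem IsBetween.len_eq {A Z : MarkedTree n} {c : A → Z} (hc : IsBetween c)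
    {g : FreeGroup (Fin n)} (hg : g ≠ 1) {x : A} (h : g • x ∈ seg x (g • g • x)) :
    Z.len g = dist (c x) (g • c x) := by
  refine Z.len_of_axis (fun e => hg (Z.free _ _ e)) ?_
  have := hc.between _ _ _ h
  rw [hc.equivariant, hc.equivariant] at this
  exact this

theorem len_le_of_lipschitz {A Z : MarkedTree n} {c : A → Z} {K : ℝ} (hK : 0 ≤ K)
    (he : ∀ (g : FreeGroup (Fin n)) x, c (g • x) = g • c x)
    (hc : ∀ x y, dist (c x) (c y) ≤ K * dist x y) (g : FreeGroup (Fin n)) :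
    Z.len g ≤ K * A.len g := by
  have := A.realTree.nonempty
  unfold len
  rw [Real.mul_iInf_of_nonneg hK]
  refine le_ciInf fun x => (Z.len_le g (c x)).trans ?_
  rw [← he]
  exact hc _ _

end MarkedTree

/-! ### Weighted fundamental domains and the volume of the quotient graph. -/

namespace MarkedTree

variable {n : ℕ}

instance (A : MarkedTree n) : MeasurableSpace A := borel A

instance (A : MarkedTree n) : BorelSpace A := ⟨rfl⟩

/-- The length measure of a tree. -/
noncomputable def lengthMeasure (A : MarkedTree n) : Measure A := μH[1]

instance (A : MarkedTree n) : NullSingletonClass A.lengthMeasure :=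
  nullSingletonClass_hausdorff A one_pos

theorem lengthMeasure_seg (A : MarkedTree n) (x y : A) :
    A.lengthMeasure (seg x y) = ENNReal.ofReal (dist x y) := A.realTree.hausdorffMeasure_seg x y

theorem measurable_smul (A : MarkedTree n) (g : FreeGroup (Fin n)) :
    Measurable fun x : A => g • x :=
  (Isometry.of_dist_eq fun x y => A.dist_smul g x y).continuous.measurable

theorem lintegral_smul (A : MarkedTree n) (g : FreeGroup (Fin n)) {ψ : A → ENNReal}
    (hψ : Measurable ψ) : ∫⁻ x, ψ (g • x) ∂A.lengthMeasure = ∫⁻ x, ψ x ∂A.lengthMeasure := by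
  let e : A ≃ᵢ A := ⟨MulAction.toPerm g, Isometry.of_dist_eq fun x y => A.dist_smul g x y⟩
  exact (e.measurePreserving_hausdorffMeasure 1).lintegral_comp hψ

/-- A function whose translates sum up to one: a weighted fundamental domain. -/
structure IsUnfolding (A : MarkedTree n) (φ : A → ENNReal) : Prop where
  measurable : Measurable φ
  tsum_eq : ∀ᵐ x ∂A.lengthMeasure, ∑' g : FreeGroup (Fin n), φ (g • x) = 1

/-- The unfolding trick: insert the sum of the translates of φ, which is one, and move the group
element to h by invariance of the measure. -/
theorem IsUnfolding.lintegral_eq {A : MarkedTree n} {φ : A → ENNReal} (hφ : A.IsUnfolding φ)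
    {h : A → ENNReal} (hh : Measurable h) :
    ∫⁻ x, h x ∂A.lengthMeasure =
      ∫⁻ x, φ x * ∑' g : FreeGroup (Fin n), h (g⁻¹ • x) ∂A.lengthMeasure := by
  have e1 : ∫⁻ x, h x ∂A.lengthMeasure =
      ∫⁻ x, ∑' g : FreeGroup (Fin n), h x * φ (g • x) ∂A.lengthMeasure := by
    refine lintegral_congr_ae ?_
    filter_upwards [hφ.tsum_eq] with x hx
    rw [ENNReal.tsum_mul_left, hx, mul_one]
  have m1 : ∀ g : FreeGroup (Fin n), Measurable fun x => h x * φ (g • x) := fun g =>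
    hh.mul (hφ.measurable.comp (A.measurable_smul g))
  have m2 : ∀ g : FreeGroup (Fin n), Measurable fun x => φ x * h (g⁻¹ • x) := fun g =>
    hφ.measurable.mul (hh.comp (A.measurable_smul g⁻¹))
  rw [e1, lintegral_tsum fun g => (m1 g).aemeasurable]
  have e2 : ∀ g : FreeGroup (Fin n), ∫⁻ x, h x * φ (g • x) ∂A.lengthMeasure =
      ∫⁻ x, φ x * h (g⁻¹ • x) ∂A.lengthMeasure := by
    intro g
    rw [← A.lintegral_smul g (m2 g)]
    simp only [inv_smul_smul, mul_comm]
  rw [tsum_congr e2, ← lintegral_tsum fun g => (m2 g).aemeasurable]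
  simp only [ENNReal.tsum_mul_left]

theorem tsum_inv_smul (A : MarkedTree n) (ψ : A → ENNReal) (x : A) :
    ∑' g : FreeGroup (Fin n), ψ (g⁻¹ • x) = ∑' g : FreeGroup (Fin n), ψ (g • x) :=
  (Equiv.inv (FreeGroup (Fin n))).tsum_eq fun g => ψ (g • x)

theorem IsUnfolding.lintegral_unique {A : MarkedTree n} {φ ψ : A → ENNReal}
    (hφ : A.IsUnfolding φ) (hψ : A.IsUnfolding ψ) :
    ∫⁻ x, φ x ∂A.lengthMeasure = ∫⁻ x, ψ x ∂A.lengthMeasure := by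
  rw [hφ.lintegral_eq hψ.measurable]
  refine lintegral_congr_ae ?_
  filter_upwards [hψ.tsum_eq] with x hx
  rw [A.tsum_inv_smul, hx, mul_one]

/-- If I covers each point of the quotient at most M times, it meets an invariant set N in at most M
times the measure of N modulo the group. -/
theorem IsUnfolding.measure_inter_le {A : MarkedTree n} {φ : A → ENNReal} (hφ : A.IsUnfolding φ)
    {I N : Set A} (hI : MeasurableSet I) (hN : MeasurableSet N)
    (hNG : ∀ (g : FreeGroup (Fin n)) x, g • x ∈ N → x ∈ N) {M : ENNReal}
    (hM : ∀ x, ∑' g : FreeGroup (Fin n), I.indicator 1 (g • x) ≤ M) :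
    A.lengthMeasure (I ∩ N) ≤ M * ∫⁻ x, φ x * N.indicator 1 x ∂A.lengthMeasure := by
  have m1 : Measurable fun x => φ x * N.indicator 1 x :=
    hφ.measurable.mul (measurable_one.indicator hN)
  rw [← lintegral_indicator_one (hI.inter hN), hφ.lintegral_eq
    (measurable_one.indicator (hI.inter hN)),
    ← lintegral_const_mul _ m1]
  refine lintegral_mono fun x => ?_
  rw [mul_left_comm]
  refine mul_le_mul_right ?_ _
  by_cases hx : x ∈ N
  · rw [indicator_of_mem hx, Pi.one_apply, mul_one]
    refine le_trans ?_ (hM x)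
    rw [← A.tsum_inv_smul]
    refine ENNReal.tsum_le_tsum fun g => ?_
    exact indicator_le_indicator_of_subset inter_subset_left (fun _ => zero_le) _
  · rw [indicator_of_notMem hx, mul_zero, nonpos_iff_eq_zero, ENNReal.tsum_eq_zero]
    intro g
    exact indicator_of_notMem (fun h => hx (hNG _ _ h.2)) _

instance (A : MarkedTree n) : Finite A.GraphEdge := by
  obtain ⟨S, hS, h⟩ := A.simplicial.finite_edges
  have : Finite S := hS
  choose g p hpS h1 h2 using fun e : A.GraphEdge => h _ _ e.out.2
  refine Finite.of_injective (fun e => (⟨p e, hpS e⟩ : S)) fun e e' hee => ?_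
  have hp : p e = p e' := congrArg Subtype.val hee
  rw [← Quotient.out_eq e, ← Quotient.out_eq e']
  refine Quotient.sound ⟨g e' * (g e)⁻¹, ?_, ?_⟩
  · rw [← h1 e, ← h1 e', mul_smul, inv_smul_smul, hp]
  · rw [← h2 e, ← h2 e', mul_smul, inv_smul_smul, hp]

theorem exists_edge (A : MarkedTree n) : ∃ v w : A, A.Edge v w := by
  obtain ⟨x⟩ := A.realTree.nonempty
  by_cases hx : x ∈ branchPoints A
  · have hx' := hx
    obtain ⟨a, -, -, ha, -⟩ := hx'
    obtain ⟨w, hw, -⟩ := A.simplicial.exists_edge_toward A.realTree hx ha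
    exact ⟨x, w, hw⟩
  · obtain ⟨v, w, he, -⟩ := A.simplicial.edge_nhds x hx
    exact ⟨v, w, he⟩

instance (A : MarkedTree n) : Nonempty A.GraphEdge := by
  obtain ⟨v, w, he⟩ := A.exists_edge
  exact ⟨Quotient.mk A.edgeSetoid ⟨(v, w), he⟩⟩

theorem smul_edge (A : MarkedTree n) (g : FreeGroup (Fin n)) {v w : A} (h : A.Edge v w) :
    A.Edge (g • v) (g • w) :=
  (edge_homothety (A := A) (B := A) (MulAction.toPerm g) 1 one_pos
    (fun x y => by rw [one_mul]; exact A.dist_smul g x y) v w).2 h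

/-- Equivariant maps that collapse parts of a tree and do not fold. -/
structure IsCollapse {A Z : MarkedTree n} (c : A → Z) : Prop extends IsBetween c where
  surjective : Function.Surjective c
  continuous : Continuous c

theorem isCollapse_id (A : MarkedTree n) : IsCollapse (id : A → A) :=
  ⟨⟨fun _ _ => rfl, fun _ _ _ h => h⟩, Function.surjective_id, continuous_id⟩

theorem IsCollapse.image_seg {A Z : MarkedTree n} {c : A → Z} (hc : IsCollapse c) (x y : A) :
    c '' seg x y = seg (c x) (c y) := by
  apply Subset.antisymm
  · rintro _ ⟨z, hz, rfl⟩
    exact hc.between x y z hz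
  · exact Z.realTree.seg_subset_of_isPreconnected
      ((A.realTree.isPreconnected_seg x y).image _ hc.continuous.continuousOn)
      (mem_image_of_mem _ (left_mem_seg _ _)) (mem_image_of_mem _ (right_mem_seg _ _))

/-- The length of the image of an edge. -/
noncomputable def imageLen {A Z : MarkedTree n} (c : A → Z) (hc : IsBetween c) :
    A.GraphEdge → ℝ :=
  Quotient.lift (fun e : A.OEdge => dist (c e.1.1) (c e.1.2)) (by
    rintro e e' ⟨g, h1, h2⟩
    show dist (c e.1.1) (c e.1.2) = dist (c e'.1.1) (c e'.1.2)
    rw [← h1, ← h2, hc.equivariant, hc.equivariant, Z.dist_smul])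

theorem imageLen_out {A Z : MarkedTree n} (c : A → Z) (hc : IsBetween c) (e : A.GraphEdge) :
    imageLen c hc e = dist (c e.out.1.1) (c e.out.1.2) := by
  conv_lhs => rw [← Quotient.out_eq e]
  rfl

theorem imageLen_nonneg {A Z : MarkedTree n} (c : A → Z) (hc : IsBetween c) (e : A.GraphEdge) :
    0 ≤ imageLen c hc e := by
  rw [imageLen_out]
  exact dist_nonneg

end MarkedTree

/-- The half of a segment that is close to its first end-point. -/
def halfSeg {X : Type} [MetricSpace X] (x y : X) : Set X := {z ∈ seg x y | 2 * dist x z ≤ dist x y}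

namespace MarkedTree

variable {n : ℕ}

theorem isClosed_halfSeg (A : MarkedTree n) (x y : A) : IsClosed (halfSeg x y) :=
  (A.realTree.isClosed_seg x y).inter (isClosed_le (f := fun z => 2 * dist x z) (by fun_prop)
    continuous_const)

theorem lengthMeasure_halfSeg (A : MarkedTree n) (x y : A) :
    A.lengthMeasure (halfSeg x y) = ENNReal.ofReal (dist x y / 2) := by
  obtain ⟨γ, -, -, -, h, -, hs⟩ := A.realTree.exists_param x y
  have hm : dist x y / 2 ∈ Icc 0 (dist x y) := ⟨by positivity, by
    linarith [dist_nonneg (x := x) (y := y)]⟩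
  have hd := h _ hm
  have hms : γ (dist x y / 2) ∈ seg x y := hs ▸ mem_image_of_mem _ hm
  have : halfSeg x y = seg x (γ (dist x y / 2)) := by
    ext z
    constructor
    · rintro ⟨hz, hz2⟩
      apply mem_seg_of_le
      rw [A.realTree.dist_of_mem_seg hz hms, hd, abs_of_nonpos (by linarith)]
      linarith
    · intro hz
      refine ⟨mem_seg_trans hms hz, ?_⟩
      have := dist_left_le_of_mem_seg hz
      linarith
  rw [this, lengthMeasure_seg, hd]

theorem smul_mem_halfSeg (A : MarkedTree n) (g : FreeGroup (Fin n)) {x y z : A} :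
    g • z ∈ halfSeg x y ↔ z ∈ halfSeg (g⁻¹ • x) (g⁻¹ • y) := by
  conv_lhs => rw [← smul_inv_smul g x, ← smul_inv_smul g y]
  change _ ∧ _ ↔ _ ∧ _
  rw [A.smul_mem_seg, A.dist_smul, A.dist_smul]

/-- Away from the countably many images of vertices, a fibre is convex without vertices, so it lies
in a single edge. Away from midpoints, the half then determines the orientation. -/
theorem IsCollapse.exists_unique_halfSeg {A Z : MarkedTree n} {c : A → Z} (hc : IsCollapse c) :
    ∀ᵐ z ∂Z.lengthMeasure, ∃ v w : A, A.Edge v w ∧ z ∈ halfSeg (c v) (c w) ∧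
      ∀ v' w', A.Edge v' w' → z ∈ halfSeg (c v') (c w') → v' = v ∧ w' = w := by
  have hVc : (branchPoints A).Countable := A.simplicial.countable
  have hbad : (c '' branchPoints A ∪ ⋃ p ∈ branchPoints A ×ˢ branchPoints A,
      {z ∈ seg (c p.1) (c p.2) | 2 * dist (c p.1) z = dist (c p.1) (c p.2)}).Countable := by
    refine (hVc.image _).union ((hVc.prod hVc).biUnion fun p _ => Set.Subsingleton.countable ?_)
    rintro z ⟨hz, hz'⟩ u ⟨hu, hu'⟩
    have := Z.realTree.dist_of_mem_seg hz hu
    rw [show dist (c p.1) z - dist (c p.1) u = 0 by linarith, abs_zero] at this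
    exact dist_eq_zero.1 this
  filter_upwards [measure_eq_zero_iff_ae_notMem.1 (hbad.measure_zero Z.lengthMeasure)] with z hz
  simp only [mem_union, not_or, mem_iUnion, not_exists] at hz
  have hmid : ∀ v w, A.Edge v w → z ∈ halfSeg (c v) (c w) → z ∉ halfSeg (c w) (c v) := by
    rintro v w he h1 h2
    refine hz.2 (v, w) ⟨he.1, he.2.1⟩ ⟨h1.1, ?_⟩
    have h3 := h1.1
    rw [mem_seg] at h3
    have h4 := h1.2
    have h5 := h2.2
    rw [dist_comm (c w) z, dist_comm (c w) (c v)] at h5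
    linarith
  obtain ⟨x, rfl⟩ := hc.surjective z
  have hxV : x ∉ branchPoints A := fun h => hz.1 (mem_image_of_mem _ h)
  obtain ⟨v₀, w₀, he₀, hx₀, -⟩ := A.simplicial.edge_nhds x hxV
  have hex : ∃ v w : A, A.Edge v w ∧ c x ∈ halfSeg (c v) (c w) := by
    have h := hc.between _ _ _ hx₀
    by_cases h2 : 2 * dist (c v₀) (c x) ≤ dist (c v₀) (c w₀)
    · exact ⟨v₀, w₀, he₀, h, h2⟩
    · refine ⟨w₀, v₀, he₀.symm, mem_seg_swap h, ?_⟩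
      rw [mem_seg] at h
      rw [dist_comm (c w₀) (c x), dist_comm (c w₀) (c v₀)]
      linarith
  obtain ⟨v, w, he, hzs⟩ := hex
  refine ⟨v, w, he, hzs, fun v' w' he' hzs' => ?_⟩
  have h1 := hzs.1
  have h2 := hzs'.1
  rw [← hc.image_seg] at h1 h2
  obtain ⟨y, hy, hyz⟩ := h1
  obtain ⟨y', hy', hyz'⟩ := h2
  have hfree : ∀ u ∈ seg y y', u ∉ branchPoints A := by
    intro u hu huV
    have h3 := hc.between _ _ _ hu
    rw [hyz, hyz', seg_self] at h3
    exact hz.1 ⟨u, huV, h3⟩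
  rcases A.realTree.edge_unique subset_rfl he he' hy hy' hfree with h | h
  · exact h
  · obtain ⟨rfl, rfl⟩ := h
    exact absurd hzs' (hmid _ _ he hzs)

/-- One initial half for each oriented edge of the quotient graph: the two orientations contribute
the two halves, which matches the factor 1/2 in `vol`. Collapsed edges contribute null sets. -/
theorem IsCollapse.exists_isUnfolding {A Z : MarkedTree n} {c : A → Z} (hc : IsCollapse c) :
    ∃ φ, Z.IsUnfolding φ ∧ ∫⁻ z, φ z ∂Z.lengthMeasure =
      ENNReal.ofReal ((1 / 2) * ∑ᶠ e, imageLen c hc.toIsBetween e) := by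
  have hmeas : ∀ e : A.GraphEdge, Measurable
      ((halfSeg (c e.out.1.1) (c e.out.1.2)).indicator (1 : Z → ENNReal)) := fun e =>
    measurable_one.indicator (Z.isClosed_halfSeg _ _).measurableSet
  refine ⟨fun z => ∑' e : A.GraphEdge,
    (halfSeg (c e.out.1.1) (c e.out.1.2)).indicator 1 z, ⟨Measurable.tsum hmeas, ?_⟩, ?_⟩
  · filter_upwards [hc.exists_unique_halfSeg] with z hz
    obtain ⟨v, w, he, hzs, huniq⟩ := hz
    have hmem : ∀ (g : FreeGroup (Fin n)) (e : A.GraphEdge),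
        g • z ∈ halfSeg (c e.out.1.1) (c e.out.1.2) ↔
          g⁻¹ • e.out.1.1 = v ∧ g⁻¹ • e.out.1.2 = w := by
      intro g e
      rw [Z.smul_mem_halfSeg, ← hc.equivariant, ← hc.equivariant]
      constructor
      · intro h
        exact huniq _ _ (A.smul_edge _ e.out.2) h
      · rintro ⟨h1, h2⟩
        rwa [h1, h2]
    set e₀ : A.GraphEdge := Quotient.mk A.edgeSetoid ⟨(v, w), he⟩ with he₀
    obtain ⟨g₀, h1, h2⟩ : ∃ g : FreeGroup (Fin n), g • v = e₀.out.1.1 ∧ g • w = e₀.out.1.2 :=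
      Quotient.exact (Quotient.out_eq e₀).symm
    rw [tsum_eq_single g₀, tsum_eq_single e₀]
    · refine indicator_of_mem ((hmem _ _).2 ⟨?_, ?_⟩) _
      · rw [← h1, inv_smul_smul]
      · rw [← h2, inv_smul_smul]
    · intro e hne
      refine indicator_of_notMem (fun h => hne ?_) _
      obtain ⟨h3, h4⟩ := (hmem _ _).1 h
      rw [he₀, ← Quotient.out_eq e]
      exact Quotient.sound ⟨g₀⁻¹, h3, h4⟩
    · intro g hne
      rw [ENNReal.tsum_eq_zero]
      intro e
      refine indicator_of_notMem (fun h => hne ?_) _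
      obtain ⟨h3, h4⟩ := (hmem _ _).1 h
      have hee : e = e₀ := by
        rw [he₀, ← Quotient.out_eq e]
        exact Quotient.sound ⟨g⁻¹, h3, h4⟩
      rw [hee, ← h1] at h3
      have := A.free (g⁻¹ * g₀) v (by rw [mul_smul, h3])
      exact inv_mul_eq_one.1 this
  · rw [lintegral_tsum fun e => (hmeas e).aemeasurable]
    have e1 : ∀ e : A.GraphEdge, ∫⁻ z, (halfSeg (c e.out.1.1) (c e.out.1.2)).indicator 1 z
        ∂Z.lengthMeasure = ENNReal.ofReal (imageLen c hc.toIsBetween e / 2) := by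
      intro e
      rw [lintegral_indicator_one (Z.isClosed_halfSeg _ _).measurableSet, lengthMeasure_halfSeg,
        imageLen_out]
    have := Fintype.ofFinite A.GraphEdge
    rw [tsum_congr e1, tsum_fintype, finsum_eq_sum_of_fintype, Finset.mul_sum,
      ENNReal.ofReal_sum_of_nonneg
        (fun e _ => mul_nonneg (by norm_num) (imageLen_nonneg c hc.toIsBetween e))]
    refine Finset.sum_congr rfl fun e _ => ?_
    congr 1
    ring

theorem edgeLen_out (A : MarkedTree n) (e : A.GraphEdge) :
    A.edgeLen e = dist e.out.1.1 e.out.1.2 := imageLen_out id A.isCollapse_id.toIsBetween e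

theorem vol_pos (A : MarkedTree n) : 0 < A.vol := by
  have := Fintype.ofFinite A.GraphEdge
  unfold vol
  rw [finsum_eq_sum_of_fintype]
  refine mul_pos (by norm_num) (Finset.sum_pos (fun e _ => ?_) Finset.univ_nonempty)
  rw [A.edgeLen_out]
  exact dist_pos.2 e.out.2.2.2.1

theorem exists_isUnfolding (A : MarkedTree n) : ∃ φ, A.IsUnfolding φ :=
  let ⟨φ, hφ, _⟩ := A.isCollapse_id.exists_isUnfolding
  ⟨φ, hφ⟩

theorem IsUnfolding.lintegral {A : MarkedTree n} {φ : A → ENNReal} (hφ : A.IsUnfolding φ) :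
    ∫⁻ x, φ x ∂A.lengthMeasure = ENNReal.ofReal A.vol := by
  obtain ⟨ψ, hψ, h⟩ := A.isCollapse_id.exists_isUnfolding
  rw [hφ.lintegral_unique hψ, h]
  rfl

/-- All weighted fundamental domains have equal mass, so the volume of Z can be computed with the
edges of A, although Z has its own branch points. -/
theorem IsCollapse.vol_eq {A Z : MarkedTree n} {c : A → Z} (hc : IsCollapse c) :
    Z.vol = (1 / 2) * ∑ᶠ e, imageLen c hc.toIsBetween e := by
  obtain ⟨ψ, hψ, h⟩ := hc.exists_isUnfolding
  rw [hψ.lintegral, ENNReal.ofReal_eq_ofReal_iff Z.vol_pos.le] at h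
  · exact h
  · exact mul_nonneg (by norm_num) (finsum_nonneg (imageLen_nonneg c hc.toIsBetween))

end MarkedTree

namespace MarkedTree

variable {n : ℕ}

/-! ### How often a loop covers a point of the graph. -/

section Multiplicity

/-- The translates of x in I have distinct images in a segment of Z, pairwise at distance at least δ
because every element moves every point of Z by at least its translation length. -/
theorem tsum_indicator_le {A Z : MarkedTree n} {c : A → Z}
    (hc : ∀ (g : FreeGroup (Fin n)) x, c (g • x) = g • c x) {δ : ℝ} (hδ : 0 < δ)
    (hlen : ∀ g : FreeGroup (Fin n), g ≠ 1 → δ ≤ Z.len g) {I : Set A} {a b : Z}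
    (hI : ∀ x ∈ I, c x ∈ seg a b) (x : A) :
    ∑' g : FreeGroup (Fin n), I.indicator 1 (g • x) ≤ ENNReal.ofReal (dist a b / δ + 1) := by
  classical
  rw [ENNReal.tsum_eq_iSup_sum]
  refine iSup_le fun F => ?_
  have e1 : ∑ g ∈ F, I.indicator (1 : A → ENNReal) (g • x) =
      ((F.filter fun g => g • x ∈ I).card : ENNReal) := by
    rw [Finset.card_filter, Nat.cast_sum]
    refine Finset.sum_congr rfl fun g _ => ?_
    by_cases h : g • x ∈ I <;> simp [h]
  have hinj : Function.Injective fun g : FreeGroup (Fin n) => g • c x := by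
    intro g h hgh
    have := Z.free (h⁻¹ * g) (c x) (by
      rw [mul_smul, show g • c x = h • c x from hgh, inv_smul_smul])
    exact (inv_mul_eq_one.1 this).symm
  have h := Z.realTree.card_le_of_separated hδ
    ((F.filter fun g => g • x ∈ I).image fun g => g • c x) (x := a) (y := b) (by
      intro z hz
      obtain ⟨g, hg, rfl⟩ := Finset.mem_image.1 hz
      have := hI _ (Finset.mem_filter.1 hg).2
      rwa [hc] at this) (by
      intro z hz u hu hzu
      obtain ⟨g, hg, rfl⟩ := Finset.mem_image.1 hz
      obtain ⟨h, hh, rfl⟩ := Finset.mem_image.1 hu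
      have hne : g⁻¹ * h ≠ 1 := fun e => hzu (by rw [inv_mul_eq_one.1 e])
      refine (hlen _ hne).trans ((Z.len_le _ (c x)).trans_eq ?_)
      rw [← Z.dist_smul g, mul_smul, smul_inv_smul])
  rw [Finset.card_image_of_injective _ hinj] at h
  rw [e1, ← ENNReal.ofReal_natCast]
  exact ENNReal.ofReal_le_ofReal h

/-- A tree that collapses to a thick tree has not much longer loops. -/
theorem IsBetween.mul_len_le {A Z : MarkedTree n} {c : A → Z} (hc : IsBetween c) {δ : ℝ}
    (hδ : 0 < δ) (hlen : ∀ g : FreeGroup (Fin n), g ≠ 1 → δ ≤ Z.len g)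
    {g : FreeGroup (Fin n)} (hg : g ≠ 1) : δ * A.len g ≤ A.vol * Z.len g := by
  obtain ⟨x, hne, hx⟩ := A.exists_axis hg
  have hcx := hc.len_eq hg hx
  have hcx' : g • c x ∈ seg (c x) (g • g • c x) := by
    have := hc.between _ _ _ hx
    rw [hc.equivariant, hc.equivariant] at this
    exact this
  obtain ⟨φ, hφ⟩ := A.exists_isUnfolding
  -- The axis segment over k periods has length k l_A(g) and covers each point of the graph of A at
  -- most k l_Z(g) / δ + 1 times.
  have key : ∀ k : ℕ, k * A.len g ≤ k * (Z.len g / δ * A.vol) + A.vol := by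
    intro k
    have h := hφ.measure_inter_le (I := seg x (g ^ k • x)) (N := univ)
      (A.realTree.isClosed_seg _ _).measurableSet MeasurableSet.univ (fun _ _ _ => mem_univ _)
      (tsum_indicator_le hc.equivariant hδ hlen
        (fun y hy => hc.between _ _ y hy))
    simp only [inter_univ, indicator_univ, Pi.one_apply, mul_one] at h
    rw [lengthMeasure_seg, hφ.lintegral, ← ENNReal.ofReal_mul
      (add_nonneg (div_nonneg dist_nonneg hδ.le) zero_le_one), ENNReal.ofReal_le_ofReal_iff
      (mul_nonneg (add_nonneg (div_nonneg dist_nonneg hδ.le) zero_le_one) A.vol_pos.le),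
      hc.equivariant, A.dist_pow_of_axis hne hx,
      Z.dist_pow_of_axis (fun e => hg (Z.free _ _ e)) hcx',
      ← hcx, ← A.len_of_axis hne hx] at h
    calc k * A.len g ≤ _ := h
      _ = _ := by ring
  have h := le_of_forall_nat_mul_le key
  rw [div_mul_eq_mul_div, le_div_iff₀ hδ] at h
  linarith

/-- For the trivial group minimality would reduce the tree to a point, which has no edges; this
disposes of rank zero. -/
theorem exists_ne_one (A : MarkedTree n) : ∃ g : FreeGroup (Fin n), g ≠ 1 := by
  by_contra! h
  obtain ⟨v, w, he⟩ := A.exists_edge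
  have := A.minimal {v} ⟨v, rfl⟩ (by
    intro g x hx
    rw [h g, one_smul]
    exact hx) (by
    rintro x rfl y rfl
    rw [seg_self])
  exact he.2.2.1 (this ▸ mem_univ w : w ∈ ({v} : Set A)).symm

theorem exists_len_le_vol (A : MarkedTree n) :
    ∃ g : FreeGroup (Fin n), g ≠ 1 ∧ A.len g ≤ 2 * A.vol := by
  by_contra! h
  obtain ⟨g, hg⟩ := A.exists_ne_one
  -- For the identity collapse the counting bound says that δ is at most the volume.
  have h1 := A.isCollapse_id.toIsBetween.mul_len_le (δ := 2 * A.vol)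
    (by linarith [A.vol_pos]) (fun g hg => (h g hg).le) hg
  nlinarith [A.vol_pos, A.len_pos hg]

end Multiplicity

/-! ### The area formula for piecewise isometric maps. -/

/-- Maps that are isometric on the pieces of a countable compact cover. -/
def IsPiecewise {A B : MarkedTree n} (Q : A → B) : Prop :=
  ∃ P : ℕ → Set A, (∀ j, IsCompact (P j)) ∧ ⋃ j, P j = univ ∧
    ∀ j, ∀ x ∈ P j, ∀ y ∈ P j, dist (Q x) (Q y) = dist x y

theorem IsPiecewise.of_countable {A B : MarkedTree n} {Q : A → B} {S : Set (Set A)}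
    (hS : S.Countable) (hc : ∀ P ∈ S, IsCompact P) (hcov : ∀ x, ∃ P ∈ S, x ∈ P)
    (hiso : ∀ P ∈ S, ∀ x ∈ P, ∀ y ∈ P, dist (Q x) (Q y) = dist x y) : IsPiecewise Q := by
  obtain ⟨x⟩ := A.realTree.nonempty
  obtain ⟨P₀, hP₀, -⟩ := hcov x
  obtain ⟨f, rfl⟩ := hS.exists_eq_range ⟨P₀, hP₀⟩
  refine ⟨f, fun j => hc _ ⟨j, rfl⟩, ?_, fun j => hiso _ ⟨j, rfl⟩⟩
  rw [eq_univ_iff_forall]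
  intro y
  obtain ⟨_, ⟨j, rfl⟩, hy⟩ := hcov y
  exact mem_iUnion.2 ⟨j, hy⟩

/-- The number of preimages of a point. -/
noncomputable def mult {A B : MarkedTree n} (Q : A → B) (y : B) : ENNReal := (Q ⁻¹' {y}).encard

/-- The set of points at which a map fails to be injective. -/
def foldedSet {A B : MarkedTree n} (Q : A → B) : Set A := {x | ∃ x', x' ≠ x ∧ Q x' = Q x}

section Area

variable {A B : MarkedTree n} {Q : A → B}

/-- A countable Borel partition on whose pieces the map is isometric. -/
structure IsPartition (Q : A → B) (D : ℕ → Set A) : Prop where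
  measurable : ∀ j, MeasurableSet (D j)
  disjoint : Pairwise (Function.onFun Disjoint D)
  cover : ⋃ j, D j = univ
  isometric : ∀ j, ∀ x ∈ D j, ∀ y ∈ D j, dist (Q x) (Q y) = dist x y
  image : ∀ j, ∀ S ⊆ D j, MeasurableSet S → MeasurableSet (Q '' S)
  measurable_map : Measurable Q

theorem IsPiecewise.exists_partition (hQ : IsPiecewise Q) : ∃ D, IsPartition Q D := by
  obtain ⟨P, hP, hcov, hiso⟩ := hQ
  have hPm : ∀ j, MeasurableSet (P j) := fun j => (hP j).isClosed.measurableSet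
  have hemb : ∀ j, MeasurableEmbedding fun x : P j => Q x := by
    intro j
    have : CompactSpace (P j) := isCompact_iff_compactSpace.1 (hP j)
    have h : Isometry fun x : P j => Q x := Isometry.of_dist_eq fun x y => hiso j x x.2 y y.2
    exact h.isClosedEmbedding.measurableEmbedding
  refine ⟨disjointed P, MeasurableSet.disjointed hPm, disjoint_disjointed P,
    by rw [iUnion_disjointed, hcov], fun j x hx y hy => hiso j x (disjointed_subset P j hx) y
      (disjointed_subset P j hy), ?_, ?_⟩
  · intro j S hS hSm
    have : Q '' S = (fun x : P j => Q x) '' (Subtype.val ⁻¹' S) := by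
      ext y
      constructor
      · rintro ⟨x, hx, rfl⟩
        exact ⟨⟨x, disjointed_subset P j (hS hx)⟩, hx, rfl⟩
      · rintro ⟨x, hx, rfl⟩
        exact ⟨x, hx, rfl⟩
    rw [this]
    exact (hemb j).measurableSet_image.2 (measurable_subtype_coe hSm)
  · intro S hS
    have : Q ⁻¹' S = ⋃ j, Subtype.val '' ((fun x : P j => Q x) ⁻¹' S) := by
      ext x
      simp only [mem_preimage, mem_iUnion, mem_image, Subtype.exists, exists_and_right,
        exists_eq_right]
      constructor
      · intro hx
        obtain ⟨j, hj⟩ := mem_iUnion.1 (hcov ▸ mem_univ x : x ∈ ⋃ j, P j)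
        exact ⟨j, hj, hx⟩
      · rintro ⟨j, -, hx⟩
        exact hx
    rw [this]
    exact MeasurableSet.iUnion fun j => (hPm j).subtype_image ((hemb j).measurable hS)

theorem foldedSet_eq : foldedSet Q = Q ⁻¹' {y | 1 < mult Q y} := by
  ext x
  have : 1 < mult Q (Q x) ↔ 1 < (Q ⁻¹' {Q x}).encard := by
    unfold mult
    exact_mod_cast Iff.rfl
  simp only [mem_preimage, mem_ofPred_eq, this, one_lt_encard_iff]
  constructor
  · rintro ⟨x', hne, h⟩
    exact ⟨x', x, h, rfl, hne⟩
  · rintro ⟨a, b, ha, hb, hab⟩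
    by_cases hax : a = x
    · exact ⟨b, fun e => hab (hax.trans e.symm), hb⟩
    · exact ⟨a, hax, ha⟩

namespace IsPartition

variable {D : ℕ → Set A} (hD : IsPartition Q D)

include hD

theorem measure_image {j : ℕ} {S : Set A} (hS : S ⊆ D j) :
    B.lengthMeasure (Q '' S) = A.lengthMeasure S :=
  hausdorffMeasure_image_of_isometricOn Q S fun x hx y hy =>
    hD.isometric j x (hS hx) y (hS hy)

theorem measure_eq_tsum {S : Set A} (hS : MeasurableSet S) :
    A.lengthMeasure S = ∑' j, B.lengthMeasure (Q '' (S ∩ D j)) := by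
  have e : S = ⋃ j, S ∩ D j := by rw [← inter_iUnion, hD.cover, inter_univ]
  conv_lhs => rw [e]
  rw [measure_iUnion (fun i j hij => (hD.disjoint hij).mono inter_subset_right inter_subset_right)
    fun j => hS.inter (hD.measurable j)]
  exact tsum_congr fun j => (hD.measure_image inter_subset_right).symm

theorem measure_image_le {S : Set A} (hS : MeasurableSet S) :
    B.lengthMeasure (Q '' S) ≤ A.lengthMeasure S := by
  rw [hD.measure_eq_tsum hS]
  refine (measure_mono ?_).trans (measure_iUnion_le fun j => Q '' (S ∩ D j))
  rw [← image_iUnion, ← inter_iUnion, hD.cover, inter_univ]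

theorem measure_le_of_injOn {S : Set A} (hS : MeasurableSet S) (hinj : InjOn Q S) {J : Set B}
    (hJ : Q '' S ⊆ J) : A.lengthMeasure S ≤ B.lengthMeasure J := by
  rw [hD.measure_eq_tsum hS, ← measure_iUnion]
  · refine measure_mono (iUnion_subset fun j => ?_)
    exact (image_mono inter_subset_left).trans hJ
  · intro i j hij
    rw [Function.onFun, Set.disjoint_left]
    rintro _ ⟨x, hx, rfl⟩ ⟨y, hy, hxy⟩
    have := hinj hy.1 hx.1 hxy
    exact Set.disjoint_left.1 (hD.disjoint hij) hx.2 (this ▸ hy.2)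
  · exact fun j => hD.image j _ inter_subset_right (hS.inter (hD.measurable j))

/-- The map is injective on each piece and the pieces are disjoint, so preimages of y correspond to
pieces whose image contains y. -/
theorem mult_eq (y : B) : mult Q y = ∑' j, (Q '' D j).indicator 1 y := by
  have e : ∀ j, (Q '' D j).indicator (1 : B → ENNReal) y =
      {j | y ∈ Q '' D j}.indicator (fun _ => 1) j := by
    intro j
    by_cases h : y ∈ Q '' D j
    · rw [indicator_of_mem h, indicator_of_mem (show j ∈ {j | y ∈ Q '' D j} from h)]
      rfl
    · rw [indicator_of_notMem h, indicator_of_notMem (show j ∉ {j | y ∈ Q '' D j} from h)]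
  rw [tsum_congr e, ← tsum_subtype {j | y ∈ Q '' D j} (fun _ => (1 : ENNReal)),
    ENNReal.tsum_set_one, mult]
  congr 1
  have hex : ∀ x : A, ∃ j, x ∈ D j := fun x => mem_iUnion.1 (hD.cover ▸ mem_univ x)
  choose J hJ using hex
  have himg : {j | y ∈ Q '' D j} = J '' (Q ⁻¹' {y}) := by
    ext j
    constructor
    · rintro ⟨x, hx, rfl⟩
      refine ⟨x, rfl, ?_⟩
      by_contra hne
      exact Set.disjoint_left.1 (hD.disjoint hne) (hJ x) hx
    · rintro ⟨x, hx, rfl⟩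
      exact ⟨x, hJ x, hx⟩
  rw [himg, InjOn.encard_image]
  intro x hx x' hx' h
  have h1 := hD.isometric (J x) x (hJ x) x' (h ▸ hJ x')
  rw [show Q x = y from hx, show Q x' = y from hx', dist_self] at h1
  exact dist_eq_zero.1 h1.symm

theorem measurable_mult : Measurable (mult Q) := by
  have : mult Q = fun y => ∑' j, (Q '' D j).indicator 1 y := funext hD.mult_eq
  rw [this]
  exact Measurable.tsum fun j =>
    measurable_one.indicator (hD.image j _ subset_rfl (hD.measurable j))

theorem lintegral_comp {ψ : B → ENNReal} (hψ : Measurable ψ) :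
    ∫⁻ x, ψ (Q x) ∂A.lengthMeasure = ∫⁻ y, ψ y * mult Q y ∂B.lengthMeasure := by
  have himg : ∀ j, MeasurableSet (Q '' D j) := fun j => hD.image j _ subset_rfl (hD.measurable j)
  have hmap : Measure.map Q A.lengthMeasure =
      Measure.sum fun j => B.lengthMeasure.restrict (Q '' D j) := by
    ext S hS
    rw [Measure.map_apply hD.measurable_map hS, hD.measure_eq_tsum (hD.measurable_map hS),
      Measure.sum_apply _ hS]
    refine tsum_congr fun j => ?_
    rw [Measure.restrict_apply hS]
    congr 1
    rw [inter_comm, image_inter_preimage, inter_comm]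
  rw [← lintegral_map hψ hD.measurable_map, hmap, lintegral_sum_measure]
  have e : ∀ y, ψ y * mult Q y = ∑' j, (Q '' D j).indicator ψ y := by
    intro y
    rw [hD.mult_eq, ← ENNReal.tsum_mul_left]
    refine tsum_congr fun j => ?_
    by_cases h : y ∈ Q '' D j <;> simp [h]
  rw [lintegral_congr e, lintegral_tsum fun j => (hψ.indicator (himg j)).aemeasurable]
  exact tsum_congr fun j => (lintegral_indicator (himg j) ψ).symm

theorem measurableSet_one_lt_mult : MeasurableSet {y | 1 < mult Q y} :=
  measurableSet_lt measurable_const hD.measurable_mult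

theorem measurableSet_foldedSet : MeasurableSet (foldedSet Q) := by
  rw [foldedSet_eq]
  exact hD.measurable_map hD.measurableSet_one_lt_mult

/-- By the area formula the preimage of a null set is a null set. Together with the area formula
this expresses the volume of A as an integral over B. -/
theorem isUnfolding_comp (he : ∀ (g : FreeGroup (Fin n)) x, Q (g • x) = g • Q x)
    {φ : B → ENNReal} (hφ : B.IsUnfolding φ) : A.IsUnfolding (φ ∘ Q) := by
  refine ⟨hφ.measurable.comp hD.measurable_map, ?_⟩
  have hm : Measurable fun y => ∑' g : FreeGroup (Fin n), φ (g • y) :=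
    Measurable.tsum fun g => hφ.measurable.comp (B.measurable_smul g)
  have hS : MeasurableSet {y | ¬ ∑' g : FreeGroup (Fin n), φ (g • y) = 1} :=
    (hm (measurableSet_singleton 1)).compl
  have h0 := hφ.tsum_eq
  rw [ae_iff] at h0 ⊢
  have h := hD.lintegral_comp
    (measurable_one.indicator hS : Measurable ({y | ¬ ∑' g, φ (g • y) = 1}.indicator 1))
  have e1 : ∀ x, {y | ¬ ∑' g : FreeGroup (Fin n), φ (g • y) = 1}.indicator (1 : B → ENNReal) (Q x) =
      (Q ⁻¹' {y | ¬ ∑' g : FreeGroup (Fin n), φ (g • y) = 1}).indicator 1 x := fun x => rfl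
  rw [lintegral_congr e1, lintegral_indicator_one (hD.measurable_map hS)] at h
  have e2 : ∫⁻ y, {y | ¬ ∑' g : FreeGroup (Fin n), φ (g • y) = 1}.indicator 1 y * mult Q y
      ∂B.lengthMeasure = 0 := by
    refine (lintegral_congr_ae (g := fun _ => 0) ?_).trans lintegral_zero
    filter_upwards [hφ.tsum_eq] with y hy
    simp [hy]
  rw [e2] at h
  simp only [Function.comp_apply, he]
  exact h

theorem vol_eq (he : ∀ (g : FreeGroup (Fin n)) x, Q (g • x) = g • Q x)
    {φ : B → ENNReal} (hφ : B.IsUnfolding φ) :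
    ENNReal.ofReal A.vol = ∫⁻ y, φ y * mult Q y ∂B.lengthMeasure := by
  rw [← hD.lintegral_comp hφ.measurable, ← (hD.isUnfolding_comp he hφ).lintegral]
  rfl

/-- As integrals over B this is a pointwise inequality for the multiplicity m: for m = 1 it reads 2
≤ 2, for m ≥ 2 it reads 2 + m ≤ 2m. -/
theorem two_mul_vol_add_le (he : ∀ (g : FreeGroup (Fin n)) x, Q (g • x) = g • Q x)
    (hs : Function.Surjective Q) {φ : B → ENNReal} (hφ : B.IsUnfolding φ) :
    2 * ENNReal.ofReal B.vol + ∫⁻ x, φ (Q x) * (foldedSet Q).indicator 1 x ∂A.lengthMeasure ≤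
      2 * ENNReal.ofReal A.vol := by
  have hm : Measurable fun y => φ y * {y | 1 < mult Q y}.indicator 1 y :=
    hφ.measurable.mul (measurable_one.indicator hD.measurableSet_one_lt_mult)
  have hm2 : Measurable fun y => φ y * mult Q y := hφ.measurable.mul hD.measurable_mult
  have e1 : ∫⁻ x, φ (Q x) * (foldedSet Q).indicator 1 x ∂A.lengthMeasure =
      ∫⁻ y, φ y * {y | 1 < mult Q y}.indicator 1 y * mult Q y ∂B.lengthMeasure := by
    rw [← hD.lintegral_comp hm, foldedSet_eq]
    rfl
  rw [e1, hD.vol_eq he hφ, ← hφ.lintegral, ← lintegral_const_mul _ hφ.measurable,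
    ← lintegral_const_mul _ hm2,
    ← lintegral_add_left (hφ.measurable.const_mul 2)]
  refine lintegral_mono fun y => ?_
  have h1 : 1 ≤ mult Q y := by
    obtain ⟨x, rfl⟩ := hs y
    have : 1 ≤ (Q ⁻¹' {Q x}).encard := by
      rw [one_le_encard_iff_nonempty]
      exact ⟨x, rfl⟩
    unfold mult
    exact_mod_cast this
  by_cases h : 1 < mult Q y
  · have h2 : 2 ≤ mult Q y := by
      have h' : (1 : ℕ∞) < (Q ⁻¹' {y}).encard := by
        unfold mult at h
        exact_mod_cast h
      have h3 : (2 : ℕ∞) ≤ (Q ⁻¹' {y}).encard := by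
        have := Order.add_one_le_of_lt h'
        rwa [one_add_one_eq_two] at this
      unfold mult
      exact_mod_cast h3
    rw [indicator_of_mem (show y ∈ {y | 1 < mult Q y} from h), Pi.one_apply, mul_one, mul_comm 2,
      ← mul_add, mul_left_comm, two_mul]
    gcongr
  · rw [indicator_of_notMem (show y ∉ {y | 1 < mult Q y} from h), mul_zero, zero_mul, add_zero]
    change 2 * φ y ≤ 2 * (φ y * mult Q y)
    gcongr
    exact le_mul_of_one_le_right' h1

theorem dist_le_of_continuousOn (hc : ∀ x y, ContinuousOn Q (seg x y)) (x y : A) :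
    dist (Q x) (Q y) ≤ dist x y := by
  have h1 : seg (Q x) (Q y) ⊆ Q '' seg x y := B.realTree.seg_subset_of_isPreconnected
    ((A.realTree.isPreconnected_seg x y).image _ (hc x y))
    (mem_image_of_mem _ (left_mem_seg _ _)) (mem_image_of_mem _ (right_mem_seg _ _))
  have h2 := (measure_mono h1).trans
    (hD.measure_image_le (A.realTree.isClosed_seg x y).measurableSet)
  rwa [lengthMeasure_seg, lengthMeasure_seg, ENNReal.ofReal_le_ofReal_iff dist_nonneg] at h2

end IsPartition

/-- Almost every unfolded point z of the segment is mapped into the segment from Q x to Q y, and Q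
is injective and measure preserving on such points. -/
theorem dist_le_dist_add_measure (hQ : IsPiecewise Q) (hc : ∀ x y, ContinuousOn Q (seg x y))
    (x y : A) : ENNReal.ofReal (dist x y) ≤
      ENNReal.ofReal (dist (Q x) (Q y)) + A.lengthMeasure (seg x y ∩ foldedSet Q) := by
  obtain ⟨D, hD⟩ := hQ.exists_partition
  obtain ⟨γ, h0, h1, hγ, hγx, hγs, hs⟩ := A.realTree.exists_param x y
  set T : ℕ → Set ℝ := fun j => {t ∈ Icc 0 (dist x y) | γ t ∈ D j} with hT
  -- Only countably many parameters are isolated within their piece from one side; all others have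
  -- points of the same piece on both sides.
  have hbadT : (⋃ j, ({t | t ∈ T j ∧ 𝓝[T j ∩ Ioi t] t = ⊥} ∪
      {t | t ∈ T j ∧ 𝓝[T j ∩ Iio t] t = ⊥})).Countable :=
    countable_iUnion fun j =>
      countable_setOfPred_isolated_right_within.union countable_setOfPred_isolated_left_within
  set bad := γ '' ⋃ j, ({t | t ∈ T j ∧ 𝓝[T j ∩ Ioi t] t = ⊥} ∪
      {t | t ∈ T j ∧ 𝓝[T j ∩ Iio t] t = ⊥}) with hbad
  have hbadc : bad.Countable := hbadT.image γ
  have key : Q '' ((seg x y \ foldedSet Q) \ bad) ⊆ seg (Q x) (Q y) := by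
    rintro _ ⟨z, ⟨⟨hz, hzN⟩, hzb⟩, rfl⟩
    have htm : dist x z ∈ Icc 0 (dist x y) := ⟨dist_nonneg, dist_left_le_of_mem_seg hz⟩
    obtain ⟨j, hj⟩ := mem_iUnion.1 (hD.cover ▸ mem_univ z : z ∈ ⋃ j, D j)
    have htT : dist x z ∈ T j := ⟨htm, by rwa [hγs z hz]⟩
    have hnb : dist x z ∉ ⋃ j, ({t | t ∈ T j ∧ 𝓝[T j ∩ Ioi t] t = ⊥} ∪
      {t | t ∈ T j ∧ 𝓝[T j ∩ Iio t] t = ⊥}) := fun h => hzb ⟨_, h, hγs z hz⟩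
    simp only [mem_iUnion, not_exists, mem_union, not_or, mem_ofPred_eq, not_and] at hnb
    have hr : (𝓝[T j ∩ Ioi (dist x z)] (dist x z)).NeBot := ⟨(hnb j).1 htT⟩
    have hl : (𝓝[T j ∩ Iio (dist x z)] (dist x z)).NeBot := ⟨(hnb j).2 htT⟩
    obtain ⟨t₁, ht₁, hlt₁⟩ := hr.nonempty_of_mem self_mem_nhdsWithin
    obtain ⟨t₀, ht₀, hlt₀⟩ := hl.nonempty_of_mem self_mem_nhdsWithin
    rw [mem_Ioi] at hlt₁
    rw [mem_Iio] at hlt₀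
    have ha : γ t₀ ∈ seg x y := hs ▸ mem_image_of_mem _ ht₀.1
    have hb : γ t₁ ∈ seg x y := hs ▸ mem_image_of_mem _ ht₁.1
    have hzab : z ∈ seg (γ t₀) (γ t₁) := by
      rw [← hγs z hz, mem_seg, hγ _ ht₀.1 _ htm, hγ _ htm _ ht₁.1, hγ _ ht₀.1 _ ht₁.1,
        abs_of_neg (by linarith), abs_of_neg (by linarith), abs_of_neg (by linarith)]
      ring
    have hQz : Q z ∈ seg (Q (γ t₀)) (Q (γ t₁)) := by
      rw [mem_seg, hD.isometric j _ ht₀.2 _ hj, hD.isometric j _ hj _ ht₁.2,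
        hD.isometric j _ ht₀.2 _ ht₁.2]
      exact hzab
    -- As z is the only preimage of Q z, paths that avoid z have images that avoid Q z. So Q x and Q
    -- y stay on the sides of the images of γ t₀ and γ t₁.
    have hno : ∀ u v : A, z ∉ seg u v → Q z ∉ seg (Q u) (Q v) := by
      intro u v huv h
      obtain ⟨z', hz', hzz'⟩ := B.realTree.seg_subset_of_isPreconnected
        ((A.realTree.isPreconnected_seg u v).image _ (hc u v))
        (mem_image_of_mem _ (left_mem_seg _ _)) (mem_image_of_mem _ (right_mem_seg _ _)) h
      by_cases e : z' = z
      · exact huv (e ▸ hz')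
      · exact hzN ⟨z', e, hzz'⟩
    have hn1 : z ∉ seg (γ t₀) x := by
      intro h
      have := dist_left_le_of_mem_seg (mem_seg_swap h)
      rw [hγx _ ht₀.1] at this
      linarith
    have hn2 : z ∉ seg y (γ t₁) := by
      intro h
      have h2 := dist_left_le_of_mem_seg h
      rw [mem_seg] at hz hb
      rw [hγx _ ht₁.1, dist_comm (γ t₁) y] at hb
      rw [dist_comm z y] at hz
      linarith
    have h2 := (B.realTree.mem_seg_or_mem_seg hQz (Q x)).resolve_left (hno _ _ hn1)
    exact (B.realTree.mem_seg_or_mem_seg h2 (Q y)).resolve_right (hno _ _ hn2)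
  have hS : MeasurableSet ((seg x y \ foldedSet Q) \ bad) :=
    ((A.realTree.isClosed_seg x y).measurableSet.diff hD.measurableSet_foldedSet).diff
      hbadc.measurableSet
  have hinj : InjOn Q ((seg x y \ foldedSet Q) \ bad) := by
    intro a ha b hb hab
    by_contra hne
    exact hb.1.2 ⟨a, hne, hab⟩
  have h2 := hD.measure_le_of_injOn hS hinj key
  rw [lengthMeasure_seg] at h2
  rw [← lengthMeasure_seg]
  have hsub : seg x y ⊆ ((seg x y \ foldedSet Q) \ bad) ∪ (seg x y ∩ foldedSet Q) ∪ bad := by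
    intro z hz
    by_cases hzb : z ∈ bad
    · exact Or.inr hzb
    by_cases hzN : z ∈ foldedSet Q
    · exact Or.inl (Or.inr ⟨hz, hzN⟩)
    · exact Or.inl (Or.inl ⟨⟨hz, hzN⟩, hzb⟩)
  calc A.lengthMeasure (seg x y) ≤ _ := measure_mono hsub
    _ ≤ _ := measure_union_le _ _
    _ ≤ _ := add_le_add_left (measure_union_le _ _) _
    _ ≤ _ := by
      rw [hbadc.measure_zero, add_zero]
      gcongr

/-! ### Loss of length and loss of volume under a folding map. -/

/-- Equivariant surjections that are isometric on pieces. -/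
structure IsFolding (Q : A → B) : Prop where
  equivariant : ∀ (g : FreeGroup (Fin n)) x, Q (g • x) = g • Q x
  surjective : Function.Surjective Q
  piecewise : IsPiecewise Q
  continuousOn : ∀ x y, ContinuousOn Q (seg x y)

namespace IsFolding

variable (hQ : IsFolding Q)

include hQ

theorem dist_le (x y : A) : dist (Q x) (Q y) ≤ dist x y :=
  let ⟨_, hD⟩ := hQ.piecewise.exists_partition
  hD.dist_le_of_continuousOn hQ.continuousOn x y

theorem len_le (g : FreeGroup (Fin n)) : B.len g ≤ A.len g := by
  have := len_le_of_lipschitz zero_le_one hQ.equivariant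
    (fun x y => by rw [one_mul]; exact hQ.dist_le x y) g
  rwa [one_mul] at this

theorem smul_mem_foldedSet (g : FreeGroup (Fin n)) (x : A) (h : g • x ∈ foldedSet Q) :
    x ∈ foldedSet Q := by
  obtain ⟨x', hne, h⟩ := h
  refine ⟨g⁻¹ • x', fun e => hne ?_, ?_⟩
  · rw [← e, smul_inv_smul]
  · rw [hQ.equivariant, h, hQ.equivariant, inv_smul_smul]

theorem vol_le : B.vol ≤ A.vol := by
  obtain ⟨D, hD⟩ := hQ.piecewise.exists_partition
  obtain ⟨φ, hφ⟩ := B.exists_isUnfolding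
  have h := le_self_add.trans (hD.two_mul_vol_add_le hQ.equivariant hQ.surjective hφ)
  rwa [ENNReal.mul_le_mul_iff_right (by norm_num) (by norm_num),
    ENNReal.ofReal_le_ofReal_iff A.vol_pos.le] at h

theorem exists_unfolding : ∃ φ, A.IsUnfolding φ ∧
    ∫⁻ x, φ x * (foldedSet Q).indicator 1 x ∂A.lengthMeasure ≤
      ENNReal.ofReal (2 * (A.vol - B.vol)) := by
  obtain ⟨D, hD⟩ := hQ.piecewise.exists_partition
  obtain ⟨φ, hφ⟩ := B.exists_isUnfolding
  refine ⟨φ ∘ Q, hD.isUnfolding_comp hQ.equivariant hφ, ?_⟩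
  have h := hD.two_mul_vol_add_le hQ.equivariant hQ.surjective hφ
  have e : (2 : ENNReal) * ENNReal.ofReal A.vol =
      2 * ENNReal.ofReal B.vol + ENNReal.ofReal (2 * (A.vol - B.vol)) := by
    rw [show (2 : ENNReal) = ENNReal.ofReal 2 by norm_num, ← ENNReal.ofReal_mul (by norm_num),
      ← ENNReal.ofReal_mul (by norm_num), ← ENNReal.ofReal_add (by linarith [B.vol_pos])
      (by linarith [hQ.vol_le])]
    congr 1
    ring
  rw [e] at h
  exact (ENNReal.add_le_add_iff_left
    (ENNReal.mul_ne_top (by norm_num) ENNReal.ofReal_ne_top)).1 h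

theorem isometry_of_vol_eq (hv : A.vol = B.vol) (x y : A) : dist (Q x) (Q y) = dist x y := by
  refine le_antisymm (hQ.dist_le x y) ?_
  obtain ⟨D, hD⟩ := hQ.piecewise.exists_partition
  obtain ⟨φ, hφ, hi⟩ := hQ.exists_unfolding
  -- The trivial bound ⊤ on the multiplicity suffices: the folded set is null modulo the group, and
  -- ⊤ * 0 = 0.
  have h := hφ.measure_inter_le (A.realTree.isClosed_seg x y).measurableSet
    hD.measurableSet_foldedSet hQ.smul_mem_foldedSet (M := ⊤) (fun _ => le_top)
  rw [hv, sub_self, mul_zero, ENNReal.ofReal_zero, nonpos_iff_eq_zero] at hi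
  rw [hi, mul_zero, nonpos_iff_eq_zero] at h
  have h2 := dist_le_dist_add_measure hQ.piecewise hQ.continuousOn x y
  rwa [h, add_zero, ENNReal.ofReal_le_ofReal_iff dist_nonneg] at h2

/-- The loss of length is controlled by the loss of volume. -/
theorem len_sub_len_le {δ : ℝ} (hδ : 0 < δ)
    (hlen : ∀ g : FreeGroup (Fin n), g ≠ 1 → δ ≤ A.len g) {g : FreeGroup (Fin n)} (hg : g ≠ 1) :
    A.len g - B.len g ≤ 2 * (A.vol - B.vol) * (A.len g / δ) := by
  obtain ⟨D, hD⟩ := hQ.piecewise.exists_partition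
  obtain ⟨φ, hφ, hi⟩ := hQ.exists_unfolding
  obtain ⟨x, hne, hx⟩ := A.exists_axis hg
  obtain ⟨y, hney, hy⟩ := B.exists_axis hg
  have hvol : 0 ≤ 2 * (A.vol - B.vol) := by linarith [hQ.vol_le]
  -- Over k periods the loss is at most the covering number times the mass of the folded set. The
  -- constant term allows for Q x not lying on the axis of g in B.
  have key : ∀ k : ℕ, k * A.len g ≤ k * (B.len g + 2 * (A.vol - B.vol) * (A.len g / δ)) +
      (2 * dist (Q x) y + 2 * (A.vol - B.vol)) := by
    intro k
    have h := hφ.measure_inter_le (A.realTree.isClosed_seg x (g ^ k • x)).measurableSet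
      hD.measurableSet_foldedSet hQ.smul_mem_foldedSet
      (tsum_indicator_le (c := id) (fun _ _ => rfl) hδ hlen (fun _ h => h))
    have h2 := (dist_le_dist_add_measure hQ.piecewise hQ.continuousOn x (g ^ k • x)).trans
      (add_le_add_right (h.trans (mul_le_mul_right hi _)) _)
    have hnn : 0 ≤ dist x (g ^ k • x) / δ + 1 := by positivity
    rw [← ENNReal.ofReal_mul hnn, ← ENNReal.ofReal_add dist_nonneg (mul_nonneg hnn hvol),
      ENNReal.ofReal_le_ofReal_iff (add_nonneg dist_nonneg (mul_nonneg hnn hvol)),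
      A.dist_pow_of_axis hne hx, ← A.len_of_axis hne hx, hQ.equivariant] at h2
    have h3 := dist_triangle4 (Q x) y (g ^ k • y) (g ^ k • Q x)
    rw [B.dist_smul, dist_comm y (Q x), B.dist_pow_of_axis hney hy,
      ← B.len_of_axis hney hy] at h3
    calc k * A.len g ≤ _ := h2
      _ ≤ (dist (Q x) y + k * B.len g + dist (Q x) y) +
          (k * A.len g / δ + 1) * (2 * (A.vol - B.vol)) := by gcongr
      _ = _ := by ring
  have h := le_of_forall_nat_mul_le key
  linarith

end IsFolding

end Area

end MarkedTree

/-- The hypothesis is linear in the relative loss of v and useful only for small losses. Uniform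
continuity of v splits the interval into steps with small loss, over which the logarithmic bounds
add up. -/
theorem log_sub_log_le_of_local {l v : ℝ → ℝ} {a b κ : ℝ} (hκ : 0 ≤ κ)
    (hl : ∀ t ∈ Icc a b, 0 < l t) (hv : ∀ t ∈ Icc a b, 0 < v t) (hc : ContinuousOn v (Icc a b))
    (hanti : AntitoneOn v (Icc a b))
    (h : ∀ s ∈ Icc a b, ∀ t ∈ Icc a b, s ≤ t → l s - l t ≤ κ * ((v s - v t) / v s) * l s)
    {s t : ℝ} (hs : s ∈ Icc a b) (ht : t ∈ Icc a b) (hst : s ≤ t) :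
    Real.log (l s) - Real.log (l t) ≤ 2 * κ * (Real.log (v s) - Real.log (v t)) := by
  have hb : b ∈ Icc a b := ⟨hs.1.trans hs.2, le_rfl⟩
  have hvb := hv b hb
  -- Since v is at least v b, a drop below this bound gives a relative drop u with κ u ≤ 1/2.
  have hη : 0 < v b / (2 * κ + 1) := by positivity
  obtain ⟨η, hη0, huc⟩ := Metric.uniformContinuousOn_iff.1
    (isCompact_Icc.uniformContinuousOn_of_continuous hc) _ hη
  have small : ∀ s ∈ Icc a b, ∀ t ∈ Icc a b, s ≤ t → t - s < η →
      Real.log (l s) - Real.log (l t) ≤ 2 * κ * (Real.log (v s) - Real.log (v t)) := by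
    intro s hs t ht hst hd
    have h1 := huc s hs t ht (by
      rw [Real.dist_eq, abs_sub_comm, abs_of_nonneg (by linarith)]
      exact hd)
    have h2 := hanti hs ht hst
    have h3 := hanti hs hb hs.2
    rw [Real.dist_eq, abs_of_nonneg (by linarith)] at h1
    have hvs := hv s hs
    have hvt := hv t ht
    have hls := hl s hs
    have hlt := hl t ht
    set u := (v s - v t) / v s with hu
    have hu0 : 0 ≤ u := div_nonneg (by linarith) hvs.le
    have hvtu : v t = v s * (1 - u) := by
      rw [hu]
      field_simp
      ring
    have hu1 : u < 1 := by
      by_contra! hge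
      nlinarith
    have hz : κ * u ≤ 1 / 2 := by
      rw [lt_div_iff₀ (by positivity)] at h1
      rw [hu, ← mul_div_assoc, div_le_iff₀ hvs]
      nlinarith
    have hlt' : l s * (1 - κ * u) ≤ l t := by
      have := h s hs t ht hst
      linarith
    have e1 : Real.log (l s) + Real.log (1 - κ * u) ≤ Real.log (l t) := by
      rw [← Real.log_mul hls.ne' (by linarith)]
      exact Real.log_le_log (mul_pos hls (by linarith)) hlt'
    -- Here log (1 - z) ≥ -2z for 0 ≤ z ≤ 1/2 causes the factor 2 in the conclusion.
    have e2 : -(2 * (κ * u)) ≤ Real.log (1 - κ * u) := by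
      refine le_trans ?_ (Real.one_sub_inv_le_log_of_pos (by linarith))
      have : (1 - κ * u)⁻¹ ≤ 1 + 2 * (κ * u) := by
        rw [inv_le_iff_one_le_mul₀ (by linarith)]
        nlinarith [mul_nonneg hκ hu0]
      linarith
    have e3 : u ≤ Real.log (v s) - Real.log (v t) := by
      rw [hvtu, Real.log_mul hvs.ne' (by linarith)]
      have := Real.log_le_sub_one_of_pos (show 0 < 1 - u by linarith)
      linarith
    nlinarith
  have step : ∀ k : ℕ, ∀ s ∈ Icc a b, ∀ t ∈ Icc a b, s ≤ t → t - s ≤ k * (η / 2) →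
      Real.log (l s) - Real.log (l t) ≤ 2 * κ * (Real.log (v s) - Real.log (v t)) := by
    intro k
    induction k with
    | zero =>
      intro s hs t ht hst hd
      exact small s hs t ht hst (by simp at hd; linarith)
    | succ k ih =>
      intro s hs t ht hst hd
      push_cast at hd
      have hu : max s (t - η / 2) ∈ Icc a b :=
        ⟨hs.1.trans (le_max_left _ _), max_le hs.2 (by linarith [ht.2])⟩
      have h1 := ih s hs _ hu (le_max_left _ _) (by
        rcases max_cases s (t - η / 2) with h | h
        · rw [h.1, sub_self]
          positivity
        · rw [h.1]
          linarith)
      have h2 := small _ hu t ht (max_le hst (by linarith))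
        (by linarith [le_max_right s (t - η / 2)])
      linarith
  obtain ⟨k, hk⟩ := exists_nat_gt ((t - s) / (η / 2))
  rw [div_lt_iff₀ (by positivity)] at hk
  exact step k s hs t ht hst hk.le

theorem encard_image_eq_of_iff {α β γ : Type} {q : α → β} {q' : α → γ} {S : Set α}
    (h : ∀ x ∈ S, ∀ y ∈ S, q x = q y ↔ q' x = q' y) : (q '' S).encard = (q' '' S).encard := by
  obtain ⟨T, hT, hb⟩ := (surjOn_image q S).exists_bijOn_subset
  have hinj : InjOn q' T := fun x hx y hy hxy => hb.injOn hx hy ((h x (hT hx) y (hT hy)).2 hxy)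
  rw [← hb.image_eq, hb.injOn.encard_image, ← hinj.encard_image]
  congr 1
  apply Subset.antisymm (image_mono hT)
  rintro _ ⟨x, hx, rfl⟩
  obtain ⟨y, hy, hyx⟩ := hb.surjOn (mem_image_of_mem q hx)
  exact ⟨y, hy, (h y (hT hy) x hx).1 hyx⟩

open MarkedTree

variable {n : ℕ}

/-! ### Fast folding between two successive times. -/

section Fold

variable {C X Y B : MarkedTree n} {f : C → B} {W : Set C} {U : Set B} {s t : ℝ} {q : C → X}
  {f' : X → B} {q₂ : C → Y} {f₂ : Y → B}

theorem FoldRel.mono (hst : s ≤ t) {x y : C} (h : FoldRel f W s x y) : FoldRel f W t x y :=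
  Relation.EqvGen.mono (fun _ _ ⟨h1, v, hv, h2, h3⟩ =>
    ⟨h1, v, hv, h2.trans hst, h3.trans hst⟩) x y h

theorem FoldRel.map_eq {x y : C} (h : FoldRel f W s x y) : f x = f y := by
  induction h with
  | rel x y h => exact h.1
  | refl x => rfl
  | symm x y _ ih => exact ih.symm
  | trans x y z _ _ ih1 ih2 => exact ih1.trans ih2

/-- A chain of identifications never leaves a fibre of f, so only the distances of points of that
fibre to vertices matter. -/
theorem FoldRel.of_iff {z : B} (hz : ∀ x, f x = z → ∀ v ∈ W, dist v x ≤ s → dist v x ≤ t)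
    {x y : C} (h : FoldRel f W s x y) (hx : f x = z) : FoldRel f W t x y := by
  induction h with
  | rel x y h =>
    obtain ⟨h1, v, hv, h2, h3⟩ := h
    exact Relation.EqvGen.rel _ _ ⟨h1, v, hv, hz x hx v hv h2, hz y (h1 ▸ hx) v hv h3⟩
  | refl x => exact Relation.EqvGen.refl _
  | symm x y h ih => exact Relation.EqvGen.symm _ _ (ih ((FoldRel.map_eq h).trans hx))
  | trans x y w h1 _ ih1 ih2 =>
    exact Relation.EqvGen.trans _ _ _ (ih1 hx) (ih2 ((FoldRel.map_eq h1).symm.trans hx))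

theorem IsFold.dist_le (hS : IsSimplicial f W U) (h : IsFold f W s q f') (x y : C) :
    dist (q x) (q y) ≤ dist x y := by
  have := hS.source.dist_le_of_edges C.realTree zero_le_one q
    (fun v w he x hx y hy => by rw [h.isometric v w he x hx y hy, one_mul]) x y
  rwa [one_mul] at this

theorem IsFold.continuous (hS : IsSimplicial f W U) (h : IsFold f W s q f') : Continuous q :=
  (LipschitzWith.of_dist_le' (K := 1) fun x y => by
    rw [one_mul]; exact h.dist_le hS x y).continuous

theorem IsFold.isPiecewise_of_factor (hS : IsSimplicial f W U) (h : IsFold f W s q f')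
    {Z : MarkedTree n}
    {Q : X → Z} {q₂ : C → Z} (hQ : ∀ x, Q (q x) = q₂ x)
    (hiso : ∀ v w, IsEdge W v w → ∀ x ∈ seg v w, ∀ y ∈ seg v w, dist (q₂ x) (q₂ y) = dist x y) :
    IsPiecewise Q := by
  refine IsPiecewise.of_countable (S := (fun p => q '' seg p.1 p.2) '' edgePairs W)
    (hS.source.edgePairs_countable.image _) ?_ ?_ ?_
  · rintro _ ⟨p, -, rfl⟩
    exact (C.realTree.isCompact_seg _ _).image (h.continuous hS)
  · intro x
    obtain ⟨c, rfl⟩ := h.surjective x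
    obtain ⟨p, hp, hc⟩ := hS.source.exists_edgePair c
    exact ⟨_, ⟨p, hp, rfl⟩, c, hc, rfl⟩
  · rintro _ ⟨p, hp, rfl⟩ _ ⟨x, hx, rfl⟩ _ ⟨y, hy, rfl⟩
    rw [hQ, hQ, dist_eq_of_edgePair hiso hp hx hy, dist_eq_of_edgePair h.isometric hp hx hy]

theorem IsFold.equivariant_factor (h : IsFold f W s q f')
    (hf : ∀ (g : FreeGroup (Fin n)) x, f (g • x) = g • f x) (g : FreeGroup (Fin n)) (x : X) :
    f' (g • x) = g • f' x := by
  obtain ⟨c, rfl⟩ := h.surjective x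
  rw [← h.equivariant, h.factor, h.factor, hf]

/-- Folding longer factors through folding shorter. -/
theorem IsFold.exists_isFolding (hS : IsSimplicial f W U) (h : IsFold f W s q f')
    (h₂ : IsFold f W t q₂ f₂) (hst : s ≤ t) : ∃ Q : X → Y, IsFolding Q := by
  set Q : X → Y := fun x => q₂ (Function.surjInv h.surjective x) with hQd
  have hQ : ∀ x, Q (q x) = q₂ x := by
    intro x
    rw [hQd]
    simp only
    rw [h₂.fibre]
    exact FoldRel.mono hst ((h.fibre _ _).1 (Function.surjInv_eq h.surjective _))
  refine ⟨Q, ?_, ?_, h.isPiecewise_of_factor hS hQ h₂.isometric, ?_⟩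
  · intro g x
    obtain ⟨c, rfl⟩ := h.surjective x
    rw [← h.equivariant, hQ, hQ, h₂.equivariant]
  · intro y
    obtain ⟨c, rfl⟩ := h₂.surjective y
    exact ⟨q c, hQ c⟩
  · intro x y
    obtain ⟨c, rfl⟩ := h.surjective x
    obtain ⟨d, rfl⟩ := h.surjective y
    have hK : IsCompact (seg c d) := C.realTree.isCompact_seg c d
    -- On the compact segment q is a closed map, so the continuity of q₂ = Q ∘ q descends to Q.
    have hsub : seg (q c) (q d) ⊆ q '' seg c d := X.realTree.seg_subset_of_isPreconnected
      ((C.realTree.isPreconnected_seg c d).image _ (h.continuous hS).continuousOn)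
      (mem_image_of_mem _ (left_mem_seg _ _)) (mem_image_of_mem _ (right_mem_seg _ _))
    refine ContinuousOn.mono ?_ hsub
    rw [continuousOn_iff_isClosed]
    intro F hF
    refine ⟨q '' (seg c d ∩ q₂ ⁻¹' F),
      ((hK.inter_right (hF.preimage (h₂.continuous hS))).image (h.continuous hS)).isClosed, ?_⟩
    ext z
    constructor
    · rintro ⟨hz, e, he, rfl⟩
      exact ⟨⟨e, ⟨he, by rw [mem_preimage, ← hQ]; exact hz⟩, rfl⟩, e, he, rfl⟩
    · rintro ⟨⟨e, ⟨he, he'⟩, rfl⟩, -⟩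
      exact ⟨by rw [mem_preimage, hQ]; exact he', e, he, rfl⟩

theorem IsSimplicial.isPiecewise (hS : IsSimplicial f W U) : IsPiecewise f := by
  refine IsPiecewise.of_countable (S := (fun p : C × C => seg p.1 p.2) '' edgePairs W)
    (hS.source.edgePairs_countable.image _) ?_ ?_ ?_
  · rintro _ ⟨p, -, rfl⟩
    exact C.realTree.isCompact_seg _ _
  · intro c
    obtain ⟨p, hp, hc⟩ := hS.source.exists_edgePair c
    exact ⟨_, ⟨p, hp, rfl⟩, hc⟩
  · rintro _ ⟨p, hp, rfl⟩ x hx y hy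
    rw [dist_eq_of_edgePair hS.isometric hp hx hy]

theorem IsFold.preimage_eq (h : IsFold f W s q f') (z : B) : f' ⁻¹' {z} = q '' (f ⁻¹' {z}) := by
  ext x
  obtain ⟨c, rfl⟩ := h.surjective x
  constructor
  · intro hc
    refine ⟨c, ?_, rfl⟩
    rw [mem_preimage, ← h.factor]
    exact hc
  · rintro ⟨d, hd, hdc⟩
    rw [mem_preimage, ← hdc, h.factor]
    exact hd

theorem IsFold.mult_le (h : IsFold f W s q f') (z : B) : mult f' z ≤ mult f z := by
  unfold mult
  rw [h.preimage_eq]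
  exact_mod_cast encard_image_le q _

theorem IsSimplicial.sphere_countable (hS : IsSimplicial f W U) (r : ℝ) :
    {x : C | ∃ v ∈ W, dist v x = r}.Countable := by
  have h : (⋃ v ∈ W, ⋃ p ∈ edgePairs W, {z ∈ seg p.1 p.2 | dist v z = r}).Countable :=
    hS.source.countable.biUnion fun v _ => hS.source.edgePairs_countable.biUnion fun p _ =>
      (C.realTree.sphere_inter_seg_finite v p.1 p.2 r).countable
  refine h.mono ?_
  rintro x ⟨v, hv, hx⟩
  obtain ⟨p, hp, hxp⟩ := hS.source.exists_edgePair x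
  simp only [mem_iUnion]
  exact ⟨v, hv, p, hp, hxp, hx⟩

/-- By local finiteness only finitely many vertices lie within r₀ + 1 of points of F, and none of
these distances equals r₀. -/
theorem IsSimplicial.eventually_le_iff (hS : IsSimplicial f W U) {F : Set C} (hF : F.Finite)
    {r₀ : ℝ} (hr : ∀ x ∈ F, ∀ v ∈ W, dist v x ≠ r₀) :
    ∀ᶠ r in 𝓝 r₀, ∀ x ∈ F, ∀ v ∈ W, dist v x ≤ r ↔ dist v x ≤ r₀ := by
  have h1 : ∀ x ∈ F, ∀ v ∈ {v ∈ W | dist v x ≤ r₀ + 1}, ∀ᶠ r in 𝓝 r₀,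
      dist v x ≤ r ↔ dist v x ≤ r₀ := by
    rintro x hx v ⟨hv, -⟩
    rcases lt_or_gt_of_ne (hr x hx v hv) with h | h
    · filter_upwards [lt_mem_nhds h] with r hr
      exact ⟨fun _ => h.le, fun _ => hr.le⟩
    · filter_upwards [gt_mem_nhds h] with r hr
      exact ⟨fun h' => absurd h' (not_le.2 hr), fun h' => absurd h' (not_le.2 h)⟩
  have h2 : ∀ x ∈ F, ∀ᶠ r in 𝓝 r₀, ∀ v ∈ {v ∈ W | dist v x ≤ r₀ + 1},
      dist v x ≤ r ↔ dist v x ≤ r₀ := fun x hx =>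
    (Filter.eventually_all_finite
      (hS.source.finite_inter_closedBall C.realTree C.free x (r₀ + 1))).2 (h1 x hx)
  filter_upwards [(Filter.eventually_all_finite hF).2 h2, gt_mem_nhds (lt_add_one r₀)]
    with r h3 h4 x hx v hv
  by_cases h5 : dist v x ≤ r₀ + 1
  · exact h3 x hx v ⟨hv, h5⟩
  · rw [not_le] at h5
    exact ⟨fun h => absurd h (by linarith), fun h => absurd h (by linarith)⟩

/-- The volume is the integral of φ times the multiplicity of F t, dominated by that of f. For
almost every y with φ y ≠ 0, the fibre of f is finite and has no point at distance exactly t₀ - a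
from a vertex, so its identifications are constant near t₀. Dominated convergence applies. -/
theorem continuousOn_vol_of_isFold (hS : IsSimplicial f W U)
    (hf : ∀ (g : FreeGroup (Fin n)) x, f (g • x) = g • f x) {graph : ℝ → MarkedTree n}
    {F : ∀ t, graph t → B} {a b : ℝ}
    (h : ∀ t ∈ Icc a b, ∃ q : C → graph t, IsFold f W (t - a) q (F t)) :
    ContinuousOn (fun t => (graph t).vol) (Icc a b) := by
  obtain ⟨φ, hφ⟩ := B.exists_isUnfolding
  obtain ⟨D, hD⟩ := hS.isPiecewise.exists_partition
  have hvC := hD.vol_eq hf hφ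
  have hm0 : Measurable fun y => φ y * mult f y := hφ.measurable.mul hD.measurable_mult
  have hpw : ∀ t ∈ Icc a b, Measurable (fun y => φ y * mult (F t) y) ∧
      ENNReal.ofReal (graph t).vol = ∫⁻ y, φ y * mult (F t) y ∂B.lengthMeasure := by
    intro t ht
    obtain ⟨q, hq⟩ := h t ht
    obtain ⟨D, hD⟩ := (hq.isPiecewise_of_factor hS hq.factor hS.isometric).exists_partition
    exact ⟨hφ.measurable.mul hD.measurable_mult, hD.vol_eq (hq.equivariant_factor hf) hφ⟩
  intro t₀ ht₀
  have hlim : Filter.Tendsto (fun t => ∫⁻ y, φ y * mult (F t) y ∂B.lengthMeasure)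
      (𝓝[Icc a b] t₀) (𝓝 (∫⁻ y, φ y * mult (F t₀) y ∂B.lengthMeasure)) := by
    refine tendsto_lintegral_filter_of_dominated_convergence (fun y => φ y * mult f y) ?_ ?_ ?_ ?_
    · filter_upwards [self_mem_nhdsWithin] with t ht
      exact (hpw t ht).1
    · filter_upwards [self_mem_nhdsWithin] with t ht
      obtain ⟨q, hq⟩ := h t ht
      exact Filter.Eventually.of_forall fun y => mul_le_mul_right (hq.mult_le y) _
    · rw [← hvC]
      exact ENNReal.ofReal_ne_top
    · have hbad := ((hS.sphere_countable (t₀ - a)).image f).measure_zero B.lengthMeasure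
      have hfin := ae_lt_top hm0 (by rw [← hvC]; exact ENNReal.ofReal_ne_top)
      filter_upwards [measure_eq_zero_iff_ae_notMem.1 hbad, hfin] with y hy hyf
      by_cases hφy : φ y = 0
      · simp only [hφy, zero_mul]
        exact tendsto_const_nhds
      have hFy : (f ⁻¹' {y}).Finite := by
        rw [← encard_ne_top_iff]
        intro htop
        have : mult f y = ⊤ := by
          unfold mult
          rw [htop]
          rfl
        rw [this, ENNReal.mul_top hφy] at hyf
        exact lt_irrefl _ hyf
      have hev := hS.eventually_le_iff hFy (r₀ := t₀ - a) (by
        intro x hx v hv hd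
        exact hy ⟨x, ⟨v, hv, hd⟩, hx⟩)
      have hev' : ∀ᶠ t in 𝓝 t₀, ∀ x ∈ f ⁻¹' {y}, ∀ v ∈ W,
          dist v x ≤ t - a ↔ dist v x ≤ t₀ - a :=
        (Continuous.tendsto (by fun_prop : Continuous fun t : ℝ => t - a) t₀).eventually hev
      refine Filter.Tendsto.congr' ?_ tendsto_const_nhds
      filter_upwards [self_mem_nhdsWithin, nhdsWithin_le_nhds hev'] with t ht hti
      obtain ⟨q, hq⟩ := h t ht
      obtain ⟨q₀, hq₀⟩ := h t₀ ht₀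
      congr 1
      unfold mult
      rw [hq.preimage_eq, hq₀.preimage_eq]
      congr 1
      refine encard_image_eq_of_iff fun x hx x' _ => ?_
      rw [hq.fibre, hq₀.fibre]
      exact ⟨fun h => h.of_iff (fun x hx v hv => (hti x hx v hv).2) hx,
        fun h => h.of_iff (fun x hx v hv => (hti x hx v hv).1) hx⟩
  rw [← (hpw t₀ ht₀).2] at hlim
  have h2 := (ENNReal.tendsto_toReal ENNReal.ofReal_ne_top).comp hlim
  rw [ENNReal.toReal_ofReal (graph t₀).vol_pos.le] at h2
  refine Filter.Tendsto.congr' ?_ h2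
  filter_upwards [self_mem_nhdsWithin] with t ht
  rw [Function.comp_apply, ← (hpw t ht).2, ENNReal.toReal_ofReal (graph t).vol_pos.le]

end Fold

/-! ### Loops that together cross all edges equally often. -/

theorem exists_perm_forall_ne {α : Type} [Finite α] (h : ∀ a : α, ∃ b, b ≠ a) :
    ∃ σ : Equiv.Perm α, ∀ a, σ a ≠ a := by
  have := Fintype.ofFinite α
  rcases isEmpty_or_nonempty α with he | ⟨⟨a₀⟩⟩
  · exact ⟨1, fun a => (he.false a).elim⟩
  obtain ⟨b₀, hb₀⟩ := h a₀
  obtain ⟨k, hk⟩ := Nat.exists_eq_add_of_le' (Fintype.one_lt_card_iff.2 ⟨b₀, a₀, hb₀⟩)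
  let e : α ≃ Fin (k + 2) := Fintype.equivFinOfCardEq (by simpa using hk)
  refine ⟨e.trans ((finRotate (k + 2)).trans e.symm), fun a ha => ?_⟩
  rw [Equiv.trans_apply, Equiv.trans_apply, Equiv.symm_apply_eq, finRotate_apply] at ha
  simp at ha

theorem exists_fiberwise_perm {α β : Type} [Finite α] (π : α → β)
    (h : ∀ a, ∃ b, b ≠ a ∧ π b = π a) :
    ∃ σ : Equiv.Perm α, ∀ a, π (σ a) = π a ∧ σ a ≠ a := by
  have hfib : ∀ b, ∃ σ : Equiv.Perm {a // π a = b}, ∀ a, σ a ≠ a := fun b =>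
    exists_perm_forall_ne fun a =>
      let ⟨a', hne, ha'⟩ := h a
      ⟨⟨a', ha'.trans a.2⟩, fun e => hne (congrArg Subtype.val e)⟩
  choose σ hσ using hfib
  refine ⟨(Equiv.sigmaFiberEquiv π).symm.trans
    ((Equiv.sigmaCongrRight σ).trans (Equiv.sigmaFiberEquiv π)), fun a => ⟨?_, fun ha => ?_⟩⟩
  · exact (σ (π a) ⟨a, rfl⟩).2
  · exact hσ (π a) ⟨a, rfl⟩ (Subtype.ext ha)

namespace MarkedTree

variable (A : MarkedTree n)

section Ribbon

/-- The edge with the opposite orientation. -/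
def OEdge.rev {A : MarkedTree n} (e : A.OEdge) : A.OEdge := ⟨(e.1.2, e.1.1), IsEdge.symm e.2⟩

/-- Reversal of orientation on the quotient graph. -/
def revGraphEdge : Equiv.Perm A.GraphEdge :=
  Function.Involutive.toPerm
    (Quotient.map' (s₁ := A.edgeSetoid) (s₂ := A.edgeSetoid) OEdge.rev
      (fun _ _ ⟨g, h1, h2⟩ => ⟨g, h2, h1⟩))
    (fun e => Quotient.inductionOn e fun _ => rfl)

theorem exists_other_edge {v u : A} (he : A.Edge v u) : ∃ w, A.Edge v w ∧ w ≠ u := by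
  obtain ⟨a, b, -, ha, hb, -, hab, -⟩ := he.1
  obtain ⟨w₁, he₁, z₁, hz₁, hzv₁, hza₁⟩ := A.simplicial.exists_edge_toward A.realTree he.1 ha
  obtain ⟨w₂, he₂, z₂, hz₂, hzv₂, hza₂⟩ := A.simplicial.exists_edge_toward A.realTree he.1 hb
  by_cases h₁ : w₁ = u
  · refine ⟨w₂, he₂, fun h₂ => ?_⟩
    subst h₁
    rw [h₂] at hz₂
    have h3 := mem_seg_trans_right hab (mem_seg_swap hza₁)
    have h4 := mem_seg_trans_right (mem_seg_swap h3) (mem_seg_swap hza₂)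
    rw [mem_seg, A.realTree.dist_of_mem_seg hz₂ hz₁, dist_comm z₂ v] at h4
    have h5 := dist_pos.2 hzv₁.symm
    have h6 := dist_pos.2 hzv₂.symm
    rcases abs_cases (dist v z₂ - dist v z₁) with h | h <;> linarith
  · exact ⟨w₁, he₁, h₁⟩

/-- A permutation of the oriented edges of the graph that continues every edge by another one
without backtracking. -/
theorem exists_next : ∃ next : Equiv.Perm A.GraphEdge, ∀ e : A.OEdge, ∃ e' : A.OEdge,
    (Quotient.mk A.edgeSetoid e' : A.GraphEdge) = next (Quotient.mk A.edgeSetoid e) ∧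
      e'.1.1 = e.1.2 ∧ e'.1.2 ≠ e.1.1 := by
  let init : A.GraphEdge → MulAction.orbitRel.Quotient (FreeGroup (Fin n)) A :=
    Quotient.lift (fun e : A.OEdge => Quotient.mk _ e.1.1)
      (fun e e' ⟨g, h1, _⟩ => Quotient.sound ⟨g⁻¹, by
        change g⁻¹ • e'.1.1 = e.1.1
        rw [← h1, inv_smul_smul]⟩)
  -- A permutation without fixed points of the oriented edges issuing from each vertex. Reversing an
  -- edge and then applying ρ continues it without backtracking, and is bijective.
  obtain ⟨ρ, hρ⟩ := exists_fiberwise_perm init (fun e => Quotient.inductionOn e (by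
    rintro ⟨⟨v, u⟩, he⟩
    obtain ⟨w, hw, hwu⟩ := A.exists_other_edge he
    refine ⟨Quotient.mk A.edgeSetoid ⟨(v, w), hw⟩, fun h => ?_, rfl⟩
    obtain ⟨g, h1, h2⟩ := Quotient.exact h
    have hg : g = 1 := A.free g v h1
    rw [hg, one_smul] at h2
    exact hwu h2))
  refine ⟨A.revGraphEdge.trans ρ, fun e => ?_⟩
  set r : A.GraphEdge := A.revGraphEdge (Quotient.mk A.edgeSetoid e) with hr
  have hr' : r = Quotient.mk A.edgeSetoid e.rev := rfl
  have h1 : init (ρ r) = init r := (hρ r).1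
  change ∃ e' : A.OEdge, (Quotient.mk A.edgeSetoid e' : A.GraphEdge) = ρ r ∧
    e'.1.1 = e.1.2 ∧ e'.1.2 ≠ e.1.1
  have h2 : init (Quotient.mk A.edgeSetoid (ρ r).out) = init (Quotient.mk A.edgeSetoid e.rev) := by
    rw [← hr', ← h1]
    exact congrArg init (Quotient.out_eq (ρ r))
  obtain ⟨g, hg⟩ : ∃ g : FreeGroup (Fin n), g • e.1.2 = (ρ r).out.1.1 := Quotient.exact h2
  have hedge := A.smul_edge g⁻¹ (ρ r).out.2
  have hcls : (Quotient.mk A.edgeSetoid ⟨(g⁻¹ • (ρ r).out.1.1, g⁻¹ • (ρ r).out.1.2), hedge⟩ :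
      A.GraphEdge) = ρ r := by
    conv_rhs => rw [← Quotient.out_eq (ρ r)]
    exact Quotient.sound ⟨g, smul_inv_smul _ _, smul_inv_smul _ _⟩
  have hv : g⁻¹ • (ρ r).out.1.1 = e.1.2 := by rw [← hg, inv_smul_smul]
  refine ⟨⟨(g⁻¹ • (ρ r).out.1.1, g⁻¹ • (ρ r).out.1.2), hedge⟩, hcls, hv, fun h => ?_⟩
  refine (hρ r).2 ?_
  refine hcls.symm.trans (Eq.trans ?_ hr'.symm)
  exact congrArg (Quotient.mk A.edgeSetoid) (Subtype.ext (Prod.ext hv h))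

/-- Loops whose total length is a fixed multiple of the volume. -/
theorem exists_loops : ∃ (N : ℕ) (w : A.GraphEdge → FreeGroup (Fin n)), 0 < N ∧ (∀ e, w e ≠ 1) ∧
    ∀ (Z : MarkedTree n) (c : A → Z), IsCollapse c → ∑ᶠ e, Z.len (w e) = 2 * N * Z.vol := by
  obtain ⟨next, hnext⟩ := A.exists_next
  choose step hstep1 hstep2 hstep3 using hnext
  -- The order of `next` is a common period for the paths from all edges.
  have hN : 0 < orderOf next := orderOf_pos next
  have hcls : ∀ (e : A.GraphEdge) (i : ℕ),
      (Quotient.mk A.edgeSetoid (step^[i] e.out) : A.GraphEdge) = (next ^ i) e := by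
    intro e i
    induction i with
    | zero => exact Quotient.out_eq e
    | succ i ih => rw [Function.iterate_succ_apply', hstep1, ih, pow_succ', Equiv.Perm.mul_apply]
  have hv : ∀ (e : A.GraphEdge) (i : ℕ), (step^[i + 1] e.out).1.1 = (step^[i] e.out).1.2 := by
    intro e i
    rw [Function.iterate_succ_apply', hstep2]
  have hper : ∀ e : A.GraphEdge, ∃ g : FreeGroup (Fin n),
      g • (step^[0] e.out).1.1 = (step^[orderOf next] e.out).1.1 ∧
      g • (step^[0] e.out).1.2 = (step^[orderOf next] e.out).1.2 := by
    intro e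
    have h1 := hcls e 0
    have h2 := hcls e (orderOf next)
    rw [pow_orderOf_eq_one, ← pow_zero next, ← h1] at h2
    exact Quotient.exact h2.symm
  choose w hw1 hw2 using hper
  have hchain : ∀ (e : A.GraphEdge) (i : ℕ), (step^[i + 1] e.out).1.1 ∈
      seg (step^[i] e.out).1.1 (step^[i + 2] e.out).1.1 := by
    intro e i
    rw [hv e (i + 1), hv e i]
    refine A.realTree.mem_seg_of_edges subset_rfl (IsEdge.symm (step^[i] e.out).2) ?_ ?_
    · have := (step^[i + 1] e.out).2
      rw [hv e i] at this
      exact this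
    · have := hstep3 (step^[i] e.out)
      rw [← Function.iterate_succ_apply' step] at this
      exact this.symm
  have hne : ∀ (e : A.GraphEdge) (i : ℕ), (step^[i] e.out).1.1 ≠ (step^[i + 1] e.out).1.1 := by
    intro e i
    rw [hv e i]
    exact (step^[i] e.out).2.2.2.1
  have hp := fun e => A.len_of_periodic (hchain e) (hne e) hN (hw1 e)
    (by rw [hv e, hv e]; exact hw2 e)
  refine ⟨orderOf next, w, hN, fun e => (hp e).1, fun Z c hc => ?_⟩
  have hlen : ∀ e, Z.len (w e) =
      ∑ i ∈ Finset.range (orderOf next), imageLen c hc.toIsBetween ((next ^ i) e) := by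
    intro e
    rw [hc.len_eq (hp e).1 (hp e).2.1, ← hc.equivariant, hw1 e]
    have : ∀ k, dist (c (step^[0] e.out).1.1) (c (step^[k] e.out).1.1) =
        ∑ i ∈ Finset.range k, imageLen c hc.toIsBetween ((next ^ i) e) := by
      intro k
      induction k with
      | zero => simp
      | succ k ih =>
        have h := hc.between _ _ _ (A.realTree.chain (hchain e) (hne e) k).1
        rw [mem_seg] at h
        rw [Finset.sum_range_succ, ← ih, ← h, ← hcls e k, hv e k]
        rfl
    exact this _
  have := Fintype.ofFinite A.GraphEdge
  -- For each i the i-th edges of all the paths run through every oriented edge once, because `next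
  -- ^ i` is a permutation.
  rw [hc.vol_eq, finsum_eq_sum_of_fintype, finsum_eq_sum_of_fintype,
    Finset.sum_congr rfl (fun e _ => hlen e), Finset.sum_comm,
    Finset.sum_congr rfl (fun i _ => Equiv.sum_comp (next ^ i) (imageLen c hc.toIsBetween)),
    Finset.sum_const, Finset.card_range, nsmul_eq_mul]
  ring

end Ribbon

end MarkedTree

/-! ### Optimal maps have legal loops. -/

section Optimal

variable {A B : MarkedTree n} {f : A → B}

theorem IsPL.dist_eq (hf : IsPL f) {v w x y : A} (he : A.Edge v w) (hx : x ∈ seg v w)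
    (hy : y ∈ seg v w) : dist (f x) (f y) = stretch f v w * dist x y := by
  obtain ⟨S, hS⟩ := hf.linear v w he
  have h := hS v (left_mem_seg _ _) w (right_mem_seg _ _)
  rw [hS x hx y hy, stretch, h, mul_div_cancel_right₀]
  exact (dist_pos.2 he.2.2.1).ne'

theorem stretch_comm (f : A → B) (v w : A) : stretch f v w = stretch f w v := by
  rw [stretch, stretch, dist_comm, dist_comm v w]

theorem IsMaxEdge.symm {v w : A} (h : IsMaxEdge f v w) : IsMaxEdge f w v :=
  ⟨IsEdge.symm h.1, fun v' w' he => by rw [stretch_comm f w v]; exact h.2 v' w' he⟩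

theorem IsPL.exists_isMaxEdge (hf : IsPL f) : ∃ v w, IsMaxEdge f v w := by
  obtain ⟨e, he⟩ := Finite.exists_max fun e : A.GraphEdge => stretch f e.out.1.1 e.out.1.2
  refine ⟨_, _, e.out.2, fun v w hvw => ?_⟩
  obtain ⟨g, h1, h2⟩ : ∃ g : FreeGroup (Fin n),
      g • v = (Quotient.mk A.edgeSetoid ⟨(v, w), hvw⟩ : A.GraphEdge).out.1.1 ∧
      g • w = (Quotient.mk A.edgeSetoid ⟨(v, w), hvw⟩ : A.GraphEdge).out.1.2 :=
    Quotient.exact (Quotient.out_eq (Quotient.mk A.edgeSetoid ⟨(v, w), hvw⟩)).symm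
  have h := he (Quotient.mk A.edgeSetoid ⟨(v, w), hvw⟩)
  rw [← h1, ← h2] at h
  unfold stretch at h ⊢
  rwa [hf.equivariant, hf.equivariant, B.dist_smul, A.dist_smul] at h

/-- Otherwise f is constant, and its value is fixed by the whole group. -/
theorem IsPL.stretch_pos (hf : IsPL f) {v w : A} (h : IsMaxEdge f v w) : 0 < stretch f v w := by
  by_contra! hle
  have hconst := A.simplicial.dist_le_of_edges A.realTree le_rfl f (fun v' w' he x hx y hy => by
    rw [hf.dist_eq he hx hy]
    exact mul_le_mul_of_nonneg_right ((h.2 v' w' he).trans hle) dist_nonneg)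
  obtain ⟨g, hg⟩ := A.exists_ne_one
  have := hconst (g • v) v
  rw [zero_mul, hf.equivariant] at this
  exact hg (B.free _ _ (dist_le_zero.1 this))

/-- If every maximal edge at v shared an initial image segment with the one to u, the shortest of
these finitely many segments would be common to all, against `gates`. -/
theorem IsOptimal.exists_turn (hf : IsOptimal f) {u v : A} (h : IsMaxEdge f u v) :
    ∃ w, IsMaxEdge f v w ∧ f v ∈ seg (f u) (f w) := by
  by_contra! hno
  choose p hp1 hp2 hp3 using fun w => B.realTree.exists_median (f v) (f u) (f w)
  have hfin : {w | IsMaxEdge f v w}.Finite :=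
    (A.simplicial.neighbors_finite A.free v).subset fun w hw => hw.1
  obtain ⟨w₀, hw₀, hmin⟩ := exists_min_image _ (fun w => dist (f v) (p w)) hfin ⟨u, h.symm⟩
  refine hf.gates ⟨v, ⟨u, h.symm⟩, p w₀, fun e => hno w₀ hw₀ (e ▸ hp3 w₀), fun w hw => ?_⟩
  refine mem_seg_trans (hp2 w) (mem_seg_of_le ?_)
  rw [B.realTree.dist_of_mem_seg (hp1 w₀) (hp1 w), abs_of_nonpos (by linarith [hmin w hw])]
  linarith

/-- Continue a maximal edge by legal turns until an edge of the finite quotient recurs. The image of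
this path is geodesic and periodic, so it computes the length of g in B. -/
theorem IsOptimal.exists_legal_loop (hf : IsOptimal f) {v₀ w₀ : A} (h₀ : IsMaxEdge f v₀ w₀) :
    ∃ g : FreeGroup (Fin n), g ≠ 1 ∧ stretch f v₀ w₀ * A.len g ≤ B.len g := by
  choose next hnext1 hnext2 using fun p : {p : A × A // IsMaxEdge f p.1 p.2} => hf.exists_turn p.2
  let step : {p : A × A // IsMaxEdge f p.1 p.2} → {p : A × A // IsMaxEdge f p.1 p.2} :=
    fun p => ⟨(p.1.2, next p), hnext1 p⟩
  let P : ℕ → {p : A × A // IsMaxEdge f p.1 p.2} := fun i => step^[i] ⟨(v₀, w₀), h₀⟩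
  have hP : ∀ i, P (i + 1) = step (P i) := fun i => Function.iterate_succ_apply' _ _ _
  have hP1 : ∀ i, (P (i + 1)).1.1 = (P i).1.2 := fun i => by rw [hP]
  have hstretch : ∀ i, dist (f (P i).1.1) (f (P (i + 1)).1.1) =
      stretch f v₀ w₀ * dist (P i).1.1 (P (i + 1)).1.1 := by
    intro i
    rw [hP1, hf.isPL.dist_eq (P i).2.1 (left_mem_seg _ _) (right_mem_seg _ _)]
    congr 1
    exact le_antisymm (h₀.2 _ _ (P i).2.1) ((P i).2.2 _ _ h₀.1)
  have hpos := hf.isPL.stretch_pos h₀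
  have hne : ∀ i, f (P i).1.1 ≠ f (P (i + 1)).1.1 := by
    intro i
    rw [← dist_pos, hstretch, hP1]
    exact mul_pos hpos (dist_pos.2 (P i).2.1.2.2.1)
  have hturn : ∀ i, f (P (i + 1)).1.1 ∈ seg (f (P i).1.1) (f (P (i + 2)).1.1) := by
    intro i
    rw [hP1 (i + 1), hP1 i, hP i]
    exact hnext2 (P i)
  obtain ⟨i, j, hij, hcls⟩ := Finite.exists_ne_map_eq_of_infinite (β := A.GraphEdge)
    fun i => Quotient.mk A.edgeSetoid ⟨(P i).1, (P i).2.1⟩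
  wlog hlt : i < j generalizing i j
  · exact this j i hij.symm hcls.symm (lt_of_le_of_ne (not_lt.1 hlt) hij.symm)
  obtain ⟨g, hg1, hg2⟩ : ∃ g : FreeGroup (Fin n),
    g • (P i).1.1 = (P j).1.1 ∧ g • (P i).1.2 = (P j).1.2 := Quotient.exact hcls
  obtain ⟨k, rfl⟩ := Nat.exists_eq_add_of_lt hlt
  have h := B.len_of_periodic (v := fun m => f (P (i + m)).1.1) (fun m => hturn (i + m))
    (fun m => hne (i + m)) (N := k + 1) (Nat.succ_pos k) (g := g)
    (by rw [← hf.isPL.equivariant]; exact congrArg f hg1)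
    (by
      rw [← hf.isPL.equivariant]
      refine congrArg f ?_
      rw [hP1 i, hg2]
      exact (hP1 (i + k + 1)).symm)
  refine ⟨g, h.1, ?_⟩
  have hsum : B.len g = ∑ m ∈ Finset.range (k + 1),
      stretch f v₀ w₀ * dist (P (i + m)).1.1 (P (i + m + 1)).1.1 :=
    h.2.2.trans (Finset.sum_congr rfl fun m _ => hstretch (i + m))
  rw [hsum, ← Finset.mul_sum]
  refine mul_le_mul_of_nonneg_left ?_ hpos.le
  refine (A.len_le g (P i).1.1).trans ?_
  rw [hg1]
  exact dist_le_range_sum_dist (fun m => (P (i + m)).1.1) (k + 1)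

end Optimal

/-! ### Interpolation between a tree and a collapse of it. -/

/-- Four points span a tree with two median vertices, along which D adds up. This makes weighted
sums of the two metrics tree metrics. -/
theorem IsRealTree.fourPoint_of_additive {X : Type} [MetricSpace X] (hX : IsRealTree X)
    {D : X → X → ℝ} (hsymm : ∀ x y, D x y = D y x) (htri : ∀ x y z, D x z ≤ D x y + D y z)
    (hadd : ∀ x y, ∀ z ∈ seg x y, D x z + D z y = D x y) (x y z w : X) :
    D x y + D z w ≤ max (D x z + D y w) (D x w + D y z) := by
  obtain ⟨p, hp1, hp2, hp3⟩ := hX.exists_median x y z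
  obtain ⟨q, hq1, hq2, hq3⟩ := hX.exists_median x y w
  have e1 := hadd _ _ _ hp1
  have e2 := hadd _ _ _ hp2
  have e3 := hadd _ _ _ hp3
  have f1 := hadd _ _ _ hq1
  have f2 := hadd _ _ _ hq2
  have f3 := hadd _ _ _ hq3
  have t1 := htri z p w
  have t2 := htri p q w
  rw [hsymm z p] at t1
  rw [hsymm y p] at e3
  rw [hsymm y q] at f3
  rcases hX.mem_seg_or_mem_seg hq1 p with h | h
  · refine le_max_of_le_left ?_
    have g1 := hadd _ _ _ (mem_seg_trans_right hp1 h)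
    rw [hsymm q p] at g1
    linarith
  · refine le_max_of_le_right ?_
    have g1 := hadd _ _ _ (mem_seg_swap (mem_seg_trans_right (mem_seg_swap hp1) (mem_seg_swap h)))
    linarith

namespace MarkedTree

variable {A Z : MarkedTree n}

/-- A tree with the metric that weights its own metric by `a` and the one pulled back along a
collapse `c` by `b`. -/
@[ext]
structure Reweighted (c : A → Z) (hc : IsCollapse c) (a b : ℝ) (ha : 0 < a) (hb : 0 ≤ b) where
  point : A

variable {c : A → Z} {hc : IsCollapse c} {a b : ℝ} {ha : 0 < a} {hb : 0 ≤ b}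

namespace Reweighted

noncomputable instance : MetricSpace (Reweighted c hc a b ha hb) where
  dist x y := a * dist x.point y.point + b * dist (c x.point) (c y.point)
  dist_self x := by simp
  dist_comm x y := by rw [dist_comm x.point, dist_comm (c x.point)]
  dist_triangle x y z := by
    have h1 := mul_le_mul_of_nonneg_left (dist_triangle x.point y.point z.point) ha.le
    have h2 := mul_le_mul_of_nonneg_left (dist_triangle (c x.point) (c y.point) (c z.point)) hb
    linarith
  eq_of_dist_eq_zero := by
    intro x y h
    have h1 : 0 ≤ a * dist x.point y.point := mul_nonneg ha.le dist_nonneg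
    have h2 : 0 ≤ b * dist (c x.point) (c y.point) := mul_nonneg hb dist_nonneg
    have h3 : a * dist x.point y.point = 0 := by linarith
    exact Reweighted.ext (dist_eq_zero.1 ((mul_eq_zero.1 h3).resolve_left ha.ne'))

instance : MulAction (FreeGroup (Fin n)) (Reweighted c hc a b ha hb) where
  smul g x := ⟨g • x.point⟩
  one_smul x := Reweighted.ext (one_smul _ x.point)
  mul_smul g h x := Reweighted.ext (mul_smul g h x.point)

theorem dist_def (x y : Reweighted c hc a b ha hb) :
    dist x y = a * dist x.point y.point + b * dist (c x.point) (c y.point) := rfl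

theorem smul_point (g : FreeGroup (Fin n)) (x : Reweighted c hc a b ha hb) :
    (g • x).point = g • x.point := rfl

theorem mul_dist_le (x y : Reweighted c hc a b ha hb) : a * dist x.point y.point ≤ dist x y := by
  rw [dist_def]
  have : 0 ≤ b * dist (c x.point) (c y.point) := mul_nonneg hb dist_nonneg
  linarith

theorem dist_add_dist {x y z : Reweighted c hc a b ha hb} (h : z.point ∈ seg x.point y.point) :
    dist x z + dist z y = dist x y := by
  have h1 := hc.between _ _ _ h
  rw [mem_seg] at h h1
  rw [dist_def, dist_def, dist_def, ← h, ← h1]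
  ring

theorem mem_seg_iff {x y z : Reweighted c hc a b ha hb} :
    z ∈ seg x y ↔ z.point ∈ seg x.point y.point := by
  refine ⟨fun h => mem_seg_of_le ?_, dist_add_dist⟩
  rw [mem_seg, dist_def, dist_def, dist_def] at h
  have h2 := mul_le_mul_of_nonneg_left (dist_triangle (c x.point) (c z.point) (c y.point)) hb
  have h3 : a * (dist x.point z.point + dist z.point y.point) ≤ a * dist x.point y.point := by
    linarith
  exact le_of_mul_le_mul_left h3 ha

theorem mem_branchPoints {x : Reweighted c hc a b ha hb} :
    x ∈ branchPoints (Reweighted c hc a b ha hb) ↔ x.point ∈ branchPoints A := by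
  constructor
  · rintro ⟨u, v, w, hu, hv, hw, h1, h2, h3⟩
    exact ⟨u.point, v.point, w.point, fun e => hu (Reweighted.ext e),
      fun e => hv (Reweighted.ext e),
      fun e => hw (Reweighted.ext e), mem_seg_iff.1 h1, mem_seg_iff.1 h2, mem_seg_iff.1 h3⟩
  · rintro ⟨u, v, w, hu, hv, hw, h1, h2, h3⟩
    exact ⟨⟨u⟩, ⟨v⟩, ⟨w⟩, fun e => hu (congrArg point e), fun e => hv (congrArg point e),
      fun e => hw (congrArg point e), mem_seg_iff.2 h1, mem_seg_iff.2 h2, mem_seg_iff.2 h3⟩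

theorem isEdge_iff {v w : Reweighted c hc a b ha hb} :
    IsEdge (branchPoints (Reweighted c hc a b ha hb)) v w ↔ A.Edge v.point w.point := by
  constructor
  · rintro ⟨h1, h2, h3, h4⟩
    refine ⟨mem_branchPoints.1 h1, mem_branchPoints.1 h2, fun e => h3 (Reweighted.ext e), ?_⟩
    intro z hz hzV
    exact (h4 ⟨z⟩ (mem_seg_iff.2 hz) (mem_branchPoints.2 hzV)).imp (congrArg point) (congrArg point)
  · rintro ⟨h1, h2, h3, h4⟩
    refine ⟨mem_branchPoints.2 h1, mem_branchPoints.2 h2, fun e => h3 (congrArg point e), ?_⟩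
    intro z hz hzV
    exact (h4 z.point (mem_seg_iff.1 hz) (mem_branchPoints.1 hzV)).imp Reweighted.ext Reweighted.ext

theorem continuous_mk : Continuous (Reweighted.mk : A → Reweighted c hc a b ha hb) := by
  rw [continuous_iff_continuousAt]
  intro x
  rw [ContinuousAt, tendsto_iff_dist_tendsto_zero]
  have h : Continuous fun y => a * dist y x + b * dist (c y) (c x) := by
    have := hc.continuous
    fun_prop
  have := h.tendsto x
  rw [dist_self, dist_self, mul_zero, mul_zero, add_zero] at this
  exact this

theorem isRealTree : IsRealTree (Reweighted c hc a b ha hb) where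
  nonempty := let ⟨x⟩ := A.realTree.nonempty; ⟨⟨x⟩⟩
  fourPoint x y z w := A.realTree.fourPoint_of_additive
    (D := fun x y => dist (⟨x⟩ : Reweighted c hc a b ha hb) ⟨y⟩) (fun _ _ => dist_comm _ _)
    (fun _ _ _ => dist_triangle _ _ _) (fun _ _ _ h => dist_add_dist h) x.point y.point z.point
      w.point
  geodesic x y := by
    obtain ⟨γ, h0, h1, hγ, hγx, -, hs⟩ := A.realTree.exists_param x.point y.point
    set D := dist x.point y.point with hD
    have hγc : ContinuousOn γ (Icc 0 D) := by
      refine LipschitzOnWith.continuousOn (K := 1) (LipschitzOnWith.of_dist_le_mul ?_)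
      intro s hs t ht
      rw [hγ s hs t ht, NNReal.coe_one, one_mul, Real.dist_eq]
    have hc1 : ContinuousOn (fun t => dist x ⟨γ t⟩) (Icc 0 D) :=
      (continuous_const.dist continuous_mk).comp_continuousOn hγc
    have hsurj := intermediate_value_Icc (show (0 : ℝ) ≤ D from dist_nonneg) hc1
    have e0 : dist x (⟨γ 0⟩ : Reweighted c hc a b ha hb) = 0 := by
      rw [h0]
      exact dist_self x
    have e1 : dist x (⟨γ D⟩ : Reweighted c hc a b ha hb) = dist x y := by rw [h1]
    rw [e0, e1] at hsurj
    have hsurj' : ∀ u ∈ Icc 0 (dist x y), ∃ s ∈ Icc 0 D,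
        dist x (⟨γ s⟩ : Reweighted c hc a b ha hb) = u := fun u hu => hsurj hu
    -- The old geodesic, reparametrised by the new distance from x.
    choose! τ hτ hτd using hsurj'
    have hmono : ∀ s ∈ Icc 0 D, ∀ t ∈ Icc 0 D, s ≤ t →
        dist x (⟨γ s⟩ : Reweighted c hc a b ha hb) +
            dist (⟨γ s⟩ : Reweighted c hc a b ha hb) ⟨γ t⟩ =
          dist x (⟨γ t⟩ : Reweighted c hc a b ha hb) := by
      intro s hs t ht hst
      refine dist_add_dist ?_
      rw [mem_seg, hγx s hs, hγx t ht, hγ s hs t ht, abs_of_nonpos (by linarith)]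
      ring
    have key : ∀ s ∈ Icc 0 (dist x y), ∀ t ∈ Icc 0 (dist x y),
        dist (⟨γ (τ s)⟩ : Reweighted c hc a b ha hb) ⟨γ (τ t)⟩ = |s - t| := by
      intro s hs t ht
      have h0 : 0 ≤ dist (⟨γ (τ s)⟩ : Reweighted c hc a b ha hb) ⟨γ (τ t)⟩ := dist_nonneg
      rcases le_total (τ s) (τ t) with h | h
      · have := hmono _ (hτ s hs) _ (hτ t ht) h
        rw [hτd s hs, hτd t ht] at this
        rw [abs_of_nonpos (by linarith)]
        linarith
      · have := hmono _ (hτ t ht) _ (hτ s hs) h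
        rw [hτd s hs, hτd t ht, dist_comm (⟨γ (τ t)⟩ : Reweighted c hc a b ha hb)] at this
        rw [abs_of_nonneg (by linarith)]
        linarith
    have hm0 : (0 : ℝ) ∈ Icc 0 (dist x y) := ⟨le_rfl, dist_nonneg⟩
    have hm1 : dist x y ∈ Icc 0 (dist x y) := ⟨dist_nonneg, le_rfl⟩
    refine ⟨fun s => ⟨γ (τ s)⟩, ?_, ?_, key⟩
    · exact (dist_eq_zero.1 (hτd _ hm0)).symm
    · have hm := hτ _ hm1
      have h2 := hmono _ hm D ⟨dist_nonneg, le_rfl⟩ hm.2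
      rw [hτd _ hm1, e1, h1] at h2
      exact dist_eq_zero.1 (by linarith)

end Reweighted

/-- The marked tree given by the weighted metric. -/
noncomputable abbrev reweight (c : A → Z) (hc : IsCollapse c) (a b : ℝ) (ha : 0 < a) (hb : 0 ≤ b) :
    MarkedTree n where
  pt := Reweighted c hc a b ha hb
  realTree := Reweighted.isRealTree
  dist_smul g x y := by
    rw [Reweighted.dist_def, Reweighted.dist_def, Reweighted.smul_point, Reweighted.smul_point,
      A.dist_smul, hc.equivariant, hc.equivariant, Z.dist_smul]
  free g x h := A.free g x.point (congrArg Reweighted.point h)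
  minimal S hne hG hconv := by
    have h := A.minimal (Reweighted.point '' S) (hne.image _) (by
      rintro g _ ⟨x, hx, rfl⟩
      exact ⟨g • x, hG g x hx, rfl⟩) (by
      rintro _ ⟨x, hx, rfl⟩ _ ⟨y, hy, rfl⟩ z hz
      exact ⟨⟨z⟩, hconv x hx y hy (Reweighted.mem_seg_iff.2 hz), rfl⟩)
    rw [eq_univ_iff_forall]
    intro x
    obtain ⟨y, hy, hyx⟩ := (h ▸ mem_univ x.point : x.point ∈ Reweighted.point '' S)
    exact (Reweighted.ext hyx : y = x) ▸ hy
  simplicial :=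
    { smul_mem := fun g v hv => Reweighted.mem_branchPoints.2
        (A.simplicial.smul_mem g _ (Reweighted.mem_branchPoints.1 hv))
      finite_vertices := by
        obtain ⟨S, hS, h⟩ := A.simplicial.finite_vertices
        refine ⟨Reweighted.mk '' S, hS.image _, fun v hv => ?_⟩
        obtain ⟨g, u, hu, hgu⟩ := h _ (Reweighted.mem_branchPoints.1 hv)
        exact ⟨g, ⟨u⟩, ⟨u, hu, rfl⟩, Reweighted.ext hgu⟩
      finite_edges := by
        obtain ⟨S, hS, h⟩ := A.simplicial.finite_edges
        refine ⟨(fun p => (⟨p.1⟩, ⟨p.2⟩)) '' S, hS.image _, fun v w he => ?_⟩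
        obtain ⟨g, p, hp, h1, h2⟩ := h _ _ (Reweighted.isEdge_iff.1 he)
        exact ⟨g, _, ⟨p, hp, rfl⟩, Reweighted.ext h1, Reweighted.ext h2⟩
      separated := by
        obtain ⟨δ, hδ, h⟩ := A.simplicial.separated
        refine ⟨a * δ, mul_pos ha hδ, fun v hv w hw hne => ?_⟩
        refine (mul_le_mul_of_nonneg_left (h _ (Reweighted.mem_branchPoints.1 hv) _
          (Reweighted.mem_branchPoints.1 hw) fun e => hne (Reweighted.ext e)) ha.le).trans ?_
        exact Reweighted.mul_dist_le v w
      edge_nhds := by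
        intro x hx
        obtain ⟨v, w, he, hxs, hn⟩ := A.simplicial.edge_nhds x.point
          (fun h => hx (Reweighted.mem_branchPoints.2 h))
        obtain ⟨r, hr, hball⟩ := Metric.mem_nhds_iff.1 hn
        refine ⟨⟨v⟩, ⟨w⟩, Reweighted.isEdge_iff.2 he, Reweighted.mem_seg_iff.2 hxs,
          Metric.mem_nhds_iff.2 ⟨a * r, mul_pos ha hr, fun y hy => ?_⟩⟩
        refine Reweighted.mem_seg_iff.2 (hball ?_)
        rw [Metric.mem_ball] at hy ⊢
        exact lt_of_mul_lt_mul_left ((Reweighted.mul_dist_le y x).trans_lt hy) ha.le }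

variable (c hc a b ha hb)

theorem isCollapse_mk : IsCollapse (Z := reweight c hc a b ha hb) (Reweighted.mk : A → _) where
  equivariant _ _ := rfl
  between _ _ _ h := Reweighted.mem_seg_iff.2 h
  surjective x := ⟨x.point, rfl⟩
  continuous := Reweighted.continuous_mk

theorem reweight_len {g : FreeGroup (Fin n)} (hg : g ≠ 1) :
    (reweight c hc a b ha hb).len g = a * A.len g + b * Z.len g := by
  obtain ⟨x, hne, hx⟩ := A.exists_axis hg
  rw [(isCollapse_mk c hc a b ha hb).len_eq hg hx, hc.len_eq hg hx, A.len_of_axis hne hx,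
    ← hc.equivariant]
  rfl

theorem reweight_vol : (reweight c hc a b ha hb).vol = a * A.vol + b * Z.vol := by
  have := Fintype.ofFinite A.GraphEdge
  rw [(isCollapse_mk c hc a b ha hb).vol_eq, hc.vol_eq, vol, finsum_eq_sum_of_fintype,
    finsum_eq_sum_of_fintype, finsum_eq_sum_of_fintype]
  have : ∀ e, imageLen _ (isCollapse_mk c hc a b ha hb).toIsBetween e =
      a * A.edgeLen e + b * imageLen c hc.toIsBetween e := fun e =>
    Quotient.inductionOn e fun _ => rfl
  rw [Finset.sum_congr rfl (fun e _ => this e), Finset.sum_add_distrib, ← Finset.mul_sum,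
    ← Finset.mul_sum]
  ring

theorem reweight_zero_equivalent : A.Equivalent (reweight c hc a 0 ha le_rfl) :=
  ⟨⟨Reweighted.mk, Reweighted.point, fun _ => rfl, fun _ => rfl⟩, a, ha,
    fun x y => by
      change a * dist x y + 0 * dist (c x) (c y) = a * dist x y
      ring,
    fun _ _ => rfl⟩

end MarkedTree

namespace MarkedTree

variable {A B : MarkedTree n}

theorem equivalent_of_isometry {φ : A → B} (hs : Function.Surjective φ)
    (hd : ∀ x y, dist (φ x) (φ y) = dist x y)
    (he : ∀ (g : FreeGroup (Fin n)) x, φ (g • x) = g • φ x) : A.Equivalent B :=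
  ⟨Equiv.ofBijective φ ⟨(Isometry.of_dist_eq hd).injective, hs⟩, 1, one_pos,
    fun x y => by rw [one_mul]; exact hd x y, he⟩

theorem Equivalent.len_mul_vol (h : A.Equivalent B) (g : FreeGroup (Fin n)) :
    B.len g * A.vol = A.len g * B.vol := by
  obtain ⟨φ, k, hk, hd, he⟩ := h
  rw [len_homothety φ k hk hd he, vol_homothety φ k hk hd he]
  ring

end MarkedTree

/-! ### Shrinking the source of an optimal map. -/

section Shrinking

variable {A B A₀ : MarkedTree n} {f : A → B} {c : A → A₀} {v₀ w₀ : A}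

theorem IsShrinking.dist_le (hc : IsShrinking f c) (hf : IsPL f) (h₀ : IsMaxEdge f v₀ w₀)
    (x y : A) :
    dist (c x) (c y) ≤ stretch f v₀ w₀ * dist x y := by
  refine A.simplicial.dist_le_of_edges A.realTree (hf.stretch_pos h₀).le c ?_ x y
  intro v w he x hx y hy
  rw [hc.edge v w he x hx y hy, hf.dist_eq he hx hy]
  exact mul_le_mul_of_nonneg_right (h₀.2 v w he) dist_nonneg

theorem IsShrinking.isCollapse (hc : IsShrinking f c) (hf : IsPL f) : IsCollapse c where
  equivariant := hc.equivariant
  between := hc.between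
  surjective := hc.surjective
  continuous :=
    let ⟨_, _, h₀⟩ := hf.exists_isMaxEdge
    (LipschitzWith.of_dist_le' (hc.dist_le hf h₀)).continuous

theorem IsShrinking.len_le (hc : IsShrinking f c) (hf : IsPL f) (h₀ : IsMaxEdge f v₀ w₀)
    (g : FreeGroup (Fin n)) : A₀.len g ≤ stretch f v₀ w₀ * A.len g :=
  len_le_of_lipschitz (hf.stretch_pos h₀).le hc.equivariant (hc.dist_le hf h₀) g

theorem IsShrinking.imageLen_le (hc : IsShrinking f c) (hf : IsPL f) (h₀ : IsMaxEdge f v₀ w₀)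
    (e : A.GraphEdge) :
    imageLen c (hc.isCollapse hf).toIsBetween e ≤ stretch f v₀ w₀ * A.edgeLen e := by
  rw [imageLen_out, A.edgeLen_out]
  exact hc.dist_le hf h₀ _ _

theorem IsShrinking.vol_le (hc : IsShrinking f c) (hf : IsPL f) (h₀ : IsMaxEdge f v₀ w₀) :
    A₀.vol ≤ stretch f v₀ w₀ * A.vol := by
  have := Fintype.ofFinite A.GraphEdge
  have h := Finset.sum_le_sum fun e (_ : e ∈ Finset.univ) => hc.imageLen_le hf h₀ e
  rw [← Finset.mul_sum] at h
  rw [(hc.isCollapse hf).vol_eq, vol, finsum_eq_sum_of_fintype, finsum_eq_sum_of_fintype]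
  linarith

/-- Equality in the sum over edges forces every edge to be stretched maximally. After rescaling A,
the map c is isometric on edges and preserves the volume, hence is an isometry by
`IsFolding.isometry_of_vol_eq`. -/
theorem IsShrinking.equivalent_of_vol_eq (hc : IsShrinking f c) (hf : IsPL f)
    (h₀ : IsMaxEdge f v₀ w₀) (hv : A₀.vol = stretch f v₀ w₀ * A.vol) : A.Equivalent A₀ := by
  have := Fintype.ofFinite A.GraphEdge
  have hcol := hc.isCollapse hf
  have hpos := hf.stretch_pos h₀
  have hall : ∀ e, imageLen c hcol.toIsBetween e = stretch f v₀ w₀ * A.edgeLen e := by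
    have h := (Finset.sum_eq_sum_iff_of_le
      fun e (_ : e ∈ Finset.univ) => hc.imageLen_le hf h₀ e).1 (by
        rw [← Finset.mul_sum]
        rw [hcol.vol_eq, vol, finsum_eq_sum_of_fintype, finsum_eq_sum_of_fintype] at hv
        linarith)
    exact fun e => h e (Finset.mem_univ e)
  have hedge : ∀ v w, A.Edge v w → ∀ x ∈ seg v w, ∀ y ∈ seg v w,
      dist (c x) (c y) = stretch f v₀ w₀ * dist x y := by
    intro v w he x hx y hy
    have h1 : dist (c v) (c w) = stretch f v₀ w₀ * dist v w :=
      hall (Quotient.mk A.edgeSetoid ⟨(v, w), he⟩)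
    rw [hc.edge v w he v (left_mem_seg _ _) w (right_mem_seg _ _),
      hf.dist_eq he (left_mem_seg _ _) (right_mem_seg _ _)] at h1
    rw [hc.edge v w he x hx y hy, hf.dist_eq he hx hy,
      mul_right_cancel₀ (dist_pos.2 he.2.2.1).ne' h1]
  let X := reweight c hcol (stretch f v₀ w₀) 0 hpos le_rfl
  let Q : X → A₀ := fun x => c x.point
  have hiso : ∀ v w : X, X.Edge v w → ∀ x ∈ seg v w, ∀ y ∈ seg v w,
      dist (Q x) (Q y) = dist x y := by
    intro v w he x hx y hy
    have h := hedge _ _ (Reweighted.isEdge_iff.1 he) _ (Reweighted.mem_seg_iff.1 hx) _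
      (Reweighted.mem_seg_iff.1 hy)
    change dist (c x.point) (c y.point) = _
    rw [Reweighted.dist_def, h]
    ring
  have hQ : IsFolding Q :=
    { equivariant := fun g x => hc.equivariant g x.point
      surjective := fun z => let ⟨x, hx⟩ := hc.surjective z; ⟨⟨x⟩, hx⟩
      piecewise := by
        refine IsPiecewise.of_countable
          (S := (fun p : X × X => seg p.1 p.2) '' edgePairs (branchPoints X))
          (X.simplicial.edgePairs_countable.image _) ?_ ?_ ?_
        · rintro _ ⟨p, -, rfl⟩
          exact X.realTree.isCompact_seg _ _
        · intro x
          obtain ⟨p, hp, hx⟩ := X.simplicial.exists_edgePair x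
          exact ⟨_, ⟨p, hp, rfl⟩, hx⟩
        · rintro _ ⟨p, hp, rfl⟩ x hx y hy
          exact dist_eq_of_edgePair hiso hp hx hy
      continuousOn := fun x y => by
        have h : Continuous Q := (LipschitzWith.of_dist_le' (K := 1)
          (X.simplicial.dist_le_of_edges X.realTree zero_le_one Q fun v w he x hx y hy => by
            rw [hiso v w he x hx y hy, one_mul])).continuous
        exact h.continuousOn }
  refine (reweight_zero_equivalent c hcol _ hpos).trans
    (equivalent_of_isometry hQ.surjective (hQ.isometry_of_vol_eq ?_) hQ.equivariant)
  rw [reweight_vol, hv]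
  ring

end Shrinking

/-! ### Estimates along the whole fast folding path. -/

/-- The relations that hold between an earlier and a later tree of a folding path: volume and
lengths decrease, and logarithms of lengths at most at the rate `κ` in that of the volume. -/
structure IsFoldedTo (κ : ℝ) (X Y : MarkedTree n) : Prop where
  vol_le : Y.vol ≤ X.vol
  len_le : ∀ g : FreeGroup (Fin n), Y.len g ≤ X.len g
  log_le : ∀ g : FreeGroup (Fin n), g ≠ 1 →
    Real.log (X.len g) - Real.log (Y.len g) ≤ κ * (Real.log X.vol - Real.log Y.vol)
  equivalent : Y.vol = X.vol → X.Equivalent Y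

theorem IsFoldedTo.trans {κ : ℝ} {X Y Z : MarkedTree n} (h : IsFoldedTo κ X Y)
    (h' : IsFoldedTo κ Y Z) : IsFoldedTo κ X Z where
  vol_le := h'.vol_le.trans h.vol_le
  len_le g := (h'.len_le g).trans (h.len_le g)
  log_le g hg := by
    have h1 := h.log_le g hg
    have h2 := h'.log_le g hg
    linarith
  equivalent hv := by
    have h1 := h.vol_le
    have h2 := h'.vol_le
    exact (h.equivalent (by linarith)).trans (h'.equivalent (by linarith))

theorem mul_vol_le_len_of_mem_thick {X : MarkedTree n} {ε : ℝ} (h : X.cls ∈ CV.thick n ε)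
    {g : FreeGroup (Fin n)} (hg : g ≠ 1) : ε * X.vol ≤ X.len g := by
  by_contra! hlt
  refine h ⟨g, hg, ?_⟩
  change X.len g / X.vol < ε
  rwa [div_lt_iff₀ X.vol_pos]

namespace FastFoldingPath

variable {A B : MarkedTree n} {f : A → B} (P : FastFoldingPath A B f)

theorem time_le_succ {i : ℕ} (hi : i < P.steps) : P.time i ≤ P.time (i + 1) := by
  obtain ⟨W, U, -, ⟨⟨v, w, w', -, -, -, -, h⟩, -⟩, -⟩ := P.fold i hi
  have : 0 ≤ dist v w := dist_nonneg
  linarith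

theorem isFoldedTo_of_fold {C : MarkedTree n} {F : C → B} {W : Set C} {U : Set B} {a b ε : ℝ}
    (hε : 0 < ε) {graph : ℝ → MarkedTree n} {F' : ∀ t, graph t → B} (hS : IsSimplicial F W U)
    (hF : ∀ (g : FreeGroup (Fin n)) x, F (g • x) = g • F x)
    (h : ∀ t ∈ Icc a b, ∃ q : C → graph t, IsFold F W (t - a) q (F' t))
    (hthick : ∀ t ∈ Icc a b, (graph t).cls ∈ CV.thick n ε) {s t : ℝ} (hs : s ∈ Icc a b)
    (ht : t ∈ Icc a b) (hst : s ≤ t) : IsFoldedTo (4 / ε) (graph s) (graph t) := by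
  have hfold : ∀ s ∈ Icc a b, ∀ t ∈ Icc a b, s ≤ t →
      ∃ Q : graph s → graph t, IsFolding Q := by
    intro s hs t ht hst
    obtain ⟨q, hq⟩ := h s hs
    obtain ⟨q₂, hq₂⟩ := h t ht
    exact hq.exists_isFolding hS hq₂ (by linarith)
  obtain ⟨Q, hQ⟩ := hfold s hs t ht hst
  refine ⟨hQ.vol_le, hQ.len_le, fun g hg => ?_, fun hv =>
    equivalent_of_isometry hQ.surjective (hQ.isometry_of_vol_eq hv.symm) hQ.equivariant⟩
  -- Thickness allows δ = ε vol in `len_sub_len_le`, which gives the local rate 2/ε; the passage to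
  -- logarithms doubles it.
  have := log_sub_log_le_of_local (κ := 2 / ε) (l := fun t => (graph t).len g)
    (v := fun t => (graph t).vol) (by positivity) (fun t _ => (graph t).len_pos hg)
    (fun t _ => (graph t).vol_pos) (continuousOn_vol_of_isFold hS hF h)
    (fun s hs t ht hst => let ⟨Q, hQ⟩ := hfold s hs t ht hst; hQ.vol_le)
    (fun s hs t ht hst => by
      obtain ⟨Q, hQ⟩ := hfold s hs t ht hst
      have hv := (graph s).vol_pos
      have := hQ.len_sub_len_le (δ := ε * (graph s).vol) (by positivity)
        (fun g hg => mul_vol_le_len_of_mem_thick (hthick s hs) hg) hg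
      refine this.trans (le_of_eq ?_)
      field_simp) hs ht hst
  refine this.trans (le_of_eq ?_)
  ring

/-- The structure does not record that the maps to B are equivariant. Equivariance is inherited from
f through the quotient maps, so it is proved in the same induction as the estimates that use it. -/
theorem isFoldedTo_aux {ε : ℝ} (hε : 0 < ε)
    (hthick : ∀ t ∈ Icc 0 P.finalTime, (P.graph t).cls ∈ CV.thick n ε) {i : ℕ} (hi : i ≤ P.steps) :
    (0 ≤ P.time i ∧ P.time i ≤ P.finalTime) ∧
    (∀ (g : FreeGroup (Fin n)) x, P.toTarget (P.time i) (g • x) = g • P.toTarget (P.time i) x) ∧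
    ContinuousOn (fun t => (P.graph t).vol) (Icc 0 (P.time i)) ∧
    ∀ s ∈ Icc 0 (P.time i), ∀ t ∈ Icc 0 (P.time i), s ≤ t →
      IsFoldedTo (4 / ε) (P.graph s) (P.graph t) := by
  have hfin : ∀ j ≤ P.steps, P.time j ≤ P.finalTime := by
    intro j hj
    induction hj using Nat.decreasingInduction with
    | self => exact le_rfl
    | of_succ k hk ih => exact (P.time_le_succ hk).trans ih
  have hrefl : ∀ X : MarkedTree n, IsFoldedTo (4 / ε) X X := fun X =>
    ⟨le_rfl, fun _ => le_rfl, fun g _ => by simp, fun _ => Equivalent.refl X⟩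
  induction i with
  | zero =>
    refine ⟨⟨P.time_zero.ge, hfin 0 hi⟩, ?_, ?_, ?_⟩
    · rw [P.time_zero]
      intro g x
      obtain ⟨a, rfl⟩ := P.isShrinking.surjective x
      rw [← P.isShrinking.equivariant, P.toTarget_shrink, P.toTarget_shrink,
        P.isOptimal.isPL.equivariant]
    · rw [P.time_zero, Icc_self]
      exact continuousOn_singleton _ _
    · rw [P.time_zero, Icc_self]
      rintro s rfl t rfl -
      exact hrefl _
  | succ i ih =>
    obtain ⟨⟨h0, -⟩, he, hc, hr⟩ := ih (Nat.le_of_succ_le hi)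
    obtain ⟨W, U, hS, -, hfold⟩ := P.fold i hi
    have hle := P.time_le_succ hi
    have hthick' : ∀ t ∈ Icc (P.time i) (P.time (i + 1)), (P.graph t).cls ∈ CV.thick n ε :=
      fun t ht => hthick t ⟨h0.trans ht.1, ht.2.trans (hfin _ hi)⟩
    refine ⟨⟨h0.trans hle, hfin _ hi⟩, ?_, ?_, ?_⟩
    · obtain ⟨q, hq⟩ := hfold _ ⟨hle, le_rfl⟩
      exact hq.equivariant_factor he
    · rw [← Icc_union_Icc_eq_Icc h0 hle]
      exact hc.union_of_isClosed (continuousOn_vol_of_isFold hS he hfold) isClosed_Icc isClosed_Icc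
    · have hr' := fun {s t : ℝ} => isFoldedTo_of_fold (s := s) (t := t) hε hS he hfold hthick'
      intro s hs t ht hst
      rcases le_total t (P.time i) with h1 | h1
      · exact hr s ⟨hs.1, hst.trans h1⟩ t ⟨ht.1, h1⟩ hst
      rcases le_total s (P.time i) with h2 | h2
      · exact (hr s ⟨hs.1, h2⟩ _ ⟨h0, le_rfl⟩ h2).trans (hr' ⟨le_rfl, hle⟩ ⟨h1, ht.2⟩ h1)
      · exact hr' ⟨h2, hs.2⟩ ⟨h1, ht.2⟩ hst

theorem finalTime_nonneg {ε : ℝ} (hε : 0 < ε)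
    (hthick : ∀ t ∈ Icc 0 P.finalTime, (P.graph t).cls ∈ CV.thick n ε) : 0 ≤ P.finalTime :=
  (P.isFoldedTo_aux hε hthick le_rfl).1.1

theorem continuousOn_vol {ε : ℝ} (hε : 0 < ε)
    (hthick : ∀ t ∈ Icc 0 P.finalTime, (P.graph t).cls ∈ CV.thick n ε) :
    ContinuousOn (fun t => (P.graph t).vol) (Icc 0 P.finalTime) :=
  (P.isFoldedTo_aux hε hthick le_rfl).2.2.1

theorem isFoldedTo {ε : ℝ} (hε : 0 < ε)
    (hthick : ∀ t ∈ Icc 0 P.finalTime, (P.graph t).cls ∈ CV.thick n ε)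
    {s t : ℝ} (hs : s ∈ Icc 0 P.finalTime) (ht : t ∈ Icc 0 P.finalTime)
    (hst : s ≤ t) : IsFoldedTo (4 / ε) (P.graph s) (P.graph t) :=
  (P.isFoldedTo_aux hε hthick le_rfl).2.2.2 s hs t ht hst

theorem exists_isometry {ε : ℝ} (hε : 0 < ε)
    (hthick : ∀ t ∈ Icc 0 P.finalTime, (P.graph t).cls ∈ CV.thick n ε) :
    ∃ φ : P.graph P.finalTime ≃ B, (∀ x y, dist (φ x) (φ y) = 1 * dist x y) ∧
      ∀ (g : FreeGroup (Fin n)) x, φ (g • x) = g • φ x :=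
  ⟨Equiv.ofBijective _ P.finish.1, fun x y => by rw [one_mul]; exact P.finish.2.dist_eq x y,
    (P.isFoldedTo_aux hε hthick le_rfl).2.1⟩

theorem final_equivalent {ε : ℝ} (hε : 0 < ε)
    (hthick : ∀ t ∈ Icc 0 P.finalTime, (P.graph t).cls ∈ CV.thick n ε) :
    (P.graph P.finalTime).Equivalent B :=
  let ⟨φ, hd, he⟩ := P.exists_isometry hε hthick
  ⟨φ, 1, one_pos, hd, he⟩

theorem len_final {ε : ℝ} (hε : 0 < ε)
    (hthick : ∀ t ∈ Icc 0 P.finalTime, (P.graph t).cls ∈ CV.thick n ε)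
    (g : FreeGroup (Fin n)) : (P.graph P.finalTime).len g = B.len g := by
  obtain ⟨φ, hd, he⟩ := P.exists_isometry hε hthick
  rw [len_homothety φ 1 one_pos hd he, one_mul]

end FastFoldingPath

theorem MarkedTree.len_one (A : MarkedTree n) : A.len 1 = 0 := by
  have := A.realTree.nonempty
  simp only [len, one_smul, dist_self, ciInf_const]

theorem MarkedTree.cls_len (A : MarkedTree n) (g : FreeGroup (Fin n)) :
    A.cls.len g = A.len g / A.vol := rfl

theorem CV.d_comm (a b : CV n) : d a b = d b a := by
  rw [d, d, mul_comm]

/-! ### From stretch paths to right-geodesics and quasi-geodesics. -/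

/-- Paths of trees along which volume and lengths decrease, one loop is never
shortened, the logarithms of the lengths are controlled by the logarithm of the volume, and some
loop gets shorter at least at half the rate of the volume. -/
structure IsStretchPath (T : ℝ → MarkedTree n) (R κ M M' : ℝ) : Prop where
  nonneg : 0 ≤ R
  continuousOn_vol : ContinuousOn (fun r => (T r).vol) (Icc 0 R)
  antitone_vol : AntitoneOn (fun r => (T r).vol) (Icc 0 R)
  antitone_len : ∀ g : FreeGroup (Fin n), AntitoneOn (fun r => (T r).len g) (Icc 0 R)
  exists_rigid : ∃ g : FreeGroup (Fin n), g ≠ 1 ∧ (T 0).len g ≤ (T R).len g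
  log_lipschitz : ∀ g : FreeGroup (Fin n), g ≠ 1 → ∃ C, 0 ≤ C ∧
    ∀ r ∈ Icc 0 R, ∀ r' ∈ Icc 0 R, r ≤ r' →
      Real.log ((T r).len g) - Real.log ((T r').len g) ≤
        C * (Real.log (T r).vol - Real.log (T r').vol)
  log_le : ∀ g : FreeGroup (Fin n), g ≠ 1 → ∀ r ∈ Icc 0 R, ∀ r' ∈ Icc 0 R, r ≤ r' →
    Real.log ((T r).len g) - Real.log ((T r').len g) ≤
      M + κ * (Real.log (T r).vol - Real.log (T r').vol)
  exists_le_log : ∀ r ∈ Icc 0 R, ∀ r' ∈ Icc 0 R, r ≤ r' → ∃ g : FreeGroup (Fin n), g ≠ 1 ∧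
    (Real.log (T r).vol - Real.log (T r').vol) / 2 - M' ≤
      Real.log ((T r).len g) - Real.log ((T r').len g)
  equivalent : (T R).vol = (T 0).vol → (T 0).Equivalent (T R)

namespace IsStretchPath

variable {T : ℝ → MarkedTree n} {R κ M M' r r' : ℝ}

/-- No unnormalised length increases and the rigid loop keeps its length, so it realises the
supremum and only the normalising volumes remain. -/
theorem stretchR_eq (h : IsStretchPath T R κ M M') (hr : r ∈ Icc 0 R) (hr' : r' ∈ Icc 0 R)
    (hrr : r ≤ r') : CV.stretchR (T r).cls (T r').cls =
      Real.exp (Real.log (T r).vol - Real.log (T r').vol) := by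
  have hv := (T r).vol_pos
  have hv' := (T r').vol_pos
  rw [Real.exp_sub, Real.exp_log hv, Real.exp_log hv']
  obtain ⟨g₀, hg₀, h₀⟩ := h.exists_rigid
  have h0 : (0 : ℝ) ∈ Icc 0 R := ⟨le_rfl, h.nonneg⟩
  have hR : R ∈ Icc 0 R := ⟨h.nonneg, le_rfl⟩
  have heq : (T r').len g₀ = (T r).len g₀ := by
    have h1 := h.antitone_len g₀ h0 hr hr.1
    have h2 := h.antitone_len g₀ hr hr' hrr
    have h3 := h.antitone_len g₀ hr' hR hr'.2
    simp only at h1 h2 h3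
    linarith
  have hterm : ∀ w : {w : FreeGroup (Fin n) // w ≠ 1},
      (T r').cls.len w / (T r).cls.len w ≤ (T r).vol / (T r').vol := by
    rintro ⟨g, hg⟩
    have hl := (T r).len_pos hg
    have h2 : (T r').len g ≤ (T r).len g := h.antitone_len g hr hr' hrr
    rw [cls_len, cls_len, div_div_div_eq, div_le_div_iff₀ (by positivity) hv']
    calc (T r').len g * (T r).vol * (T r').vol
        ≤ (T r).len g * (T r).vol * (T r').vol := by gcongr
      _ = (T r).vol * ((T r').vol * (T r).len g) := by ring
  have : Nonempty {w : FreeGroup (Fin n) // w ≠ 1} := ⟨⟨g₀, hg₀⟩⟩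
  refine le_antisymm (ciSup_le hterm) ?_
  refine le_ciSup_of_le ⟨_, by rintro _ ⟨w, rfl⟩; exact hterm w⟩ ⟨g₀, hg₀⟩ (le_of_eq ?_)
  rw [cls_len, cls_len, heq]
  have hl := (T r).len_pos hg₀
  field_simp

theorem stretchR_symm_mem (h : IsStretchPath T R κ M M') (hr : r ∈ Icc 0 R) (hr' : r' ∈ Icc 0 R)
    (hrr : r ≤ r') : CV.stretchR (T r').cls (T r).cls ∈
      Icc (Real.exp (-(Real.log (T r).vol - Real.log (T r').vol) / 2 - M'))
        (Real.exp (M + (κ - 1) * (Real.log (T r).vol - Real.log (T r').vol))) := by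
  have hv := (T r).vol_pos
  have hv' := (T r').vol_pos
  have hexp : ∀ g : FreeGroup (Fin n), g ≠ 1 → (T r).cls.len g / (T r').cls.len g =
      Real.exp (Real.log ((T r).len g) - Real.log ((T r').len g) -
        (Real.log (T r).vol - Real.log (T r').vol)) := by
    intro g hg
    have hl := (T r).len_pos hg
    have hl' := (T r').len_pos hg
    rw [Real.exp_sub, Real.exp_sub, Real.exp_sub, Real.exp_log hl, Real.exp_log hl',
      Real.exp_log hv, Real.exp_log hv', cls_len, cls_len]
    field_simp
  have hterm : ∀ w : {w : FreeGroup (Fin n) // w ≠ 1},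
      (T r).cls.len w / (T r').cls.len w ≤
        Real.exp (M + (κ - 1) * (Real.log (T r).vol - Real.log (T r').vol)) := by
    rintro ⟨g, hg⟩
    rw [hexp g hg]
    have := h.log_le g hg r hr r' hr' hrr
    exact Real.exp_le_exp.2 (by linarith)
  obtain ⟨g, hg, hle⟩ := h.exists_le_log r hr r' hr' hrr
  have : Nonempty {w : FreeGroup (Fin n) // w ≠ 1} := ⟨⟨g, hg⟩⟩
  refine ⟨le_ciSup_of_le ⟨_, by rintro _ ⟨w, rfl⟩; exact hterm w⟩ ⟨g, hg⟩ ?_, ciSup_le hterm⟩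
  rw [hexp g hg]
  exact Real.exp_le_exp.2 (by linarith)

theorem dR_eq (h : IsStretchPath T R κ M M') (hr : r ∈ Icc 0 R) (hr' : r' ∈ Icc 0 R)
    (hrr : r ≤ r') : CV.dR (T r).cls (T r').cls = Real.log (T r).vol - Real.log (T r').vol := by
  rw [CV.dR, h.stretchR_eq hr hr' hrr, Real.log_exp]

theorem d_mem (h : IsStretchPath T R κ M M') (hr : r ∈ Icc 0 R) (hr' : r' ∈ Icc 0 R)
    (hrr : r ≤ r') : CV.d (T r).cls (T r').cls ∈
      Icc ((Real.log (T r).vol - Real.log (T r').vol) / 2 - M')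
        (κ * (Real.log (T r).vol - Real.log (T r').vol) + M) := by
  obtain ⟨h1, h2⟩ := h.stretchR_symm_mem hr hr' hrr
  have hpos := (Real.exp_pos _).trans_le h1
  rw [CV.d, h.stretchR_eq hr hr' hrr, Real.log_mul (Real.exp_pos _).ne' hpos.ne', Real.log_exp]
  have h3 := (Real.le_log_iff_exp_le hpos).2 h1
  have h4 := (Real.log_le_iff_le_exp hpos).2 h2
  constructor <;> linarith

theorem exists_rightGeodesic (h : IsStretchPath T R κ M M') :
    ∃ α : ℝ → CV n, CV.IsRightGeodesic α (T 0).cls (T R).cls ∧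
      CV.IsQuasiGeodesicOn α (Icc 0 (CV.dR (T 0).cls (T R).cls)) (max 2 κ) (max M M') := by
  have h0 : (0 : ℝ) ∈ Icc 0 R := ⟨le_rfl, h.nonneg⟩
  have hR : R ∈ Icc 0 R := ⟨h.nonneg, le_rfl⟩
  have hlogc : ContinuousOn (fun r => Real.log (T 0).vol - Real.log (T r).vol) (Icc 0 R) :=
    continuousOn_const.sub (h.continuousOn_vol.log fun r _ => (T r).vol_pos.ne')
  have hanti : ∀ r ∈ Icc 0 R, ∀ r' ∈ Icc 0 R, r ≤ r' →
      Real.log (T r').vol ≤ Real.log (T r).vol := fun r hr r' hr' hrr =>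
    Real.log_le_log (T r').vol_pos (h.antitone_vol hr hr' hrr)
  have hD := h.dR_eq h0 hR h.nonneg
  set D := CV.dR (T 0).cls (T R).cls with hDd
  have hD0 : 0 ≤ D := by
    have := hanti 0 h0 R hR h.nonneg
    linarith
  have hsurj := intermediate_value_Icc h.nonneg hlogc
  simp only [sub_self] at hsurj
  rw [← hD] at hsurj
  have hex : ∀ τ ∈ Icc 0 D, ∃ r ∈ Icc 0 R, Real.log (T 0).vol - Real.log (T r).vol = τ :=
    fun τ hτ => hsurj hτ
  choose! ρ hρ hρv using hex
  -- The chosen ρ need not respect the end-points. If D = 0, the first clause wins and the path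
  -- starts at T R, which then has the class of T 0.
  set r : ℝ → ℝ := fun τ => if τ = D then R else if τ = 0 then 0 else ρ τ with hrd
  have hrm : ∀ τ ∈ Icc 0 D, r τ ∈ Icc 0 R := by
    intro τ hτ
    simp only [hrd]
    split_ifs
    exacts [hR, h0, hρ τ hτ]
  have hrv : ∀ τ ∈ Icc 0 D, Real.log (T (r τ)).vol = Real.log (T 0).vol - τ := by
    intro τ hτ
    simp only [hrd]
    split_ifs with h1 h2
    · linarith
    · rw [h2, sub_zero]
    · linarith [hρv τ hτ]
  have hmono : ∀ s ∈ Icc 0 D, ∀ t ∈ Icc 0 D, s ≤ t → r s ≤ r t := by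
    intro s hs t ht hst
    rcases hst.eq_or_lt with rfl | hlt
    · exact le_rfl
    · by_contra! hlt'
      have := hanti _ (hrm t ht) _ (hrm s hs) hlt'.le
      rw [hrv s hs, hrv t ht] at this
      linarith
  have hlip : ∀ g : FreeGroup (Fin n), ContinuousOn (fun τ => (T (r τ)).len g) (Icc 0 D) := by
    intro g
    by_cases hg : g = 1
    · subst hg
      simp only [len_one]
      exact continuousOn_const
    -- The topology is that of pointwise convergence up to homothety, so a constant that depends on
    -- g suffices for continuity.
    obtain ⟨C, hC, hCl⟩ := h.log_lipschitz g hg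
    have hle : ∀ s ∈ Icc 0 D, ∀ t ∈ Icc 0 D, s ≤ t →
        dist (Real.log ((T (r s)).len g)) (Real.log ((T (r t)).len g)) ≤ C * dist s t := by
      intro s hs t ht hst
      have h1 := hCl _ (hrm s hs) _ (hrm t ht) (hmono s hs t ht hst)
      have h2 : (T (r t)).len g ≤ (T (r s)).len g :=
        h.antitone_len g (hrm s hs) (hrm t ht) (hmono s hs t ht hst)
      have h3 := Real.log_le_log ((T (r t)).len_pos hg) h2
      rw [hrv s hs, hrv t ht] at h1
      rw [Real.dist_eq, Real.dist_eq, abs_of_nonneg (by linarith), abs_of_nonpos (by linarith)]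
      refine h1.trans (le_of_eq ?_)
      ring
    have hlog : ContinuousOn (fun τ => Real.log ((T (r τ)).len g)) (Icc 0 D) := by
      refine LipschitzOnWith.continuousOn (K := ⟨C, hC⟩) (LipschitzOnWith.of_dist_le_mul ?_)
      intro s hs t ht
      rcases le_total s t with hst | hst
      · exact hle s hs t ht hst
      · rw [dist_comm, dist_comm s]
        exact hle t ht s hs hst
    exact hlog.rexp.congr fun τ _ => (Real.exp_log ((T (r τ)).len_pos hg)).symm
  have hd : ∀ s ∈ Icc 0 D, ∀ t ∈ Icc 0 D, s ≤ t → CV.d (T (r s)).cls (T (r t)).cls ∈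
      Icc (1 / max 2 κ * |s - t| - max M M') (max 2 κ * |s - t| + max M M') := by
    intro s hs t ht hst
    have h1 := h.d_mem (hrm s hs) (hrm t ht) (hmono s hs t ht hst)
    rw [hrv s hs, hrv t ht] at h1
    obtain ⟨h1, h2⟩ := h1
    rw [abs_of_nonpos (by linarith)]
    have h3 : 1 / max 2 κ * (t - s) ≤ 1 / 2 * (t - s) := mul_le_mul_of_nonneg_right
      (one_div_le_one_div_of_le two_pos (le_max_left _ _)) (by linarith)
    have h4 : κ * (t - s) ≤ max 2 κ * (t - s) :=
      mul_le_mul_of_nonneg_right (le_max_right _ _) (by linarith)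
    have h5 := le_max_left M M'
    have h6 := le_max_right M M'
    constructor <;> linarith
  refine ⟨fun τ => (T (r τ)).cls, ⟨?_, ?_, ?_, ?_⟩, ?_⟩
  · have hind : IsInducing fun a : CV n => Quotient.mk (homothetySetoid n) a.len := ⟨rfl⟩
    rw [hind.continuousOn_iff]
    have hq := (continuous_quotient_mk' (s := homothetySetoid n)).comp_continuousOn
      (continuousOn_pi.2 hlip)
    refine hq.congr fun τ _ => Quotient.sound ⟨(T (r τ)).vol, (T (r τ)).vol_pos, ?_⟩
    ext g
    have := (T (r τ)).vol_pos
    rw [Pi.smul_apply, smul_eq_mul, cls_len, mul_div_cancel₀ _ this.ne']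
  · simp only [hrd]
    split_ifs with h1
    · refine Quotient.sound (Equivalent.symm (h.equivalent ?_))
      refine Real.log_injOn_pos (T R).vol_pos (T 0).vol_pos ?_
      linarith
    · rfl
  · simp only [hrd, ← hDd, if_true]
  · intro s hs t ht hst
    rw [h.dR_eq (hrm s hs) (hrm t ht) (hmono s hs t ht hst), hrv s hs, hrv t ht]
    ring
  · intro s hs t ht
    rcases le_total s t with hst | hst
    · exact hd s hs t ht hst
    · have h1 := hd t ht s hs hst
      rw [CV.d_comm, abs_sub_comm] at h1
      exact h1

end IsStretchPath

/-! ### Concatenation, and logarithms of linear interpolations. -/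

theorem forall_le_of_concat {p : ℝ → ℝ → Prop} {R : ℝ} (hR : 1 ≤ R)
    (h1 : ∀ r ∈ Icc (0 : ℝ) 1, ∀ r' ∈ Icc (0 : ℝ) 1, r ≤ r' → p r r')
    (h2 : ∀ r ∈ Icc 1 R, ∀ r' ∈ Icc 1 R, r ≤ r' → p r r')
    (h3 : ∀ r ∈ Icc (0 : ℝ) 1, ∀ r' ∈ Icc 1 R, p r 1 → p 1 r' → p r r') :
    ∀ r ∈ Icc 0 R, ∀ r' ∈ Icc 0 R, r ≤ r' → p r r' := by
  intro r hr r' hr' hrr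
  rcases le_total r' 1 with h | h
  · exact h1 r ⟨hr.1, hrr.trans h⟩ r' ⟨hr'.1, h⟩ hrr
  rcases le_total r 1 with h' | h'
  · exact h3 r ⟨hr.1, h'⟩ r' ⟨h, hr'.2⟩ (h1 r ⟨hr.1, h'⟩ 1 ⟨zero_le_one, le_rfl⟩ h')
      (h2 1 ⟨le_rfl, hR⟩ r' ⟨h, hr'.2⟩ h)
  · exact h2 r ⟨h', hr.2⟩ r' ⟨h, hr'.2⟩ hrr

section Interpolation

variable {x y a b r r' : ℝ}

theorem interpolation_pos (hx : 0 < x) (hy : 0 < y) (hr : r ∈ Icc (0 : ℝ) 1) :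
    0 < (1 - r) * x + r * y := by
  have h1 : 0 ≤ (1 - r) * x := mul_nonneg (by linarith [hr.2]) hx.le
  rcases hr.1.eq_or_lt with rfl | h
  · linarith
  · have : 0 < r * y := mul_pos h hy
    linarith

theorem interpolation_anti (hxy : y ≤ x) (hrr : r ≤ r') :
    (1 - r') * x + r' * y ≤ (1 - r) * x + r * y := by
  nlinarith

/-- For lengths x, y and volumes a, b at the ends. C compares the largest possible decay rate (x -
y) / y of log length with the smallest one (a - b) / a of log volume; it is not uniform and serves
continuity only. -/
theorem exists_log_interpolation_le (hx : 0 < x) (hy : 0 < y) (ha : 0 < a) (hb : 0 < b)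
    (hxy : y ≤ x) (hab : b ≤ a) (heq : b = a → y = x) : ∃ C, 0 ≤ C ∧
      ∀ r ∈ Icc (0 : ℝ) 1, ∀ r' ∈ Icc (0 : ℝ) 1, r ≤ r' →
        Real.log ((1 - r) * x + r * y) - Real.log ((1 - r') * x + r' * y) ≤
          C * (Real.log ((1 - r) * a + r * b) - Real.log ((1 - r') * a + r' * b)) := by
  rcases hab.eq_or_lt with h | hlt
  · refine ⟨0, le_rfl, fun r _ r' _ _ => ?_⟩
    rw [heq h, zero_mul, ← add_mul, ← add_mul, sub_add_cancel, sub_add_cancel, sub_self]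
  refine ⟨(x - y) * a / (y * (a - b)), div_nonneg (mul_nonneg (by linarith) ha.le)
    (mul_nonneg hy.le (by linarith)), fun r hr r' hr' hrr => ?_⟩
  have h1 := interpolation_pos hx hy hr
  have h2 := interpolation_pos hx hy hr'
  have h3 := interpolation_pos ha hb hr
  have h4 := interpolation_pos ha hb hr'
  have u1 : Real.log ((1 - r) * x + r * y) - Real.log ((1 - r') * x + r' * y) ≤
      (r' - r) * (x - y) / y := by
    rw [← Real.log_div h1.ne' h2.ne']
    refine (Real.log_le_sub_one_of_pos (by positivity)).trans ?_
    rw [div_sub_one h2.ne']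
    have e : (1 - r) * x + r * y - ((1 - r') * x + r' * y) = (r' - r) * (x - y) := by ring
    rw [e]
    refine div_le_div_of_nonneg_left (mul_nonneg (by linarith) (by linarith)) hy ?_
    nlinarith [hr'.2]
  have u2 : (r' - r) * (a - b) / a ≤
      Real.log ((1 - r) * a + r * b) - Real.log ((1 - r') * a + r' * b) := by
    have h := Real.log_le_sub_one_of_pos (div_pos h4 h3)
    rw [Real.log_div h4.ne' h3.ne', div_sub_one h3.ne'] at h
    have e : (1 - r') * a + r' * b - ((1 - r) * a + r * b) = -((r' - r) * (a - b)) := by ring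
    rw [e, neg_div] at h
    have h5 : (r' - r) * (a - b) / a ≤ (r' - r) * (a - b) / ((1 - r) * a + r * b) := by
      refine div_le_div_of_nonneg_left (mul_nonneg (by linarith) (by linarith)) h3 ?_
      nlinarith [hr.1]
    linarith
  have hC : 0 ≤ (x - y) * a / (y * (a - b)) := div_nonneg (mul_nonneg (by linarith) ha.le)
    (mul_nonneg hy.le (by linarith))
  refine u1.trans (le_trans (le_of_eq ?_) (mul_le_mul_of_nonneg_left u2 hC))
  have : a - b ≠ 0 := (sub_pos.2 hlt).ne'
  field_simp

/-- After multiplying out, the only dangerous term is (1 - r) r' x b, which the hypothesis bounds by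
1/δ times the corresponding term in a y. -/
theorem log_interpolation_le {δ : ℝ} (hδ : 0 < δ) (hx : 0 < x) (hy : 0 < y) (ha : 0 < a)
    (hb : 0 < b) (h : δ * (x * b) ≤ a * y) (hr : r ∈ Icc (0 : ℝ) 1) (hr' : r' ∈ Icc (0 : ℝ) 1)
    (hrr : r ≤ r') : Real.log ((1 - r) * x + r * y) - Real.log ((1 - r') * x + r' * y) ≤
      Real.log (1 / δ + 1) +
        (Real.log ((1 - r) * a + r * b) - Real.log ((1 - r') * a + r' * b)) := by
  have h1 := interpolation_pos hx hy hr
  have h2 := interpolation_pos hx hy hr'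
  have h3 := interpolation_pos ha hb hr
  have h4 := interpolation_pos ha hb hr'
  have hδ' : 0 < 1 / δ + 1 := by positivity
  have h5 : x * b ≤ 1 / δ * (a * y) := by
    rw [one_div_mul_eq_div, le_div_iff₀ hδ]
    linarith
  have key : ((1 - r) * x + r * y) * ((1 - r') * a + r' * b) ≤
      (1 / δ + 1) * ((1 - r) * a + r * b) * ((1 - r') * x + r' * y) := by
    have hs : 0 ≤ 1 - r := by linarith [hr.2]
    have hs' : 0 ≤ 1 - r' := by linarith [hr'.2]
    have hd : 0 ≤ 1 / δ := by positivity
    have t1 := mul_le_mul_of_nonneg_left h5 (mul_nonneg hs hr'.1)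
    have t2 : r * (1 - r') * (a * y) ≤ r' * (1 - r) * (a * y) :=
      mul_le_mul_of_nonneg_right (by nlinarith) (by positivity)
    have t3 : 0 ≤ 1 / δ * ((1 - r) * (1 - r') * (a * x)) :=
      mul_nonneg hd (mul_nonneg (mul_nonneg hs hs') (by positivity))
    have t4 : 0 ≤ (1 / δ + 1) * (r * (1 - r') * (b * x)) :=
      mul_nonneg hδ'.le (mul_nonneg (mul_nonneg hr.1 hs') (by positivity))
    have t5 : 0 ≤ 1 / δ * (r * r' * (b * y)) :=
      mul_nonneg hd (mul_nonneg (mul_nonneg hr.1 hr'.1) (by positivity))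
    nlinarith
  have := Real.log_le_log (mul_pos h1 h4) key
  rw [Real.log_mul h1.ne' h4.ne', Real.log_mul (by positivity) h2.ne',
    Real.log_mul hδ'.ne' h3.ne'] at this
  linarith

/-- The cross-multiplied difference is (r' - r) (x b - y a). -/
theorem log_le_log_interpolation (hx : 0 < x) (hy : 0 < y) (ha : 0 < a)
    (hb : 0 < b) (h : y * a ≤ x * b) (hr : r ∈ Icc (0 : ℝ) 1) (hr' : r' ∈ Icc (0 : ℝ) 1)
    (hrr : r ≤ r') : Real.log ((1 - r) * a + r * b) - Real.log ((1 - r') * a + r' * b) ≤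
      Real.log ((1 - r) * x + r * y) - Real.log ((1 - r') * x + r' * y) := by
  have h1 := interpolation_pos hx hy hr
  have h2 := interpolation_pos hx hy hr'
  have h3 := interpolation_pos ha hb hr
  have h4 := interpolation_pos ha hb hr'
  have key : ((1 - r) * a + r * b) * ((1 - r') * x + r' * y) ≤
      ((1 - r) * x + r * y) * ((1 - r') * a + r' * b) := by
    have := mul_le_mul_of_nonneg_left h (sub_nonneg.2 hrr)
    linarith
  have := Real.log_le_log (mul_pos h3 h2) key
  rw [Real.log_mul h3.ne' h2.ne', Real.log_mul h1.ne' h4.ne'] at this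
  linarith

end Interpolation

/-- Along a collapse, some loop shrinks at least as much as the volume does. -/
theorem MarkedTree.IsCollapse.exists_len_mul_vol_le {A Z : MarkedTree n} {c : A → Z}
    (hc : IsCollapse c) : ∃ g : FreeGroup (Fin n), g ≠ 1 ∧ Z.len g * A.vol ≤ A.len g * Z.vol := by
  obtain ⟨N, w, hN, hw, h⟩ := A.exists_loops
  have := Fintype.ofFinite A.GraphEdge
  have h1 := h A id A.isCollapse_id
  have h2 := h Z c hc
  rw [finsum_eq_sum_of_fintype] at h1 h2
  by_contra! hlt
  have h3 := Finset.sum_lt_sum_of_nonempty Finset.univ_nonempty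
    fun e (_ : e ∈ Finset.univ) => hlt (w e) (hw e)
  rw [← Finset.sum_mul, ← Finset.sum_mul, h1, h2] at h3
  linarith

/-! ### The interpolation followed by the folding path is a stretch path. -/

namespace FastFoldingPath

variable {A B : MarkedTree n} {f : A → B} (P : FastFoldingPath A B f)

theorem isCollapse_shrink : IsCollapse P.shrink := P.isShrinking.isCollapse P.isOptimal.isPL

/-- The fast folding path, preceded by a linear interpolation between the source, scaled by `k`,
and the graph at which the folding starts. -/
noncomputable def extend {k : ℝ} (hk : 0 < k) (r : ℝ) : MarkedTree n :=
  if h : 0 ≤ r ∧ r < 1 then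
    reweight P.shrink P.isCollapse_shrink ((1 - r) * k) r (mul_pos (sub_pos.2 h.2) hk) h.1
  else P.graph (r - 1)

variable {k : ℝ} (hk : 0 < k) {r r' : ℝ}

theorem extend_of_one_le (hr : 1 ≤ r) : P.extend hk r = P.graph (r - 1) :=
  dif_neg fun h => absurd h.2 (not_lt.2 hr)

theorem extend_one : P.extend hk 1 = P.graph 0 := by
  rw [extend_of_one_le P hk le_rfl, sub_self]

theorem extend_len (hr : r ∈ Icc (0 : ℝ) 1) (g : FreeGroup (Fin n)) :
    (P.extend hk r).len g = (1 - r) * (k * A.len g) + r * (P.graph 0).len g := by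
  by_cases hg : g = 1
  · rw [hg, len_one, len_one, len_one, mul_zero, mul_zero, mul_zero, add_zero]
  rcases hr.2.eq_or_lt with rfl | h
  · rw [extend_one, sub_self, zero_mul, zero_add, one_mul]
  · rw [extend, dif_pos ⟨hr.1, h⟩, reweight_len _ _ _ _ _ _ hg, mul_assoc]

theorem extend_vol (hr : r ∈ Icc (0 : ℝ) 1) :
    (P.extend hk r).vol = (1 - r) * (k * A.vol) + r * (P.graph 0).vol := by
  rcases hr.2.eq_or_lt with rfl | h
  · rw [extend_one, sub_self, zero_mul, zero_add, one_mul]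
  · rw [extend, dif_pos ⟨hr.1, h⟩, reweight_vol, mul_assoc]

theorem extend_zero_equivalent : A.Equivalent (P.extend hk 0) := by
  rw [extend, dif_pos ⟨le_rfl, zero_lt_one⟩]
  exact reweight_zero_equivalent _ _ _ _

variable {ε : ℝ} {v₀ w₀ : A}

theorem isStretchPath_extend (hε : 0 < ε)
    (hthick : ∀ t ∈ Icc 0 P.finalTime, (P.graph t).cls ∈ CV.thick n ε) (h₀ : IsMaxEdge f v₀ w₀) :
    IsStretchPath (P.extend (P.isOptimal.isPL.stretch_pos h₀)) (1 + P.finalTime) (1 + 4 / ε)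
      (Real.log (1 / ε + 1)) |Real.log (ε / 2)| := by
  have hk := P.isOptimal.isPL.stretch_pos h₀
  set k := stretch f v₀ w₀ with hkd
  have hT := P.finalTime_nonneg hε hthick
  have hR : 1 ≤ 1 + P.finalTime := by linarith
  have hlen0 := P.isShrinking.len_le P.isOptimal.isPL h₀
  have hvol0 := P.isShrinking.vol_le P.isOptimal.isPL h₀
  have hA := A.vol_pos
  have hkA : 0 < k * A.vol := mul_pos hk hA
  have hG := (P.graph 0).vol_pos
  have hlA : ∀ g : FreeGroup (Fin n), g ≠ 1 → 0 < k * A.len g := fun g hg =>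
    mul_pos hk (A.len_pos hg)
  have hlast : P.extend hk (1 + P.finalTime) = P.graph P.finalTime := by
    rw [P.extend_of_one_le hk hR, add_sub_cancel_left]
  have hfold : ∀ r ∈ Icc 1 (1 + P.finalTime), ∀ r' ∈ Icc 1 (1 + P.finalTime), r ≤ r' →
      IsFoldedTo (4 / ε) (P.extend hk r) (P.extend hk r') := by
    intro r hr r' hr' hrr
    rw [P.extend_of_one_le hk hr.1, P.extend_of_one_le hk hr'.1]
    exact P.isFoldedTo hε hthick ⟨by linarith [hr.1], by linarith [hr.2]⟩
      ⟨by linarith [hr'.1], by linarith [hr'.2]⟩ (by linarith)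
  have hthick' : ∀ r ∈ Icc 1 (1 + P.finalTime), ∀ g : FreeGroup (Fin n), g ≠ 1 →
      ε * (P.extend hk r).vol ≤ (P.extend hk r).len g := by
    intro r hr g hg
    rw [P.extend_of_one_le hk hr.1]
    exact mul_vol_le_len_of_mem_thick
      (hthick _ ⟨by linarith [hr.1], by linarith [hr.2]⟩) hg
  have hanti : ∀ r ∈ Icc 0 (1 + P.finalTime), ∀ r' ∈ Icc 0 (1 + P.finalTime), r ≤ r' →
      (P.extend hk r').vol ≤ (P.extend hk r).vol := by
    refine forall_le_of_concat hR ?_ (fun r hr r' hr' h => (hfold r hr r' hr' h).vol_le)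
      fun _ _ _ _ h h' => h'.trans h
    intro r hr r' hr' hrr
    rw [P.extend_vol hk hr, P.extend_vol hk hr']
    exact interpolation_anti hvol0 hrr
  have hlanti : ∀ g : FreeGroup (Fin n), ∀ r ∈ Icc 0 (1 + P.finalTime),
      ∀ r' ∈ Icc 0 (1 + P.finalTime), r ≤ r' →
        (P.extend hk r').len g ≤ (P.extend hk r).len g := by
    intro g
    refine forall_le_of_concat hR ?_ (fun r hr r' hr' h => (hfold r hr r' hr' h).len_le g)
      fun _ _ _ _ h h' => h'.trans h
    intro r hr r' hr' hrr
    rw [P.extend_len hk hr, P.extend_len hk hr']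
    exact interpolation_anti (hlen0 g) hrr
  have hvlog : ∀ r ∈ Icc 0 (1 + P.finalTime), ∀ r' ∈ Icc 0 (1 + P.finalTime), r ≤ r' →
      0 ≤ Real.log (P.extend hk r).vol - Real.log (P.extend hk r').vol :=
    fun r hr r' hr' hrr => sub_nonneg.2
      (Real.log_le_log (P.extend hk r').vol_pos (hanti r hr r' hr' hrr))
  have hllog : ∀ g : FreeGroup (Fin n), g ≠ 1 → ∀ r ∈ Icc 0 (1 + P.finalTime),
      ∀ r' ∈ Icc 0 (1 + P.finalTime), r ≤ r' →
        0 ≤ Real.log ((P.extend hk r).len g) - Real.log ((P.extend hk r').len g) :=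
    fun g hg r hr r' hr' hrr => sub_nonneg.2
      (Real.log_le_log ((P.extend hk r').len_pos hg) (hlanti g r hr r' hr' hrr))
  have hl : ∀ r ∈ Icc (0 : ℝ) 1, r ∈ Icc 0 (1 + P.finalTime) := fun r hr => ⟨hr.1, hr.2.trans hR⟩
  have hr1 : ∀ r ∈ Icc 1 (1 + P.finalTime), r ∈ Icc 0 (1 + P.finalTime) :=
    fun r hr => ⟨zero_le_one.trans hr.1, hr.2⟩
  have h1l : (1 : ℝ) ∈ Icc (0 : ℝ) 1 := ⟨zero_le_one, le_rfl⟩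
  have h1r : (1 : ℝ) ∈ Icc 1 (1 + P.finalTime) := ⟨le_rfl, hR⟩
  refine ⟨zero_le_one.trans hR, ?_, fun r hr r' hr' => hanti r hr r' hr',
    fun g r hr r' hr' => hlanti g r hr r' hr', ?_, ?_, ?_, ?_, ?_⟩
  · rw [← Icc_union_Icc_eq_Icc zero_le_one hR]
    refine ContinuousOn.union_of_isClosed ?_ ?_ isClosed_Icc isClosed_Icc
    · have hc : ContinuousOn (fun r : ℝ => (1 - r) * (k * A.vol) + r * (P.graph 0).vol)
          (Icc 0 1) := by fun_prop
      exact hc.congr fun r hr => P.extend_vol hk hr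
    · have hc : ContinuousOn (fun r : ℝ => (P.graph (r - 1)).vol) (Icc 1 (1 + P.finalTime)) :=
        (P.continuousOn_vol hε hthick).comp (by fun_prop)
          fun r hr => ⟨by linarith [hr.1], by linarith [hr.2]⟩
      refine hc.congr fun r hr => ?_
      simp only
      rw [P.extend_of_one_le hk hr.1]
  -- The path starts at kA, where the legal loop has length k l_A(g), at most its length in B.
  · obtain ⟨g, hg, h⟩ := P.isOptimal.exists_legal_loop h₀
    refine ⟨g, hg, ?_⟩
    rw [P.extend_len hk ⟨le_rfl, zero_le_one⟩, hlast, P.len_final hε hthick, sub_zero, one_mul,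
      zero_mul, add_zero]
    exact h
  · intro g hg
    obtain ⟨C, hC, h⟩ := exists_log_interpolation_le (hlA g hg) ((P.graph 0).len_pos hg) hkA hG
      (hlen0 g) hvol0 (fun heq => by
        have := (P.isShrinking.equivalent_of_vol_eq P.isOptimal.isPL h₀ heq).len_mul_vol g
        rw [heq] at this
        refine mul_right_cancel₀ hA.ne' (this.trans ?_)
        ring)
    refine ⟨max C (4 / ε), hC.trans (le_max_left _ _), ?_⟩
    refine forall_le_of_concat hR ?_ ?_ ?_
    · intro r hr r' hr' hrr
      have h1 := h r hr r' hr' hrr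
      rw [← P.extend_len hk hr, ← P.extend_len hk hr', ← P.extend_vol hk hr,
        ← P.extend_vol hk hr'] at h1
      exact h1.trans (mul_le_mul_of_nonneg_right (le_max_left _ _)
        (hvlog r (hl r hr) r' (hl r' hr') hrr))
    · intro r hr r' hr' hrr
      exact ((hfold r hr r' hr' hrr).log_le g hg).trans (mul_le_mul_of_nonneg_right
        (le_max_right _ _) (hvlog r (hr1 r hr) r' (hr1 r' hr') hrr))
    · intro r _ r' _ h1 h2
      linarith
  · intro g hg
    have hM : 0 ≤ Real.log (1 / ε + 1) := Real.log_nonneg (by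
      have : 0 < 1 / ε := by positivity
      linarith)
    have hε4 : 0 ≤ 4 / ε := by positivity
    have hL : ∀ r ∈ Icc (0 : ℝ) 1, ∀ r' ∈ Icc (0 : ℝ) 1, r ≤ r' →
        Real.log ((P.extend hk r).len g) - Real.log ((P.extend hk r').len g) ≤
          Real.log (1 / ε + 1) +
            (Real.log (P.extend hk r).vol - Real.log (P.extend hk r').vol) := by
      intro r hr r' hr' hrr
      rw [P.extend_len hk hr, P.extend_len hk hr', P.extend_vol hk hr, P.extend_vol hk hr']
      refine log_interpolation_le hε (hlA g hg) ((P.graph 0).len_pos hg) hkA hG ?_ hr hr' hrr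
      have h1 := hthick' 1 h1r
      rw [P.extend_one hk] at h1
      -- Thickness is known only at the end of the interpolation, which is what the counting bound
      -- needs.
      have h2 := P.isCollapse_shrink.toIsBetween.mul_len_le (δ := ε * (P.graph 0).vol)
        (by positivity) h1 hg
      have h3 := mul_le_mul_of_nonneg_left h2 hk.le
      linarith
    intro r hr r' hr' hrr
    rcases le_total r' 1 with h | h
    · have h1 := hL r ⟨hr.1, hrr.trans h⟩ r' ⟨hr'.1, h⟩ hrr
      have h2 := mul_nonneg hε4 (hvlog r hr r' hr' hrr)
      linarith
    rcases le_total r 1 with h' | h'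
    · have h1 := hL r ⟨hr.1, h'⟩ 1 h1l h'
      have h2 := (hfold 1 h1r r' ⟨h, hr'.2⟩ h).log_le g hg
      have h3 := mul_nonneg hε4 (hvlog r hr 1 (hl 1 h1l) h')
      have h4 := hvlog 1 (hl 1 h1l) r' hr' h
      linarith
    · have h1 := (hfold r ⟨h', hr.2⟩ r' ⟨h, hr'.2⟩ hrr).log_le g hg
      have h2 := hvlog r hr r' hr' hrr
      linarith
  · have hM := abs_nonneg (Real.log (ε / 2))
    have hL : ∃ g : FreeGroup (Fin n), g ≠ 1 ∧ ∀ r ∈ Icc (0 : ℝ) 1, ∀ r' ∈ Icc (0 : ℝ) 1, r ≤ r' →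
        Real.log (P.extend hk r).vol - Real.log (P.extend hk r').vol ≤
          Real.log ((P.extend hk r).len g) - Real.log ((P.extend hk r').len g) := by
      obtain ⟨g, hg, h⟩ := P.isCollapse_shrink.exists_len_mul_vol_le
      refine ⟨g, hg, fun r hr r' hr' hrr => ?_⟩
      rw [P.extend_len hk hr, P.extend_len hk hr', P.extend_vol hk hr, P.extend_vol hk hr']
      refine log_le_log_interpolation (hlA g hg) ((P.graph 0).len_pos hg) hkA hG ?_ hr hr' hrr
      have h1 := mul_le_mul_of_nonneg_left h hk.le
      linarith
    have hF : ∀ r ∈ Icc 1 (1 + P.finalTime), ∀ r' ∈ Icc 1 (1 + P.finalTime), r ≤ r' →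
        ∃ g : FreeGroup (Fin n), g ≠ 1 ∧
        Real.log (P.extend hk r).vol - Real.log (P.extend hk r').vol - |Real.log (ε / 2)| ≤
          Real.log ((P.extend hk r).len g) - Real.log ((P.extend hk r').len g) := by
      intro r hr r' hr' _
      -- A loop that is short at the later time r' cannot have been short at the time r, by
      -- thickness there.
      obtain ⟨g, hg, h⟩ := (P.extend hk r').exists_len_le_vol
      refine ⟨g, hg, ?_⟩
      have hv := (P.extend hk r).vol_pos
      have hv' := (P.extend hk r').vol_pos
      have h1 := Real.log_le_log (by positivity) (hthick' r hr g hg)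
      have h2 := Real.log_le_log ((P.extend hk r').len_pos hg) h
      rw [Real.log_mul hε.ne' hv.ne'] at h1
      rw [Real.log_mul two_ne_zero hv'.ne'] at h2
      have h3 := neg_abs_le (Real.log (ε / 2))
      rw [Real.log_div hε.ne' two_ne_zero] at h3 ⊢
      linarith
    intro r hr r' hr' hrr
    have hx := hvlog r hr r' hr' hrr
    obtain ⟨g, hg, hL⟩ := hL
    rcases le_total r' 1 with h | h
    · have h1 := hL r ⟨hr.1, hrr.trans h⟩ r' ⟨hr'.1, h⟩ hrr
      exact ⟨g, hg, by linarith⟩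
    rcases le_total r 1 with h' | h'
    · have h1 := hL r ⟨hr.1, h'⟩ 1 h1l h'
      obtain ⟨g', hg', h2⟩ := hF 1 h1r r' ⟨h, hr'.2⟩ h
      -- The phase with the larger drop of log vol supplies the loop; in the other phase the length
      -- of that loop does not increase.
      rcases le_total (Real.log (P.extend hk 1).vol - Real.log (P.extend hk r').vol)
        (Real.log (P.extend hk r).vol - Real.log (P.extend hk 1).vol) with h3 | h3
      · have h4 := hllog g hg 1 (hl 1 h1l) r' hr' h
        exact ⟨g, hg, by linarith⟩
      · have h4 := hllog g' hg' r hr 1 (hl 1 h1l) h'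
        exact ⟨g', hg', by linarith⟩
    · obtain ⟨g', hg', h2⟩ := hF r ⟨h', hr.2⟩ r' ⟨h, hr'.2⟩ hrr
      exact ⟨g', hg', by linarith⟩
  · intro hv
    have h0l : (0 : ℝ) ∈ Icc (0 : ℝ) 1 := ⟨le_rfl, zero_le_one⟩
    have hRr : 1 + P.finalTime ∈ Icc 1 (1 + P.finalTime) := ⟨hR, le_rfl⟩
    have h1 := hanti 0 (hl 0 h0l) 1 (hl 1 h1l) zero_le_one
    have h2 := (hfold 1 h1r _ hRr hR).vol_le
    have h3 := (hfold 1 h1r _ hRr hR).equivalent (by linarith)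
    have h4 : (P.extend hk 1).vol = (P.extend hk 0).vol := by linarith
    rw [P.extend_one, P.extend_vol hk h0l, sub_zero, one_mul, zero_mul, add_zero] at h4
    have h5 := P.isShrinking.equivalent_of_vol_eq P.isOptimal.isPL h₀ h4
    rw [← P.extend_one hk] at h5
    exact (P.extend_zero_equivalent hk).symm.trans (h5.trans h3)

end FastFoldingPath

end OuterSpace

theorem mainTheorem10 (n : ℕ) (ε : ℝ) (hε : 0 < ε) :
    ∃ K L : ℝ, 1 ≤ K ∧ 0 ≤ L ∧
      ∀ (A B : OuterSpace.MarkedTree n) (f : A → B) (P : OuterSpace.FastFoldingPath A B f),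
        (∀ t ∈ Set.Icc 0 P.finalTime, (P.graph t).cls ∈ OuterSpace.CV.thick n ε) →
        ∃ α : ℝ → OuterSpace.CV n,
          OuterSpace.CV.IsRightGeodesic α A.cls B.cls ∧
          OuterSpace.CV.IsQuasiGeodesicOn α
            (Set.Icc 0 (OuterSpace.CV.dR A.cls B.cls)) K L := by
  refine ⟨max 2 (1 + 4 / ε), max (Real.log (1 / ε + 1)) |Real.log (ε / 2)|,
    one_le_two.trans (le_max_left _ _), (abs_nonneg _).trans (le_max_right _ _), ?_⟩
  intro A B f P hthick
  obtain ⟨v₀, w₀, h₀⟩ := P.isOptimal.isPL.exists_isMaxEdge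
  have hk := P.isOptimal.isPL.stretch_pos h₀
  have hA : A.cls = (P.extend hk 0).cls := Quotient.sound (P.extend_zero_equivalent hk)
  have hB : B.cls = (P.extend hk (1 + P.finalTime)).cls := by
    rw [P.extend_of_one_le hk (by linarith [P.finalTime_nonneg hε hthick]), add_sub_cancel_left]
    exact Quotient.sound (P.final_equivalent hε hthick).symm
  rw [hA, hB]
  exact (P.isStretchPath_extend hε hthick h₀).exists_rightGeodesic
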